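/- Let $G=(V,E)$ be a finite simple graph. A set $M\subseteq V$ is a module if $N(v)\setminus M=N(w)\setminus M$ for all $v,w\in M$; a module is strong if it is disjoint from, contained in, or contains every other module. The nodes of the modular decomposition tree of $G$ are the nonempty strong modules of $G$. For a node $M$ with $|M|\ge 2$, let $\Pi_{mod}(G[M])$ be the partition of $M$ into the inclusion-maximal nonempty proper strong modules of $G[M]$, and let $G^q_M=G[M]/\Pi_{mod}(G[M])$ be the quotient graph, whose vertices are the parts, two distinct parts being adjacent if some edge of $G$ joins them. The node $M$ is prime if the only modules of $G^q_M$ are $\emptyset$, the whole vertex set and the singletons, and $G^q_M$ is neither edgeless nor complete (i.e. $M$ is neither a parallel nor a series node). In the (Node) Steiner Tree problem we are given $G$, a set of terminals $K\subseteq V$, costs $\mathbf c\colon V\to\mathbb N\setminus\{0\}$ and an integer $\overline b$, and have to decide whether there is a set $X\subseteq V$ such that $K\subseteq X$, $G[X]$ is connected (the empty graph counts as connected) and $\sum_{v\in X}\mathbf c(v)\le\overline b$. Theorem. There is a randomised algorithm (a program for a random access machine with logarithmic cost and fair coin tosses) with the following property. For every polynomial $q$ there is a polynomial $p$ such that, for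 every $k\in\mathbb N$ and every input consisting of a Steiner Tree instance $(G,K,\mathbf c,\overline b)$ with $\mathbf c(v)\le q(|V|)$ for all $v\in V$, together with a tree decomposition of width at most $k$ of $G^q_M$ for every prime node $M$ of the modular decomposition of $G$: 1. for every outcome of the coin tosses, the algorithm halts within time $p(s)\cdot 3^k$, where $s$ is the size of the input (so it runs in time $O^*(3^k)$); 2. if the answer to the instance is no, the algorithm never answers yes; 3. if the answer to the instance is yes, the algorithm fails to answer yes with probability at most $1/2$. -/

import Mathlib

/-! ### Modules and the modular decomposition of a graph -/

namespace ModularDecomposition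

/-- `M` is a module: all its members have the same neighbours outside `M`. -/
def IsModule {V : Type*} (G : SimpleGraph V) (M : Set V) : Prop :=
  ∀ v ∈ M, ∀ w ∈ M, G.neighborSet v \ M = G.neighborSet w \ M

/-- A strong module overlaps no module: it is disjoint from, contained in, or contains each one. -/
def IsStrongModule {V : Type*} (G : SimpleGraph V) (M : Set V) : Prop :=
  IsModule G M ∧ ∀ M' : Set V, IsModule G M' → M ∩ M' = ∅ ∨ M ⊆ M' ∨ M' ⊆ M

/-- The nodes of the modular decomposition tree: the nonempty strong modules. -/
def treeNodes {V : Type*} (G : SimpleGraph V) : Set (Set V) :=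
  {M | IsStrongModule G M ∧ M.Nonempty}

/-- The canonical modular partition: the inclusion-maximal nonempty proper strong modules. -/
def canonicalPartition {V : Type*} (G : SimpleGraph V) : Set (Set V) :=
  {M | Maximal (fun N => IsStrongModule G N ∧ N.Nonempty ∧ N ≠ Set.univ) M}

/-- The quotient of `G` by a family `P` of vertex sets (usually a partition of the vertices). -/
def quotientGraph {V : Type*} (G : SimpleGraph V) (P : Set (Set V)) : SimpleGraph P where
  Adj A B := A ≠ B ∧ ∃ u ∈ (A : Set V), ∃ v ∈ (B : Set V), G.Adj u v
  symm := ⟨fun _ _ h => ⟨h.1.symm, by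
    obtain ⟨u, hu, v, hv, huv⟩ := h.2
    exact ⟨v, hv, u, hu, huv.symm⟩⟩⟩
  loopless := ⟨fun _ h => h.1 rfl⟩

/-- The quotient graph at a node `M`: the quotient of `G[M]` by its canonical modular partition. -/
def nodeQuotient {V : Type*} (G : SimpleGraph V) (M : Set V) :
    SimpleGraph (canonicalPartition (G.induce M)) :=
  quotientGraph (G.induce M) (canonicalPartition (G.induce M))

/-- All modules of `G` are trivial. -/
def HasOnlyTrivialModules {V : Type*} (G : SimpleGraph V) : Prop :=
  ∀ M : Set V, IsModule G M → M = ∅ ∨ M = Set.univ ∨ ∃ v, M = {v}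

/-- `M` is a prime node: a non-leaf node of the modular decomposition tree whose quotient graph is
prime. The quotient of a parallel node is edgeless and that of a series node is complete, so the
last two conditions say that a node with a quotient on two vertices counts as parallel or series,
not as prime. -/
def IsPrimeNode {V : Type*} (G : SimpleGraph V) (M : Set V) : Prop :=
  M ∈ treeNodes G ∧ M.Nontrivial ∧ HasOnlyTrivialModules (nodeQuotient G M) ∧
    nodeQuotient G M ≠ ⊥ ∧ nodeQuotient G M ≠ ⊤

end ModularDecomposition

/-- A tree decomposition of `H`. -/
structure TreeDecomposition {V : Type*} (H : SimpleGraph V) where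
  /-- number of nodes of the tree -/
  size : ℕ
  tree : SimpleGraph (Fin size)
  isTree : tree.IsTree
  bag : Fin size → Set V
  exists_mem_bag : ∀ v, ∃ t, v ∈ bag t
  exists_edge_bag : ∀ v w, H.Adj v w → ∃ t, v ∈ bag t ∧ w ∈ bag t
  connected : ∀ v, (tree.induce {t | v ∈ bag t}).Connected

/-- The width: the largest size of a bag, minus one. -/
noncomputable def TreeDecomposition.width {V : Type*} {H : SimpleGraph V}
    (D : TreeDecomposition H) : ℕ :=
  (Finset.univ.sup fun t => (D.bag t).ncard) - 1

/-- A prime node of the modular decomposition of `G` with a tree decomposition of its quotient. -/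
structure PrimeNodeDecomposition {V : Type*} (G : SimpleGraph V) where
  node : Set V
  isPrimeNode : ModularDecomposition.IsPrimeNode G node
  decomposition : TreeDecomposition (ModularDecomposition.nodeQuotient G node)

/-! ### Steiner Tree -/

/-- An instance of (node-weighted) Steiner Tree. -/
structure SteinerInstance where
  /-- number of vertices -/
  n : ℕ
  graph : SimpleGraph (Fin n)
  terminals : Finset (Fin n)
  cost : Fin n → ℕ
  cost_pos : ∀ v, 0 < cost v
  budget : ℤ

/-- Some connected vertex set contains all terminals and costs at most the budget. (The graph
without vertices counts as connected.) -/
def SteinerInstance.HasSolution (I : SteinerInstance) : Prop :=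
  ∃ X : Finset (Fin I.n), I.terminals ⊆ X ∧ (I.graph.induce (X : Set (Fin I.n))).Preconnected ∧
    ((∑ v ∈ X, I.cost v : ℕ) : ℤ) ≤ I.budget

/-- A Steiner Tree instance with a tree decomposition for every prime node. -/
structure SteinerInput extends SteinerInstance where
  decompositions : List (PrimeNodeDecomposition graph)
  complete : ∀ M, ModularDecomposition.IsPrimeNode graph M → ∃ D ∈ decompositions, D.node = M

/-! ### Encoding of the input as a list of natural numbers -/

open Classical in
/-- The truth value of `p` as a number. -/
noncomputable def propBit (p : Prop) : ℕ := if p then 1 else 0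

/-- The 0-1 matrix of a relation, row by row. -/
noncomputable def matrixBits {a b : ℕ} (R : Fin a → Fin b → Prop) : List ℕ :=
  (List.finRange a).flatMap fun i => (List.finRange b).map fun j => propBit (R i j)

/-- A prime node with its tree decomposition is given by the relation of lying in the same child
module (which describes the vertices of the quotient graph), the number of nodes of the tree,
the adjacency matrix of the tree, and, for each bag, the vertices lying in the modules of the bag. -/
noncomputable def PrimeNodeDecomposition.encode {n : ℕ} {G : SimpleGraph (Fin n)}
    (D : PrimeNodeDecomposition G) : List ℕ :=
  matrixBits (fun u v : Fin n =>
      ∃ N ∈ ModularDecomposition.canonicalPartition (G.induce D.node),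
        u ∈ Subtype.val '' N ∧ v ∈ Subtype.val '' N) ++
    [D.decomposition.size] ++
    matrixBits D.decomposition.tree.Adj ++
    matrixBits (fun (t : Fin D.decomposition.size) (v : Fin n) =>
      ∃ N ∈ D.decomposition.bag t, v ∈ Subtype.val '' (N : Set D.node))

/-- The input as a list: number of vertices, adjacency matrix, terminals, costs, sign and absolute
value of the budget, number of decompositions, decompositions. -/
noncomputable def SteinerInput.encode (I : SteinerInput) : List ℕ :=
  [I.n] ++ matrixBits I.graph.Adj ++
    (List.finRange I.n).map (fun v => propBit (v ∈ I.terminals)) ++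
    (List.finRange I.n).map I.cost ++
    [propBit (I.budget < 0), I.budget.natAbs] ++
    [I.decompositions.length] ++ I.decompositions.flatMap PrimeNodeDecomposition.encode

/-! ### Randomised random access machines with logarithmic cost -/

namespace RAM

/-- The length of a number: its number of binary digits, plus one. -/
def len (x : ℕ) : ℕ := Nat.size x + 1

/-- Binary operations on natural numbers (truncated subtraction, integer division). -/
inductive Op
  | add
  | sub
  | mul
  | div
  | mod
  | eq
  | lt

def Op.eval : Op → ℕ → ℕ → ℕ
  | .add, x, y => x + y
  | .sub, x, y => x - y
  | .mul, x, y => x * y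
  | .div, x, y => x / y
  | .mod, x, y => x % y
  | .eq, x, y => if x = y then 1 else 0
  | .lt, x, y => if x < y then 1 else 0

/-- A state: registers, memory (array `a` has the cells `mem a 0`, `mem a 1`, …), and the random
bits that have not been used yet. A program mentions only finitely many registers and arrays. -/
structure State where
  reg : ℕ → ℕ
  mem : ℕ → ℕ → ℕ
  coins : ℕ → Bool

/-- Expressions; `read a e` is the cell of array `a` whose index is the value of `e`. -/
inductive Expr
  | const (x : ℕ)
  | reg (r : ℕ)
  | read (a : ℕ) (e : Expr)
  | op (o : Op) (e₁ e₂ : Expr)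

def Expr.eval (s : State) : Expr → ℕ
  | .const x => x
  | .reg r => s.reg r
  | .read a e => s.mem a (e.eval s)
  | .op o e₁ e₂ => o.eval (e₁.eval s) (e₂.eval s)

/-- Logarithmic cost: every access and every operation costs the lengths of the numbers and of the
addresses that it handles. -/
def Expr.cost (s : State) : Expr → ℕ
  | .const x => len x
  | .reg r => len (s.reg r)
  | .read a e => e.cost s + len (e.eval s) + len (s.mem a (e.eval s))
  | .op _ e₁ e₂ => e₁.cost s + e₂.cost s + len (e₁.eval s) + len (e₂.eval s)

/-- Programs; `flip r` stores a random bit in register `r`. -/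
inductive Program
  | skip
  | assign (r : ℕ) (e : Expr)
  | write (a : ℕ) (i e : Expr)
  | flip (r : ℕ)
  | seq (c₁ c₂ : Program)
  | ite (e : Expr) (c₁ c₂ : Program)
  | loop (e : Expr) (c : Program)

def State.setReg (s : State) (r x : ℕ) : State :=
  { s with reg := Function.update s.reg r x }

def State.setMem (s : State) (a i x : ℕ) : State :=
  { s with mem := Function.update s.mem a (Function.update (s.mem a) i x) }

/-- `Exec c s s' t`: the program `c`, started in `s`, halts in `s'` after time `t`. -/
inductive Exec : Program → State → State → ℕ → Prop
  | skip (s) : Exec .skip s s 1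
  | assign (r e s) : Exec (.assign r e) s (s.setReg r (e.eval s)) (e.cost s + len (e.eval s))
  | write (a i e s) : Exec (.write a i e) s (s.setMem a (i.eval s) (e.eval s))
      (i.cost s + e.cost s + len (i.eval s) + len (e.eval s))
  | flip (r s) : Exec (.flip r) s
      { s.setReg r (s.coins 0).toNat with coins := fun j => s.coins (j + 1) } 1
  | seq {c₁ c₂ s s' s'' t₁ t₂} : Exec c₁ s s' t₁ → Exec c₂ s' s'' t₂ →
      Exec (.seq c₁ c₂) s s'' (t₁ + t₂)
  | ite_true {e c₁ c₂ s s' t} : e.eval s ≠ 0 → Exec c₁ s s' t →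
      Exec (.ite e c₁ c₂) s s' (e.cost s + t)
  | ite_false {e c₁ c₂ s s' t} : e.eval s = 0 → Exec c₂ s s' t →
      Exec (.ite e c₁ c₂) s s' (e.cost s + t)
  | loop_true {e c s s' s'' t₁ t₂} : e.eval s ≠ 0 → Exec c s s' t₁ →
      Exec (.loop e c) s' s'' t₂ → Exec (.loop e c) s s'' (e.cost s + t₁ + t₂)
  | loop_false {e c s} : e.eval s = 0 → Exec (.loop e c) s s (e.cost s)

/-- The start: the input in array `0`, everything else zero. -/
def init (x : List ℕ) (ω : ℕ → Bool) : State where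
  reg _ := 0
  mem a i := if a = 0 then x.getD i 0 else 0
  coins := ω

/-- On input `x` with random bits `ω`, the program halts within time `T`. -/
def HaltsWithin (P : Program) (x : List ℕ) (ω : ℕ → Bool) (T : ℕ) : Prop :=
  ∃ s t, Exec P (init x ω) s t ∧ t ≤ T

/-- On input `x` with random bits `ω`, the program halts and answers yes: `1` in register `0`. -/
def Accepts (P : Program) (x : List ℕ) (ω : ℕ → Bool) : Prop :=
  ∃ s t, Exec P (init x ω) s t ∧ s.reg 0 = 1

/-- The size of an input: the total length of its numbers. -/
def inputSize (x : List ℕ) : ℕ := (x.map len).sum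

/-- The law of a sequence of independent fair coin tosses. -/
noncomputable def fairCoins : MeasureTheory.Measure (ℕ → Bool) :=
  MeasureTheory.Measure.infinitePi fun _ => (PMF.uniformOfFintype Bool).toMeasure

end RAM

/-! ### A structured language with bounded sums and products, compiled to RAM programs -/

namespace RAM

/-! Let `X` be a connected set containing the terminals `K`, where `K` has at least two elements,
and let `M` be the smallest strong module containing `K`. If `X` leaves `M`, then some vertex of `X`
outside `M` has a neighbour in `M`; it is adjacent to all of `M`, so `K` together with this vertex
is connected. If `X ⊆ M`, then `G[M]` is connected, because a component containing `K` would be a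
smaller strong module. If moreover the complement of `G[M]` is disconnected, then `K` meets two
co-components and is connected by itself. Otherwise Gallai's theorem (`quotient_prime`) says that
`M` is a prime node, and `K` meets at least two parts. This is `terminals_trichotomy`; the first two
kinds of solution are tested directly.

In the prime case a part may be replaced by its terminals or, if it has none, by its cheapest
vertex: connected sets pass between `G[M]` and the quotient without increase of cost
(`lift_solution`, `project_solution`). What remains is Steiner Tree in a graph with a tree
decomposition of width `k`, and this is solved by Cut and Count. A set `X` and a cut of `X` without
crossing edges form a colouring with three colours. With one terminal fixed on the first side, the
number of cuts of `X` is one if `X` is connected and even otherwise (`card_cuts_of_connected`,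
`even_card_cuts`). Hence an odd number of cuts of given cost and weight always certifies a solution.
Conversely, random weights single out one solution of minimum weight with probability at least one
half (`isolation`), and then some number is odd.

The numbers for all costs and weights are packed into one integer, a sum of powers of a base so
large that the parities can be read off (`sum_pow_digit`). This sum over colourings is a product of
factors local to the bags. It is computed by eliminating the leaves of the tree one after another
(`totalSum_erase`), at the price of `3 ^ (k + 1)` colourings per bag and polynomial time per
colouring. All arithmetic is done modulo a number larger than the result.

For the running time, the program is written in a small language of expressions and commands that is
compiled to the machine. A static analysis (`infer`, `check`) bounds all numbers and all times by
powers of a parameter `S`; it is sound (`infer_computes`, `check_sound`) and is run by evaluation on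
the concrete program. The only loop that is not polynomially long runs through the colourings of a
bag. -/

theorem Exec.det {c : Program} {s s₁ s₂ : State} {t₁ t₂ : ℕ} (h₁ : Exec c s s₁ t₁)
    (h₂ : Exec c s s₂ t₂) : s₁ = s₂ := by
  induction h₁ generalizing s₂ t₂ with
  | skip => cases h₂; rfl
  | assign => cases h₂; rfl
  | write => cases h₂; rfl
  | flip => cases h₂; rfl
  | seq _ _ ih₁ ih₂ =>
    cases h₂ with
    | seq ha hb => obtain rfl := ih₁ ha; exact ih₂ hb
  | ite_true he _ ih =>
    cases h₂ with
    | ite_true _ h => exact ih h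
    | ite_false h _ => exact absurd h he
  | ite_false he _ ih =>
    cases h₂ with
    | ite_true h _ => exact absurd he h
    | ite_false _ h => exact ih h
  | loop_true he _ _ ih₁ ih₂ =>
    cases h₂ with
    | loop_true _ ha hb => obtain rfl := ih₁ ha; exact ih₂ hb
    | loop_false h => exact absurd h he
  | loop_false he =>
    cases h₂ with
    | loop_true h _ _ => exact absurd he h
    | loop_false => rfl

/-- Expressions with bounded sums and products; `sum r N e` is the sum of the values of `e` as the
variable `r` runs through the numbers below `N`. -/
inductive Ex
  | const (x : ℕ)
  | var (r : ℕ)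
  | read (a : ℕ) (e : Ex)
  | op (o : Op) (e₁ e₂ : Ex)
  | cond (e₁ e₂ e₃ : Ex)
  | sum (r : ℕ) (N e : Ex)
  | prod (r : ℕ) (N e : Ex)

def Ex.eval (μ : ℕ → ℕ → ℕ) : Ex → (ℕ → ℕ) → ℕ
  | .const x, _ => x
  | .var r, ρ => ρ r
  | .read a e, ρ => μ a (e.eval μ ρ)
  | .op o e₁ e₂, ρ => o.eval (e₁.eval μ ρ) (e₂.eval μ ρ)
  | .cond e₁ e₂ e₃, ρ => if e₁.eval μ ρ ≠ 0 then e₂.eval μ ρ else e₃.eval μ ρ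
  | .sum r N e, ρ => ∑ i ∈ Finset.range (N.eval μ ρ), e.eval μ (Function.update ρ r i)
  | .prod r N e, ρ => ∏ i ∈ Finset.range (N.eval μ ρ), e.eval μ (Function.update ρ r i)

/-- Variable `r` is kept in register `2 * r`; the odd registers serve as a stack. -/
def tmp (d : ℕ) : ℕ := 2 * d + 1

/-- Stack layout: `tmp d` holds the bound, `tmp (d + 1)` the accumulator and `tmp (d + 2)` the outer
value of the bound variable, which is restored at the end; the body works from `tmp (d + 3)` on. -/
def bigOp (o : Op) (x r : ℕ) (cN ce : Program) (d : ℕ) : Program :=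
  .seq cN <| .seq (.assign (tmp (d + 1)) (.const x)) <|
    .seq (.assign (tmp (d + 2)) (.reg (2 * r))) <| .seq (.assign (2 * r) (.const 0)) <|
    .seq (.loop (.op .lt (.reg (2 * r)) (.reg (tmp d))) <|
      .seq ce <| .seq (.assign (tmp (d + 1)) (.op o (.reg (tmp (d + 1))) (.reg (tmp (d + 3)))))
        (.assign (2 * r) (.op .add (.reg (2 * r)) (.const 1)))) <|
    .seq (.assign (2 * r) (.reg (tmp (d + 2)))) (.assign (tmp d) (.reg (tmp (d + 1))))

/-- Compiled code leaves the value in `tmp d` and uses no `tmp i` with `i < d`. -/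
def Ex.comp : Ex → ℕ → Program
  | .const x, d => .assign (tmp d) (.const x)
  | .var r, d => .assign (tmp d) (.reg (2 * r))
  | .read a e, d => .seq (e.comp d) (.assign (tmp d) (.read a (.reg (tmp d))))
  | .op o e₁ e₂, d => .seq (e₁.comp d) <| .seq (e₂.comp (d + 1)) <|
      .assign (tmp d) (.op o (.reg (tmp d)) (.reg (tmp (d + 1))))
  | .cond e₁ e₂ e₃, d => .seq (e₁.comp d) (.ite (.reg (tmp d)) (e₂.comp d) (e₃.comp d))
  | .sum r N e, d => bigOp .add 0 r (N.comp d) (e.comp (d + 3)) d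
  | .prod r N e, d => bigOp .mul 1 r (N.comp d) (e.comp (d + 3)) d

/-- Sizes of numbers relative to a parameter `S`: at most `S ^ e`, or at most `2 ^ S ^ e`. -/
inductive Kd
  | sm (e : ℕ)
  | bg (e : ℕ)

namespace Kd

def exp : Kd → ℕ
  | sm e => e
  | bg e => e

def bd (S : ℕ) : Kd → ℕ
  | sm e => S ^ e
  | bg e => 2 ^ S ^ e

def le : Kd → Kd → Bool
  | sm a, sm b => a ≤ b
  | sm a, bg b => a ≤ b
  | bg a, bg b => a ≤ b
  | bg _, sm _ => false

def join : Kd → Kd → Kd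
  | sm a, sm b => sm (max a b)
  | a, b => bg (max a.exp b.exp)

/-- Since `2 ≤ S`, one more unit in the exponent pays for a factor two. This covers the sum of two
small numbers, and sums and products of large ones, where the logarithms add. -/
def add : Kd → Kd → Kd
  | sm a, sm b => sm (max a b + 1)
  | a, b => bg (max a.exp b.exp + 1)

def mul : Kd → Kd → Kd
  | sm a, sm b => sm (a + b)
  | a, b => bg (max a.exp b.exp + 1)

def sumK (a : ℕ) : Kd → Kd
  | sm b => sm (a + b)
  | bg b => bg (a + b + 1)

variable {S : ℕ}

theorem pow_mono_exp (hS : 2 ≤ S) {a b : ℕ} (h : a ≤ b) : S ^ a ≤ S ^ b :=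
  Nat.pow_le_pow_right (by omega) h

theorem bd_le_big (k : Kd) : k.bd S ≤ 2 ^ S ^ k.exp := by
  cases k with
  | sm e => exact Nat.lt_two_pow_self.le
  | bg e => exact le_rfl

theorem bd_le_bg (hS : 2 ≤ S) (k : Kd) {b : ℕ} (h : k.exp ≤ b) : k.bd S ≤ 2 ^ S ^ b :=
  k.bd_le_big.trans (Nat.pow_le_pow_right (by omega) (pow_mono_exp hS h))

theorem bd_mono (hS : 2 ≤ S) {k l : Kd} (h : k.le l = true) : k.bd S ≤ l.bd S := by
  cases k <;> cases l <;> simp only [le, decide_eq_true_eq, Bool.false_eq_true] at h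
  · exact pow_mono_exp hS h
  · exact bd_le_bg hS _ h
  · exact bd_le_bg hS _ h

theorem le_join (hS : 2 ≤ S) (k l : Kd) : k.bd S ≤ (k.join l).bd S ∧ l.bd S ≤ (k.join l).bd S := by
  cases k <;> cases l <;> simp only [join]
  · exact ⟨pow_mono_exp hS (le_max_left _ _), pow_mono_exp hS (le_max_right _ _)⟩
  all_goals exact ⟨bd_le_bg hS _ (le_max_left _ _), bd_le_bg hS _ (le_max_right _ _)⟩

theorem two_mul_pow_le (hS : 2 ≤ S) (a : ℕ) : S ^ a + S ^ a ≤ S ^ (a + 1) := by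
  rw [pow_succ]; nlinarith [Nat.zero_le (S ^ a)]

theorem big_add (hS : 2 ≤ S) {x y a b : ℕ} (hx : x ≤ 2 ^ S ^ a) (hy : y ≤ 2 ^ S ^ b) :
    x + y ≤ 2 ^ S ^ (max a b + 1) ∧ x * y ≤ 2 ^ S ^ (max a b + 1) := by
  have hx' : x ≤ 2 ^ S ^ max a b :=
    hx.trans (Nat.pow_le_pow_right (by omega) (pow_mono_exp hS (le_max_left _ _)))
  have hy' : y ≤ 2 ^ S ^ max a b :=
    hy.trans (Nat.pow_le_pow_right (by omega) (pow_mono_exp hS (le_max_right _ _)))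
  have h2 : 2 ^ (S ^ max a b + S ^ max a b) ≤ 2 ^ S ^ (max a b + 1) :=
    Nat.pow_le_pow_right (by omega) (two_mul_pow_le hS _)
  rw [pow_add] at h2
  have h3 : 2 ≤ 2 ^ S ^ max a b := by
    calc 2 = 2 ^ 1 := rfl
      _ ≤ _ := Nat.pow_le_pow_right (by omega) (Nat.one_le_pow _ _ (by omega))
  exact ⟨by nlinarith, (Nat.mul_le_mul hx' hy').trans h2⟩

theorem add_bd (hS : 2 ≤ S) {k l : Kd} {x y : ℕ} (hx : x ≤ k.bd S) (hy : y ≤ l.bd S) :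
    x + y ≤ (k.add l).bd S := by
  have key := (big_add hS (hx.trans k.bd_le_big) (hy.trans l.bd_le_big)).1
  cases k <;> cases l <;> simp only [add, exp] at key ⊢ <;> try exact key
  rename_i a b
  have h1 := pow_mono_exp hS (le_max_left a b)
  have h2 := pow_mono_exp hS (le_max_right a b)
  have h3 := two_mul_pow_le hS (max a b)
  simp only [bd] at *
  omega

theorem mul_bd (hS : 2 ≤ S) {k l : Kd} {x y : ℕ} (hx : x ≤ k.bd S) (hy : y ≤ l.bd S) :
    x * y ≤ (k.mul l).bd S := by
  have key := (big_add hS (hx.trans k.bd_le_big) (hy.trans l.bd_le_big)).2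
  cases k <;> cases l <;> simp only [mul, exp] at key ⊢ <;> try exact key
  simp only [bd, pow_add] at *
  exact Nat.mul_le_mul hx hy

theorem sum_bd (hS : 2 ≤ S) {k : Kd} {a n : ℕ} {f : ℕ → ℕ} (hn : n ≤ S ^ a)
    (hf : ∀ i < n, f i ≤ k.bd S) : ∑ i ∈ Finset.range n, f i ≤ (sumK a k).bd S := by
  have h : ∑ i ∈ Finset.range n, f i ≤ n * k.bd S := by
    simpa using Finset.sum_le_card_nsmul (Finset.range n) f (k.bd S)
      fun i hi => hf i (Finset.mem_range.1 hi)
  refine h.trans ?_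
  cases k with
  | sm b => simp only [sumK, bd, pow_add]; exact Nat.mul_le_mul_right _ hn
  | bg b =>
    have h1 : n ≤ 2 ^ S ^ a := hn.trans Nat.lt_two_pow_self.le
    refine (big_add hS h1 (le_refl (2 ^ S ^ b))).2.trans ?_
    exact Nat.pow_le_pow_right (by omega) (pow_mono_exp hS (by omega))

theorem prod_bd (hS : 2 ≤ S) {k : Kd} {a n : ℕ} {f : ℕ → ℕ} (hn : n ≤ S ^ a)
    (hf : ∀ i < n, f i ≤ k.bd S) :
    ∏ i ∈ Finset.range n, f i ≤ (bg (a + k.exp)).bd S := by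
  have h : ∏ i ∈ Finset.range n, f i ≤ (2 ^ S ^ k.exp) ^ n := by
    simpa using Finset.prod_le_pow_card (Finset.range n) f (2 ^ S ^ k.exp)
      fun i hi => (hf i (Finset.mem_range.1 hi)).trans k.bd_le_big
  refine h.trans ?_
  rw [← pow_mul]
  refine Nat.pow_le_pow_right (by omega) ?_
  rw [pow_add, mul_comm]
  exact Nat.mul_le_mul_right _ hn

theorem len_le (hS : 2 ≤ S) {k : Kd} {x b : ℕ} (hx : x ≤ k.bd S) (hb : k.exp + 2 ≤ b) :
    len x ≤ S ^ b := by
  have h1 : x < 2 ^ (S ^ k.exp + 1) :=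
    (hx.trans k.bd_le_big).trans_lt (Nat.pow_lt_pow_right (by omega) (by omega))
  have h2 : Nat.size x ≤ S ^ k.exp + 1 := Nat.size_le.2 h1
  have h3 : 1 ≤ S ^ k.exp := Nat.one_le_pow _ _ (by omega)
  have h4 : S ^ (k.exp + 2) ≤ S ^ b := pow_mono_exp hS hb
  have h5 := two_mul_pow_le hS k.exp
  have h6 : S ^ (k.exp + 1) + S ^ (k.exp + 1) ≤ S ^ (k.exp + 2) := two_mul_pow_le hS _
  unfold len
  omega

end Kd

/-- A remainder is bounded by the divisor only if the divisor is positive, as `x % 0 = x`. A divisor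
of the form `e + (x + 1)` is visibly positive; reduction modulo such a divisor is the way to make a
number short again. -/
def opKd : Op → Ex → Kd → Kd → Kd
  | .add, _, k, l => k.add l
  | .mul, _, k, l => k.mul l
  | .sub, _, k, _ => k
  | .div, _, k, _ => k
  | .mod, .op .add _ (.const (_ + 1)), _, l => l
  | .mod, _, k, _ => k
  | .eq, _, _, _ => .sm 0
  | .lt, _, _, _ => .sm 0

/-- A bound for the value, and an exponent `A` such that evaluation takes time at most `S ^ A`. -/
def infer (Δ : ℕ → Kd) : Ex → (ℕ → Kd) → Option (Kd × ℕ)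
  -- `x ≤ 2 ^ (x - 1) ≤ S ^ (x - 1)`, so that the constants 0 and 1 have exponent 0.
  | .const x, _ => some (.sm (x - 1), x + 5)
  | .var r, Γ => some (Γ r, (Γ r).exp + 5)
  | .read a e, Γ =>
    match infer Δ e Γ with
    | none => none
    | some (k, A) => some (Δ a, max A (max (k.exp + 2) ((Δ a).exp + 2)) + 3)
  | .op o e₁ e₂, Γ =>
    match infer Δ e₁ Γ, infer Δ e₂ Γ with
    | some (k, A), some (l, B) =>
      some (opKd o e₂ k l,
        max A (max B (max (k.exp + 2) (max (l.exp + 2) ((opKd o e₂ k l).exp + 2)))) + 3)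
    | _, _ => none
  | .cond e₁ e₂ e₃, Γ =>
    match infer Δ e₁ Γ, infer Δ e₂ Γ, infer Δ e₃ Γ with
    | some (k, A), some (l, B), some (m, C) => some (l.join m, max A (max (max B C) (k.exp + 2)) + 3)
    | _, _, _ => none
  -- Only a polynomial number of rounds is allowed. The summand `a` in the time exponent counts the
  -- rounds, and 7 absorbs the constant factors.
  | .sum r N e, Γ =>
    match infer Δ N Γ with
    | some (.sm a, A) =>
      match infer Δ e (Function.update Γ r (.sm a)) with
      | some (k, B) => some (Kd.sumK a k, max A (max B (max (a + 3) (max (k.exp + 2)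
          (max ((Γ r).exp + 2) ((Kd.sumK a k).exp + 2))))) + a + 7)
      | none => none
    | _ => none
  | .prod r N e, Γ =>
    match infer Δ N Γ with
    | some (.sm a, A) =>
      match infer Δ e (Function.update Γ r (.sm a)) with
      | some (k, B) => some (.bg (a + k.exp), max A (max B (max (a + 3) (max (k.exp + 2)
          (max ((Γ r).exp + 2) (a + k.exp + 2))))) + a + 7)
      | none => none
    | _ => none

theorem opKd_bd {S : ℕ} (hS : 2 ≤ S) {μ : ℕ → ℕ → ℕ} {ρ : ℕ → ℕ} (o : Op) (e : Ex) {k l : Kd}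
    {x : ℕ} (hx : x ≤ k.bd S) (hy : e.eval μ ρ ≤ l.bd S) :
    o.eval x (e.eval μ ρ) ≤ (opKd o e k l).bd S := by
  have hmod : x % e.eval μ ρ ≤ k.bd S := (Nat.mod_le _ _).trans hx
  cases o with
  | add => exact Kd.add_bd hS hx hy
  | mul => exact Kd.mul_bd hS hx hy
  | sub => exact (Nat.sub_le _ _).trans hx
  | div => exact (Nat.div_le_self _ _).trans hx
  | mod =>
    simp only [Op.eval]
    unfold opKd
    split <;> try exact hmod
    · rename_i h; cases h
    · rename_i h; cases h
    · refine le_trans (Nat.mod_lt _ ?_).le hy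
      simp [Ex.eval, Op.eval]
    all_goals (rename_i h; cases h)
  | eq => simp only [Op.eval, opKd, Kd.bd, pow_zero]; split <;> omega
  | lt => simp only [Op.eval, opKd, Kd.bd, pow_zero]; split <;> omega

theorem update_bd {S : ℕ} {Γ : ℕ → Kd} {ρ : ℕ → ℕ} {r i : ℕ} {k : Kd}
    (hρ : ∀ j, ρ j ≤ (Γ j).bd S) (hi : i ≤ k.bd S) (j : ℕ) :
    Function.update ρ r i j ≤ (Function.update Γ r k j).bd S := by
  by_cases h : j = r
  · subst h; simpa using hi
  · simpa [h] using hρ j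

theorem le_two_pow_pred {x : ℕ} : x ≤ 2 ^ (x - 1) := by
  cases x with
  | zero => simp
  | succ x => exact Nat.lt_two_pow_self

theorem infer_bd {S : ℕ} (hS : 2 ≤ S) {Δ : ℕ → Kd} {μ : ℕ → ℕ → ℕ}
    (hμ : ∀ a i, μ a i ≤ (Δ a).bd S) (e : Ex) {Γ : ℕ → Kd} {ρ : ℕ → ℕ} {k : Kd} {A : ℕ}
    (hρ : ∀ r, ρ r ≤ (Γ r).bd S) (h : infer Δ e Γ = some (k, A)) : e.eval μ ρ ≤ k.bd S := by
  induction e generalizing Γ ρ k A with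
  | const x =>
    simp only [infer, Option.some.injEq, Prod.mk.injEq] at h
    obtain ⟨rfl, rfl⟩ := h
    exact le_two_pow_pred.trans (Nat.pow_le_pow_left hS _)
  | var r =>
    simp only [infer, Option.some.injEq, Prod.mk.injEq] at h
    obtain ⟨rfl, rfl⟩ := h
    exact hρ r
  | read a e ih =>
    unfold infer at h
    split at h
    · cases h
    · cases h; exact hμ _ _
  | op o e₁ e₂ ih₁ ih₂ =>
    unfold infer at h
    split at h
    · rename_i h₁ h₂
      cases h
      exact opKd_bd hS o e₂ (ih₁ hρ h₁) (ih₂ hρ h₂)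
    · cases h
  | cond e₁ e₂ e₃ ih₁ ih₂ ih₃ =>
    unfold infer at h
    split at h
    · rename_i l B m C h₁ h₂ h₃
      cases h
      simp only [Ex.eval]
      split
      · exact (ih₂ hρ h₂).trans (Kd.le_join hS l m).1
      · exact (ih₃ hρ h₃).trans (Kd.le_join hS l m).2
    · cases h
  | sum r N e ihN ihe =>
    unfold infer at h
    split at h
    · rename_i h₁
      split at h
      · rename_i h₂
        cases h
        have hN := ihN hρ h₁
        exact Kd.sum_bd hS hN fun i hi => ihe (update_bd hρ (hi.le.trans hN)) h₂
      · cases h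
    · cases h
  | prod r N e ihN ihe =>
    unfold infer at h
    split at h
    · rename_i h₁
      split at h
      · rename_i h₂
        cases h
        have hN := ihN hρ h₁
        exact Kd.prod_bd hS hN fun i hi => ihe (update_bd hρ (hi.le.trans hN)) h₂
      · cases h
    · cases h

end RAM

/-! ### Correctness and running time of compiled expressions -/

namespace RAM

/-- Nothing has changed except the stack from position `d` on. -/
structure Agree (d : ℕ) (s s' : State) : Prop where
  mem : s'.mem = s.mem
  coins : s'.coins = s.coins
  var : ∀ r, s'.reg (2 * r) = s.reg (2 * r)
  tmp : ∀ i < d, s'.reg (tmp i) = s.reg (tmp i)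

theorem tmp_ne (d r : ℕ) : tmp d ≠ 2 * r := by unfold tmp; omega
theorem ne_tmp (d r : ℕ) : 2 * r ≠ tmp d := by unfold tmp; omega
theorem tmp_inj {i j : ℕ} : tmp i = tmp j ↔ i = j := by unfold tmp; omega

namespace Agree
variable {d : ℕ} {s s' s'' : State}

theorem trans (h : Agree d s s') (h' : Agree d s' s'') : Agree d s s'' :=
  ⟨h'.mem.trans h.mem, h'.coins.trans h.coins, fun r => (h'.var r).trans (h.var r),
    fun i hi => (h'.tmp i hi).trans (h.tmp i hi)⟩

theorem mono {e : ℕ} (h : Agree d s s') (hd : e ≤ d) : Agree e s s' :=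
  ⟨h.mem, h.coins, h.var, fun i hi => h.tmp i (hi.trans_le hd)⟩

theorem setTmp (s : State) {i : ℕ} (hi : d ≤ i) (x : ℕ) : Agree d s (s.setReg (RAM.tmp i) x) := by
  refine ⟨rfl, rfl, fun r => ?_, fun j hj => ?_⟩
  · simp [State.setReg, ne_tmp]
  · have : j ≠ i := by omega
    simp [State.setReg, tmp_inj, this]

end Agree

theorem setReg_reg (s : State) (r x j : ℕ) :
    (s.setReg r x).reg j = if j = r then x else s.reg j := by
  simp [State.setReg, Function.update_apply]

/-- The sum of at most `2 ^ m` numbers that are at most `S ^ A`. -/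
theorem le_pow_add {S A x : ℕ} (hS : 2 ≤ S) (m : ℕ) (hx : x ≤ 2 ^ m * S ^ A) : x ≤ S ^ (A + m) := by
  rw [pow_add, mul_comm]
  exact hx.trans (Nat.mul_le_mul_right _ (Nat.pow_le_pow_left hS m))

/-- Registers hold `ρ` in the even positions. -/
def Holds (s : State) (ρ : ℕ → ℕ) : Prop := ∀ r, s.reg (2 * r) = ρ r

/-- The code evaluates to `f` of the variables and memory within time `T`. -/
def Computes (c : Program) (d : ℕ) (s : State) (x T : ℕ) : Prop :=
  ∃ s' t, Exec c s s' t ∧ t ≤ T ∧ Agree d s s' ∧ s'.reg (tmp d) = x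

/-- Induction on the number `m` of rounds that remain when round `k` begins. The sequence `acc`
lists the partial results; apart from the body, a round handles at most 16 numbers, each of length
at most `L`. -/
theorem bigOp_loop {S : ℕ} {o : Op} {r : ℕ} {ce : Program} {d : ℕ} {s₀ : State}
    {N te L : ℕ} (f acc : ℕ → ℕ) (hacc : ∀ i < N, o.eval (acc i) (f i) = acc (i + 1))
    (hce : ∀ i < N, ∀ s, s.mem = s₀.mem → Holds s (Function.update (fun j => s₀.reg (2 * j)) r i) →
      Computes ce (d + 3) s (f i) te)
    (hN : len N ≤ L) (hacL : ∀ i ≤ N, len (acc i) ≤ L) (hfL : ∀ i < N, len (f i) ≤ L)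
    (h1L : len 1 ≤ L) (m : ℕ) :
    ∀ k s, k + m = N → s.mem = s₀.mem → s.coins = s₀.coins →
      Holds s (Function.update (fun j => s₀.reg (2 * j)) r k) →
      (∀ i < d, s.reg (tmp i) = s₀.reg (tmp i)) → s.reg (tmp d) = N → s.reg (tmp (d + 1)) = acc k →
      ∃ s' t, Exec (.loop (.op .lt (.reg (2 * r)) (.reg (tmp d))) <|
        .seq ce <| .seq (.assign (tmp (d + 1)) (.op o (.reg (tmp (d + 1))) (.reg (tmp (d + 3)))))
        (.assign (2 * r) (.op .add (.reg (2 * r)) (.const 1)))) s s' t ∧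
        t ≤ m * (te + 16 * L) + 4 * L ∧ s'.mem = s₀.mem ∧ s'.coins = s₀.coins ∧
        (∀ j, j ≠ r → s'.reg (2 * j) = s₀.reg (2 * j)) ∧
        (∀ i < d, s'.reg (tmp i) = s₀.reg (tmp i)) ∧ s'.reg (tmp (d + 1)) = acc N ∧
        s'.reg (tmp (d + 2)) = s.reg (tmp (d + 2)) := by
  have len_mono : ∀ {x y}, x ≤ y → len x ≤ len y := fun h => by
    unfold len; exact Nat.add_le_add_right (Nat.size_le_size h) 1
  induction m with
  | zero =>
    intro k s hk hm hc hv ht hd ha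
    obtain rfl : k = N := by omega
    have hr : s.reg (2 * r) = k := by simpa using hv r
    refine ⟨s, _, .loop_false ?_, ?_, hm, hc, fun j hj => by simpa [hj] using hv j, ht, ha, rfl⟩
    · simp [Expr.eval, Op.eval, hr, hd]
    · simp only [Expr.cost, Expr.eval, hr, hd]; omega
  | succ m ih =>
    intro k s hk hm hc hv ht hd ha
    have hr : s.reg (2 * r) = k := by simpa using hv r
    obtain ⟨s₁, t₁, hx₁, htt₁, ag, hval⟩ := hce k (by omega) s hm hv
    have e1 : s₁.reg (tmp (d + 1)) = acc k := (ag.tmp _ (by omega)).trans ha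
    set s₂ := s₁.setReg (tmp (d + 1)) (acc (k + 1)) with hs₂
    set s₃ := s₂.setReg (2 * r) (k + 1) with hs₃
    have hr1 : s₁.reg (2 * r) = k := (ag.var r).trans hr
    have hr2 : s₂.reg (2 * r) = k := by rw [hs₂, setReg_reg, if_neg (ne_tmp _ _), hr1]
    obtain ⟨s', t, hx, htt, h1, h2, h3, h4, h5, h6⟩ := ih (k + 1) s₃ (by omega)
      (by rw [← hm]; exact ag.mem) (by rw [← hc]; exact ag.coins)
      (by
        intro j
        rw [hs₃, setReg_reg]
        by_cases hj : j = r
        · simp [hj]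
        · have := (ag.var j).trans (hv j)
          simpa [hs₂, setReg_reg, hj, ne_tmp] using this)
      (by
        intro i hi
        rw [hs₃, setReg_reg, if_neg (tmp_ne _ _), hs₂, setReg_reg, if_neg (by simp [tmp_inj]; omega),
          ag.tmp _ (by omega), ht i hi])
      (by rw [hs₃, setReg_reg, if_neg (tmp_ne _ _), hs₂, setReg_reg, if_neg (by simp [tmp_inj]),
          ag.tmp _ (by omega), hd])
      (by rw [hs₃, setReg_reg, if_neg (tmp_ne _ _), hs₂, setReg_reg, if_pos rfl])
    refine ⟨s', _, .loop_true ?_ (.seq hx₁ (.seq (s' := s₂) (s'' := s₃)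
      (t₁ := len (acc k) + len (f k) + len (acc k) + len (f k) + len (acc (k + 1)))
      (t₂ := len k + len 1 + len k + len 1 + len (k + 1)) ?_ ?_)) hx, ?_, h1, h2, h3, h4, h5, ?_⟩
    · simp [Expr.eval, Op.eval, hr, hd]; omega
    · have := Exec.assign (tmp (d + 1)) (.op o (.reg (tmp (d + 1))) (.reg (tmp (d + 3)))) s₁
      simp only [Expr.eval, Expr.cost, e1, hval, hacc k (by omega)] at this
      exact this
    · have := Exec.assign (2 * r) (.op .add (.reg (2 * r)) (.const 1)) s₂
      simp only [Expr.eval, Expr.cost, hr2, Op.eval] at this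
      exact this
    · have g1 := hacL k (by omega)
      have g2 := hacL (k + 1) (by omega)
      have g3 := hfL k (by omega)
      have g4 : len k ≤ L := (len_mono (by omega)).trans hN
      have g5 : len (k + 1) ≤ L := (len_mono (by omega)).trans hN
      simp only [Expr.cost, Expr.eval, hr, hd]
      rw [Nat.succ_mul]
      omega
    · rw [h6, hs₃, setReg_reg, if_neg (tmp_ne _ _), hs₂, setReg_reg, if_neg (by simp [tmp_inj]),
        ag.tmp _ (by omega)]

theorem bigOp_computes {S : ℕ} (hS : 2 ≤ S) {o : Op} {x r : ℕ} {cN ce : Program} {d : ℕ} {s₀ : State}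
    {N tN te L a : ℕ} (f acc : ℕ → ℕ) (hacc : ∀ i < N, o.eval (acc i) (f i) = acc (i + 1))
    (hx : acc 0 = x) (hcN : Computes cN d s₀ N tN)
    (hce : ∀ i < N, ∀ s, s.mem = s₀.mem → Holds s (Function.update (fun j => s₀.reg (2 * j)) r i) →
      Computes ce (d + 3) s (f i) te)
    (hNa : N ≤ S ^ a)
    (hN : len N ≤ L) (hacL : ∀ i ≤ N, len (acc i) ≤ L) (hfL : ∀ i < N, len (f i) ≤ L)
    (h1L : len 1 ≤ L) (hrL : len (s₀.reg (2 * r)) ≤ L) {B : ℕ} (htN : tN ≤ S ^ B)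
    (hte : te ≤ S ^ B) (hL : L ≤ S ^ B) :
    Computes (bigOp o x r cN ce d) d s₀ (acc N) (S ^ (B + a + 7)) := by
  obtain ⟨s₁, t₁, hx₁, htt₁, ag₁, hv₁⟩ := hcN
  set s₂ := s₁.setReg (tmp (d + 1)) x with hs₂
  set s₃ := s₂.setReg (tmp (d + 2)) (s₀.reg (2 * r)) with hs₃
  set s₄ := s₃.setReg (2 * r) 0 with hs₄
  have e2 : s₂.reg (2 * r) = s₀.reg (2 * r) := by
    rw [hs₂, setReg_reg, if_neg (ne_tmp _ _), ag₁.var]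
  obtain ⟨s₅, t₅, hx₅, htt₅, h1, h2, h3, h4, h5, h6⟩ := bigOp_loop (S := S) f acc hacc hce hN hacL hfL h1L N
    0 s₄ (by omega) ag₁.mem ag₁.coins
    (by
      intro j
      rw [hs₄, setReg_reg]
      by_cases hj : j = r
      · simp [hj]
      · simpa [hs₂, hs₃, setReg_reg, hj, ne_tmp] using ag₁.var j)
    (by
      intro i hi
      have h1 : i ≠ d + 1 := by omega
      have h2 : i ≠ d + 2 := by omega
      simpa [hs₂, hs₃, hs₄, setReg_reg, tmp_inj, h1, h2, tmp_ne] using ag₁.tmp i hi)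
    (by simpa [hs₂, hs₃, hs₄, setReg_reg, tmp_inj, tmp_ne] using hv₁)
    (by simp [hs₂, hs₃, hs₄, setReg_reg, tmp_inj, tmp_ne, hx])
  have e6 : s₅.reg (tmp (d + 2)) = s₀.reg (2 * r) := by
    rw [h6, hs₄, setReg_reg, if_neg (tmp_ne _ _), hs₃, setReg_reg, if_pos rfl]
  set s₆ := s₅.setReg (2 * r) (s₀.reg (2 * r)) with hs₆
  set s₇ := s₆.setReg (tmp d) (acc N) with hs₇
  have e7 : s₆.reg (tmp (d + 1)) = acc N := by rw [hs₆, setReg_reg, if_neg (tmp_ne _ _), h5]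
  refine ⟨s₇, _, .seq hx₁ (.seq (t₁ := len x + len x) (s' := s₂) ?_ (.seq
    (t₁ := len (s₀.reg (2 * r)) + len (s₀.reg (2 * r))) (s' := s₃) ?_
    (.seq (t₁ := len 0 + len 0) (s' := s₄) ?_
    (.seq hx₅ (.seq (t₁ := len (s₀.reg (2 * r)) + len (s₀.reg (2 * r)))
    (t₂ := len (acc N) + len (acc N)) (s' := s₆) ?_ ?_))))), ?_, ?_, ?_⟩
  · exact Exec.assign _ (.const x) s₁
  · have := Exec.assign (tmp (d + 2)) (.reg (2 * r)) s₂
    simp only [Expr.eval, Expr.cost, e2] at this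
    exact this
  · exact Exec.assign _ (.const 0) s₃
  · have := Exec.assign (2 * r) (.reg (tmp (d + 2))) s₅
    simp only [Expr.eval, Expr.cost, e6] at this
    exact this
  · have := Exec.assign (tmp d) (.reg (tmp (d + 1))) s₆
    simp only [Expr.eval, Expr.cost, e7] at this
    exact this
  · have g1 := hacL N le_rfl
    have g0 := hacL 0 (by omega)
    rw [hx] at g0
    have g2 : len 0 ≤ L := le_trans (by simp [len]) h1L
    have g3 : N * (te + 16 * L) ≤ S ^ a * (17 * S ^ B) := Nat.mul_le_mul hNa (by omega)
    have g4 : S ^ B ≤ S ^ a * S ^ B := Nat.le_mul_of_pos_left _ (Nat.pow_pos (by omega))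
    have g5 : S ^ a * (17 * S ^ B) = 17 * (S ^ a * S ^ B) := by ring
    -- The rounds contribute at most `17 * S ^ (a + B)`, and everything else is a constant number of
    -- terms `S ^ B`; together this is below `2 ^ 7 * S ^ (a + B)`.
    refine le_pow_add hS 7 ?_
    rw [pow_add, mul_comm (S ^ B)]
    omega
  · refine ⟨h1, h2, fun j => ?_, fun i hi => ?_⟩
    · by_cases hj : j = r
      · simp [hs₇, hs₆, setReg_reg, ne_tmp, hj]
      · simp [hs₇, hs₆, setReg_reg, ne_tmp, hj, h3 j hj]
    · have : i ≠ d := by omega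
      simp [hs₇, hs₆, setReg_reg, tmp_ne, tmp_inj, this, h4 i hi]
  · simp [hs₇, setReg_reg]

theorem len_const_le {S : ℕ} (hS : 2 ≤ S) (x b : ℕ) (hb : x + 2 ≤ b) : len x ≤ S ^ b :=
  Kd.len_le hS (k := .sm x) (Nat.lt_two_pow_self.le.trans (Nat.pow_le_pow_left hS x)) hb

/-- Structural induction. By `infer_bd` every intermediate number has a length polynomial in `S`, so
every access is cheap; and since compiled code leaves memory and variables as it found them
(`Agree`), subexpressions can be evaluated one after another. -/
theorem infer_computes {S : ℕ} (hS : 2 ≤ S) {Δ : ℕ → Kd} (e : Ex) {Γ : ℕ → Kd} {ρ : ℕ → ℕ}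
    {k : Kd} {A d : ℕ} {s : State} (hs : Holds s ρ) (hμ : ∀ a i, s.mem a i ≤ (Δ a).bd S)
    (hρ : ∀ r, ρ r ≤ (Γ r).bd S) (h : infer Δ e Γ = some (k, A)) :
    Computes (e.comp d) d s (e.eval s.mem ρ) (S ^ A) := by
  induction e generalizing Γ ρ k A d s with
  | const x =>
    simp only [infer, Option.some.injEq, Prod.mk.injEq] at h
    obtain ⟨rfl, rfl⟩ := h
    refine ⟨_, _, .assign _ _ _, ?_, Agree.setTmp s le_rfl _, by simp [setReg_reg, Expr.eval, Ex.eval]⟩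
    have := len_const_le hS x _ le_rfl
    exact le_pow_add hS (A := x + 2) 3 (by simp only [Expr.cost, Expr.eval]; omega)
  | var r =>
    simp only [infer, Option.some.injEq, Prod.mk.injEq] at h
    obtain ⟨rfl, rfl⟩ := h
    refine ⟨_, _, .assign _ _ _, ?_, Agree.setTmp s le_rfl _,
      by simp [setReg_reg, Expr.eval, Ex.eval, hs r]⟩
    have := Kd.len_le hS (hρ r) le_rfl
    exact le_pow_add hS (A := (Γ r).exp + 2) 3 (by simp only [Expr.cost, Expr.eval, hs r]; omega)
  | read a e ih =>
    unfold infer at h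
    split at h
    · cases h
    · rename_i k' A' h'
      cases h
      obtain ⟨s₁, t₁, hx₁, ht₁, ag₁, hv₁⟩ := ih (d := d) hs hμ hρ h'
      refine ⟨_, _, .seq hx₁ (.assign _ _ _), ?_, ag₁.trans (Agree.setTmp _ le_rfl _),
        by simp [setReg_reg, Expr.eval, Ex.eval, hv₁, ag₁.mem]⟩
      set B := max A' (max (k'.exp + 2) ((Δ a).exp + 2))
      have g1 := Kd.len_le hS (infer_bd hS hμ e hρ h') (show _ ≤ B by omega)
      have g2 := Kd.len_le hS (hμ a (e.eval s.mem ρ)) (show _ ≤ B by omega)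
      have g3 := ht₁.trans (Kd.pow_mono_exp hS (show A' ≤ B by omega))
      refine le_pow_add hS 3 ?_
      simp only [Expr.cost, Expr.eval, hv₁, ag₁.mem]
      omega
  | op o e₁ e₂ ih₁ ih₂ =>
    unfold infer at h
    split at h
    · rename_i k₁ A₁ k₂ A₂ h₁ h₂
      cases h
      obtain ⟨s₁, t₁, hx₁, ht₁, ag₁, hv₁⟩ := ih₁ (d := d) hs hμ hρ h₁
      obtain ⟨s₂, t₂, hx₂, ht₂, ag₂, hv₂⟩ := ih₂ (d := d + 1) (s := s₁)
        (fun r => (ag₁.var r).trans (hs r)) (by rw [ag₁.mem]; exact hμ) hρ h₂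
      have hv₁' := (ag₂.tmp d (by omega)).trans hv₁
      rw [ag₁.mem] at hv₂
      refine ⟨_, _, .seq hx₁ (.seq hx₂ (.assign _ _ _)), ?_,
        (ag₁.trans (ag₂.mono (by omega))).trans (Agree.setTmp _ le_rfl _),
        by simp [setReg_reg, Expr.eval, Ex.eval, hv₁', hv₂]⟩
      have b₁ := infer_bd hS hμ e₁ hρ h₁
      have b₂ := infer_bd hS hμ e₂ hρ h₂
      set B := max A₁ (max A₂ (max (k₁.exp + 2) (max (k₂.exp + 2) ((opKd o e₂ k₁ k₂).exp + 2))))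
      have g1 := Kd.len_le hS b₁ (show _ ≤ B by omega)
      have g2 := Kd.len_le hS b₂ (show _ ≤ B by omega)
      have g3 := Kd.len_le hS (opKd_bd hS o e₂ b₁ b₂) (show _ ≤ B by omega)
      have g4 := ht₁.trans (Kd.pow_mono_exp hS (show A₁ ≤ B by omega))
      have g5 := ht₂.trans (Kd.pow_mono_exp hS (show A₂ ≤ B by omega))
      refine le_pow_add hS 3 ?_
      simp only [Expr.cost, Expr.eval, hv₁', hv₂]
      omega
    · cases h
  | cond e₁ e₂ e₃ ih₁ ih₂ ih₃ =>
    unfold infer at h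
    split at h
    · rename_i k₁ A₁ k₂ A₂ k₃ A₃ h₁ h₂ h₃
      cases h
      obtain ⟨s₁, t₁, hx₁, ht₁, ag₁, hv₁⟩ := ih₁ (d := d) hs hμ hρ h₁
      set B := max A₁ (max (max A₂ A₃) (k₁.exp + 2))
      have g1 := Kd.len_le hS (infer_bd hS hμ e₁ hρ h₁) (show _ ≤ B by omega)
      have g4 := ht₁.trans (Kd.pow_mono_exp hS (show A₁ ≤ B by omega))
      by_cases h0 : e₁.eval s.mem ρ = 0
      · obtain ⟨s₂, t₂, hx₂, ht₂, ag₂, hv₂⟩ := ih₃ (d := d) (s := s₁)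
          (fun r => (ag₁.var r).trans (hs r)) (by rw [ag₁.mem]; exact hμ) hρ h₃
        refine ⟨s₂, _, .seq hx₁ (.ite_false (by simp [Expr.eval, hv₁, h0]) hx₂), ?_, ag₁.trans ag₂,
          by rw [hv₂, ag₁.mem]; simp [Ex.eval, h0]⟩
        have g5 := ht₂.trans (Kd.pow_mono_exp hS (show A₃ ≤ B by omega))
        refine le_pow_add hS 3 ?_
        simp only [Expr.cost, hv₁]
        omega
      · obtain ⟨s₂, t₂, hx₂, ht₂, ag₂, hv₂⟩ := ih₂ (d := d) (s := s₁)
          (fun r => (ag₁.var r).trans (hs r)) (by rw [ag₁.mem]; exact hμ) hρ h₂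
        refine ⟨s₂, _, .seq hx₁ (.ite_true (by simpa [Expr.eval, hv₁] using h0) hx₂), ?_, ag₁.trans ag₂,
          by rw [hv₂, ag₁.mem]; simp [Ex.eval, h0]⟩
        have g5 := ht₂.trans (Kd.pow_mono_exp hS (show A₂ ≤ B by omega))
        refine le_pow_add hS 3 ?_
        simp only [Expr.cost, hv₁]
        omega
    · cases h
  | sum r N e ihN ihe =>
    unfold infer at h
    split at h
    · rename_i a A₁ h₁
      split at h
      · rename_i k₂ A₂ h₂
        cases h
        have hN := infer_bd hS hμ N hρ h₁
        have hf : ∀ i < N.eval s.mem ρ, e.eval s.mem (Function.update ρ r i) ≤ k₂.bd S :=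
          fun i hi => infer_bd hS hμ e (update_bd hρ (hi.le.trans hN)) h₂
        have hρs : (fun j => s.reg (2 * j)) = ρ := funext hs
        set B := max A₁ (max A₂ (max (a + 3) (max (k₂.exp + 2)
          (max ((Γ r).exp + 2) ((Kd.sumK a k₂).exp + 2)))))
        refine bigOp_computes hS (fun i => e.eval s.mem (Function.update ρ r i))
          (fun m => ∑ i ∈ Finset.range m, e.eval s.mem (Function.update ρ r i))
          (L := S ^ B) (tN := S ^ A₁) (te := S ^ A₂) ?_ ?_ (ihN hs hμ hρ h₁) ?_ hN ?_ ?_ ?_ ?_ ?_ ?_ ?_ le_rfl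
        · intro i _; simp [Op.eval, Finset.sum_range_succ]
        · simp
        · intro i hi s' hm hs'
          rw [← hm]
          rw [hρs] at hs'
          exact ihe hs' (by rw [hm]; exact hμ) (update_bd hρ (hi.le.trans hN)) h₂
        · exact Kd.len_le hS hN (show a + 2 ≤ B by omega)
        · intro i hi
          exact Kd.len_le hS (Kd.sum_bd hS (hi.trans hN) fun j hj => hf j (by omega))
            (show _ ≤ B by omega)
        · intro i hi
          exact Kd.len_le hS (hf i hi) (show _ ≤ B by omega)
        · exact len_const_le hS 1 B (by omega)
        · exact Kd.len_le hS (k := Γ r) (by rw [hs r]; exact hρ r) (show _ ≤ B by omega)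
        · exact Kd.pow_mono_exp hS (by omega)
        · exact Kd.pow_mono_exp hS (by omega)
      · cases h
    · cases h
  | prod r N e ihN ihe =>
    unfold infer at h
    split at h
    · rename_i a A₁ h₁
      split at h
      · rename_i k₂ A₂ h₂
        cases h
        have hN := infer_bd hS hμ N hρ h₁
        have hf : ∀ i < N.eval s.mem ρ, e.eval s.mem (Function.update ρ r i) ≤ k₂.bd S :=
          fun i hi => infer_bd hS hμ e (update_bd hρ (hi.le.trans hN)) h₂
        have hρs : (fun j => s.reg (2 * j)) = ρ := funext hs
        set B := max A₁ (max A₂ (max (a + 3) (max (k₂.exp + 2)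
          (max ((Γ r).exp + 2) (a + k₂.exp + 2)))))
        refine bigOp_computes hS (fun i => e.eval s.mem (Function.update ρ r i))
          (fun m => ∏ i ∈ Finset.range m, e.eval s.mem (Function.update ρ r i))
          (L := S ^ B) (tN := S ^ A₁) (te := S ^ A₂) ?_ ?_ (ihN hs hμ hρ h₁) ?_ hN ?_ ?_ ?_ ?_ ?_ ?_ ?_ le_rfl
        · intro i _; simp [Op.eval, Finset.prod_range_succ]
        · simp
        · intro i hi s' hm hs'
          rw [← hm]
          rw [hρs] at hs'
          exact ihe hs' (by rw [hm]; exact hμ) (update_bd hρ (hi.le.trans hN)) h₂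
        · exact Kd.len_le hS hN (show a + 2 ≤ B by omega)
        · intro i hi
          exact Kd.len_le hS (Kd.prod_bd hS (hi.trans hN) fun j hj => hf j (by omega))
            (show a + k₂.exp + 2 ≤ B by omega)
        · intro i hi
          exact Kd.len_le hS (hf i hi) (show _ ≤ B by omega)
        · exact len_const_le hS 1 B (by omega)
        · exact Kd.len_le hS (k := Γ r) (by rw [hs r]; exact hρ r) (show _ ≤ B by omega)
        · exact Kd.pow_mono_exp hS (by omega)
        · exact Kd.pow_mono_exp hS (by omega)
      · cases h
    · cases h

end RAM

/-! ### Commands, their compilation and the static analysis of their running time -/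

namespace RAM

/-- Commands; `loop r N c` runs `c` for `r = 0, 1, …` below the value that `N` has at the start. -/
inductive Cmd
  | skip
  | set (r : ℕ) (e : Ex)
  | write (a : ℕ) (i e : Ex)
  | flip (r : ℕ)
  | seq (c₁ c₂ : Cmd)
  | ite (e : Ex) (c₁ c₂ : Cmd)
  | loop (r : ℕ) (N : Ex) (c : Cmd)

/-- The state after the rounds `0, …, n - 1`. -/
def iter (f : ℕ → State → State) : ℕ → State → State
  | 0, s => s
  | n + 1, s => f n (iter f n s)

def Cmd.den : Cmd → State → State
  | .skip, s => s
  | .set r e, s => s.setReg r (e.eval s.mem s.reg)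
  | .write a i e, s => s.setMem a (i.eval s.mem s.reg) (e.eval s.mem s.reg)
  | .flip r, s => { s.setReg r (s.coins 0).toNat with coins := fun j => s.coins (j + 1) }
  | .seq c₁ c₂, s => c₂.den (c₁.den s)
  | .ite e c₁ c₂, s => if e.eval s.mem s.reg ≠ 0 then c₁.den s else c₂.den s
  | .loop r N c, s => iter (fun i s => c.den (s.setReg r i)) (N.eval s.mem s.reg) s

/-- The bound and the counter of a loop live on the stack, and the counter is copied to the loop
variable in each round. So the number of rounds is fixed at the start, whatever the body does to the
variables. -/
def Cmd.comp : Cmd → ℕ → Program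
  | .skip, _ => .skip
  | .set r e, d => .seq (e.comp d) (.assign (2 * r) (.reg (tmp d)))
  | .write a i e, d => .seq (i.comp d) <| .seq (e.comp (d + 1)) <|
      .write a (.reg (tmp d)) (.reg (tmp (d + 1)))
  | .flip r, _ => .flip (2 * r)
  | .seq c₁ c₂, d => .seq (c₁.comp d) (c₂.comp d)
  | .ite e c₁ c₂, d => .seq (e.comp d) (.ite (.reg (tmp d)) (c₁.comp d) (c₂.comp d))
  | .loop r N c, d => .seq (N.comp d) <| .seq (.assign (tmp (d + 1)) (.const 0)) <|
      .loop (.op .lt (.reg (tmp (d + 1))) (.reg (tmp d))) <|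
      .seq (.assign (2 * r) (.reg (tmp (d + 1)))) <| .seq (c.comp (d + 2)) <|
      .assign (tmp (d + 1)) (.op .add (.reg (tmp (d + 1))) (.const 1))

/-- The machine state `s` represents the state `σ` of a command. -/
structure Rep (σ s : State) : Prop where
  reg : Holds s σ.reg
  mem : s.mem = σ.mem
  coins : s.coins = σ.coins

theorem Rep.agree {σ s s' : State} {d : ℕ} (h : Rep σ s) (ag : Agree d s s') : Rep σ s' :=
  ⟨fun r => (ag.var r).trans (h.reg r), ag.mem.trans h.mem, ag.coins.trans h.coins⟩

theorem Rep.setReg {σ s : State} (h : Rep σ s) (r x : ℕ) :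
    Rep (σ.setReg r x) (s.setReg (2 * r) x) := by
  refine ⟨fun j => ?_, h.mem, h.coins⟩
  rw [setReg_reg, setReg_reg]
  by_cases hj : j = r
  · simp [hj]
  · simp [hj, h.reg j]

/-- The compiled command runs from (representations of) `σ` within time `T`. -/
def Runs (c : Cmd) (σ : State) (T : ℕ) : Prop :=
  ∀ d s, Rep σ s → ∃ s' t, Exec (c.comp d) s s' t ∧ t ≤ T ∧ Rep (c.den σ) s' ∧
    ∀ i < d, s'.reg (tmp i) = s.reg (tmp i)

theorem Runs.mono {c : Cmd} {σ : State} {T T' : ℕ} (h : Runs c σ T) (hT : T ≤ T') : Runs c σ T' :=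
  fun d s hs => let ⟨s', t, h1, h2, h3⟩ := h d s hs; ⟨s', t, h1, h2.trans hT, h3⟩

theorem Runs.seq {c₁ c₂ : Cmd} {σ : State} {T₁ T₂ : ℕ} (h₁ : Runs c₁ σ T₁)
    (h₂ : Runs c₂ (c₁.den σ) T₂) : Runs (.seq c₁ c₂) σ (T₁ + T₂) := by
  intro d s hs
  obtain ⟨s₁, t₁, a1, a2, a3, a4⟩ := h₁ d s hs
  obtain ⟨s₂, t₂, b1, b2, b3, b4⟩ := h₂ d s₁ a3
  exact ⟨s₂, _, .seq a1 b1, by omega, b3, fun i hi => (b4 i hi).trans (a4 i hi)⟩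

/-- The body need only be controlled in the states that really occur. This permits invariants finer
than `InCtx`, which the scan of the input needs. -/
theorem Runs.loop {r : ℕ} {N : Ex} {c : Cmd} {σ : State} {n tN te L : ℕ}
    (hn : N.eval σ.mem σ.reg = n) (hN : ∀ d s, Rep σ s → Computes (N.comp d) d s n tN)
    (hc : ∀ i < n, Runs c ((iter (fun i s => c.den (s.setReg r i)) i σ).setReg r i) te)
    (hL : len n ≤ L) (h1 : len 1 ≤ L) :
    Runs (.loop r N c) σ (tN + n * (te + 16 * L) + 8 * L) := by
  have len_mono : ∀ {x y}, x ≤ y → len x ≤ len y := fun h => by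
    unfold len; exact Nat.add_le_add_right (Nat.size_le_size h) 1
  set f := fun i s => c.den (State.setReg s r i) with hf
  intro d s hs
  obtain ⟨s₁, t₁, hx₁, ht₁, ag₁, hv₁⟩ := hN d s hs
  have key : ∀ m k s', k + m = n → Rep (iter f k σ) s' → s'.reg (tmp d) = n →
      s'.reg (tmp (d + 1)) = k → ∃ s'' t,
      Exec (.loop (.op .lt (.reg (tmp (d + 1))) (.reg (tmp d))) <|
        .seq (.assign (2 * r) (.reg (tmp (d + 1)))) <| .seq (c.comp (d + 2)) <|
        .assign (tmp (d + 1)) (.op .add (.reg (tmp (d + 1))) (.const 1))) s' s'' t ∧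
      t ≤ m * (te + 16 * L) + 4 * L ∧ Rep (iter f n σ) s'' ∧
        ∀ i < d, s''.reg (tmp i) = s'.reg (tmp i) := by
    intro m
    induction m with
    | zero =>
      intro k s' hk hr hd hd1
      obtain rfl : k = n := by omega
      refine ⟨s', _, .loop_false ?_, ?_, hr, fun _ _ => rfl⟩
      · simp [Expr.eval, Op.eval, hd, hd1]
      · simp only [Expr.cost, Expr.eval, hd, hd1]; omega
    | succ m ih =>
      intro k s' hk hr hd hd1
      obtain ⟨s₂, t₂, hx₂, ht₂, hr₂, hag₂⟩ := hc k (by omega) (d + 2) (s'.setReg (2 * r) k)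
        (hr.setReg r k)
      have e1 : s₂.reg (tmp (d + 1)) = k := by
        rw [hag₂ _ (by omega), setReg_reg, if_neg (tmp_ne _ _), hd1]
      have e0 : s₂.reg (tmp d) = n := by
        rw [hag₂ _ (by omega), setReg_reg, if_neg (tmp_ne _ _), hd]
      set s₃ := s₂.setReg (tmp (d + 1)) (k + 1) with hs₃
      obtain ⟨s'', t, hx, ht, hr', hag⟩ := ih (k + 1) s₃ (by omega)
        (hr₂.agree (Agree.setTmp (d := 0) s₂ (by omega) _))
        (by rw [hs₃, setReg_reg, if_neg (by simp [tmp_inj]), e0])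
        (by rw [hs₃, setReg_reg, if_pos rfl])
      refine ⟨s'', _, .loop_true ?_ (.seq (t₁ := len k + len k) ?_ (.seq hx₂
        (t₂ := len k + len 1 + len k + len 1 + len (k + 1)) (s'' := s₃) ?_)) hx, ?_, hr', ?_⟩
      · simp [Expr.eval, Op.eval, hd, hd1]; omega
      · have := Exec.assign (2 * r) (.reg (tmp (d + 1))) s'
        simp only [Expr.eval, Expr.cost, hd1] at this
        exact this
      · have := Exec.assign (tmp (d + 1)) (.op .add (.reg (tmp (d + 1))) (.const 1)) s₂
        simp only [Expr.eval, Expr.cost, Op.eval, e1] at this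
        exact this
      · have g4 : len k ≤ L := (len_mono (by omega)).trans hL
        have g5 : len (k + 1) ≤ L := (len_mono (by omega)).trans hL
        simp only [Expr.cost, Expr.eval, hd, hd1]
        rw [Nat.succ_mul]
        omega
      · intro i hi
        rw [hag i hi, hs₃, setReg_reg, if_neg (by simp [tmp_inj]; omega), hag₂ _ (by omega),
          setReg_reg, if_neg (tmp_ne _ _)]
  obtain ⟨s₂, t₂, hx₂, ht₂, hr₂, hag₂⟩ := key n 0 (s₁.setReg (tmp (d + 1)) 0) (by omega)
    ((hs.agree ag₁).agree (Agree.setTmp (d := 0) s₁ (by omega) _))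
    (by rw [setReg_reg, if_neg (by simp [tmp_inj]), hv₁]) (by rw [setReg_reg, if_pos rfl])
  refine ⟨s₂, _, .seq hx₁ (.seq (.assign _ (.const 0) s₁) hx₂), ?_, ?_, ?_⟩
  · have : len 0 ≤ L := le_trans (by simp [len]) h1
    simp only [Expr.cost, Expr.eval]
    omega
  · simpa [Cmd.den, hn] using hr₂
  · intro i hi
    rw [hag₂ i hi, setReg_reg, if_neg (by simp [tmp_inj]; omega), ag₁.tmp i hi]

/-- The numbers in a state obey the bounds. -/
structure InCtx (S : ℕ) (Δ Γ : ℕ → Kd) (σ : State) : Prop where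
  mem : ∀ a i, σ.mem a i ≤ (Δ a).bd S
  reg : ∀ r, σ.reg r ≤ (Γ r).bd S

/-- An exponent `A` such that the command respects the bounds and takes time at most `S ^ A`, or (if
the flag is set) at most `S ^ A` times the content of register `q`, which bounds long loops. -/
def check (Δ Γ : ℕ → Kd) (q : ℕ) : Cmd → Option (ℕ × Bool)
  | .skip => some (0, false)
  | .set r e =>
    match infer Δ e Γ with
    | some (k, A) =>
      if k.le (Γ r) && r != q then some (max A (k.exp + 2) + 3, false) else none
    | none => none
  | .write a i e =>
    match infer Δ i Γ, infer Δ e Γ with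
    | some (k, A), some (l, B) =>
      if l.le (Δ a) then some (max A (max B (max (k.exp + 2) (l.exp + 2))) + 3, false) else none
    | _, _ => none
  | .flip r => if (Kd.sm 0).le (Γ r) && r != q then some (0, false) else none
  | .seq c₁ c₂ =>
    match check Δ Γ q c₁, check Δ Γ q c₂ with
    | some (A, f), some (B, g) => some (max A B + 1, f || g)
    | _, _ => none
  | .ite e c₁ c₂ =>
    match infer Δ e Γ, check Δ Γ q c₁, check Δ Γ q c₂ with
    | some (k, C), some (A, f), some (B, g) =>
      some (max C (max (k.exp + 2) (max A B)) + 3, f || g)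
    | _, _, _ => none
  | .loop r N c =>
    match infer Δ N Γ, check Δ Γ q c with
    | some (.sm a, A), some (B, f) =>
      if (Kd.sm a).le (Γ r) && r != q then some (max A (max (a + 3) B) + a + 6, f) else none
    | some (.bg a, A), some (B, f) =>
      match N with
      | .var q' => if (Kd.bg a).le (Γ r) && r != q && q' == q && !f
          then some (max A (max (a + 3) B) + 6, true) else none
      | _ => none
    | _, _ => none

theorem InCtx.setReg {S : ℕ} (hS : 2 ≤ S) {Δ Γ : ℕ → Kd} {σ : State} (h : InCtx S Δ Γ σ) {r x : ℕ}
    {k : Kd} (hx : x ≤ k.bd S) (hk : k.le (Γ r) = true) : InCtx S Δ Γ (σ.setReg r x) := by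
  refine ⟨h.mem, fun j => ?_⟩
  rw [setReg_reg]
  split
  · rename_i hj; subst hj; exact hx.trans (Kd.bd_mono hS hk)
  · exact h.reg j

theorem Runs.set {S : ℕ} (hS : 2 ≤ S) {Δ Γ : ℕ → Kd} {r : ℕ} {e : Ex} {k : Kd} {B : ℕ} {σ : State}
    (hσ : InCtx S Δ Γ σ) (he : infer Δ e Γ = some (k, B)) :
    Runs (.set r e) σ (S ^ (max B (k.exp + 2) + 3)) := by
  intro d s hs
  obtain ⟨s₁, t₁, hx₁, ht₁, ag₁, hv₁⟩ := infer_computes hS e (d := d) hs.reg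
    (by rw [hs.mem]; exact hσ.mem) hσ.reg he
  rw [hs.mem] at hv₁
  refine ⟨_, _, .seq hx₁ (.assign _ _ _), ?_, ?_, ?_⟩
  · have g1 := Kd.len_le hS (infer_bd hS hσ.mem e hσ.reg he) (show _ ≤ max B (k.exp + 2) by omega)
    have g2 := ht₁.trans (Kd.pow_mono_exp hS (show B ≤ max B (k.exp + 2) by omega))
    refine le_pow_add hS 3 ?_
    simp only [Expr.cost, Expr.eval, hv₁]
    omega
  · simp only [Expr.eval, hv₁]
    exact (hs.agree ag₁).setReg _ _
  · intro i hi
    rw [setReg_reg, if_neg (tmp_ne _ _), ag₁.tmp i hi]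

/-- Induction on the command. A long loop may lie inside short loops but not inside another long
one, so the factor `M` is never squared. The register `q` that bounds its length is never assigned,
so `q` keeps its value throughout. -/
theorem check_sound {S : ℕ} (hS : 2 ≤ S) {Δ Γ : ℕ → Kd} {q M : ℕ} (hM : 1 ≤ M) (c : Cmd)
    {A : ℕ} {f : Bool} (hc : check Δ Γ q c = some (A, f)) {σ : State} (hσ : InCtx S Δ Γ σ)
    (hq : σ.reg q ≤ M) :
    InCtx S Δ Γ (c.den σ) ∧ (c.den σ).reg q = σ.reg q ∧
      Runs c σ (S ^ A * if f then M else 1) := by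
  have hmono : ∀ {f g : Bool}, (if f then M else 1) ≤ (if f || g then M else 1) ∧
      (if g then M else 1) ≤ (if f || g then M else 1) := by
    intro f g; cases f <;> cases g <;> simp [hM]
  have hpos : ∀ {f : Bool}, 1 ≤ (if f then M else 1) := by
    intro f; cases f <;> simp [hM]
  induction c generalizing A f σ with
  | skip =>
    simp only [check, Option.some.injEq, Prod.mk.injEq] at hc
    obtain ⟨rfl, rfl⟩ := hc
    exact ⟨hσ, rfl, fun d s hs => ⟨s, 1, .skip s, by simp, hs, fun _ _ => rfl⟩⟩
  | set r e =>
    unfold check at hc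
    split at hc <;> try cases hc
    rename_i k B he
    split_ifs at hc with hif
    simp only [Option.some.injEq, Prod.mk.injEq] at hc
    obtain ⟨rfl, rfl⟩ := hc
    simp only [Bool.and_eq_true, bne_iff_ne] at hif
    have hb := infer_bd hS hσ.mem e hσ.reg he
    refine ⟨hσ.setReg hS hb hif.1, ?_, by simpa using Runs.set hS hσ he⟩
    simp [Cmd.den, setReg_reg, hif.2.symm]
  | write a i e =>
    unfold check at hc
    split at hc <;> try cases hc
    rename_i k B l C hi he
    split_ifs at hc with hif
    simp only [Option.some.injEq, Prod.mk.injEq] at hc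
    obtain ⟨rfl, rfl⟩ := hc
    have hbi := infer_bd hS hσ.mem i hσ.reg hi
    have hbe := infer_bd hS hσ.mem e hσ.reg he
    refine ⟨⟨fun b j => ?_, hσ.reg⟩, rfl, fun d s hs => ?_⟩
    · simp only [Cmd.den, State.setMem, Function.update_apply]
      split_ifs with h1
      · subst h1
        rw [Function.update_apply]
        split_ifs
        · exact hbe.trans (Kd.bd_mono hS hif)
        · exact hσ.mem _ _
      · exact hσ.mem _ _
    · obtain ⟨s₁, t₁, hx₁, ht₁, ag₁, hv₁⟩ := infer_computes hS i (d := d) hs.reg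
        (by rw [hs.mem]; exact hσ.mem) hσ.reg hi
      obtain ⟨s₂, t₂, hx₂, ht₂, ag₂, hv₂⟩ := infer_computes hS e (d := d + 1) (hs.agree ag₁).reg
        (by rw [ag₁.mem, hs.mem]; exact hσ.mem) hσ.reg he
      have hv₁' := (ag₂.tmp d (by omega)).trans hv₁
      rw [hs.mem] at hv₁'
      rw [ag₁.mem, hs.mem] at hv₂
      have hr := (hs.agree ag₁).agree ag₂
      refine ⟨_, _, .seq hx₁ (.seq hx₂ (.write _ _ _ _)), ?_, ⟨hr.reg, ?_, hr.coins⟩, ?_⟩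
      · set D := max B (max C (max (k.exp + 2) (l.exp + 2)))
        have g1 := Kd.len_le hS hbi (show _ ≤ D by omega)
        have g2 := Kd.len_le hS hbe (show _ ≤ D by omega)
        have g3 := ht₁.trans (Kd.pow_mono_exp hS (show B ≤ D by omega))
        have g4 := ht₂.trans (Kd.pow_mono_exp hS (show C ≤ D by omega))
        simp only [Bool.false_eq_true, if_false, mul_one]
        refine le_pow_add hS 3 ?_
        simp only [Expr.cost, Expr.eval, hv₁', hv₂]
        omega
      · simp only [Expr.eval, hv₁', hv₂, State.setMem, Cmd.den, hr.mem]
      · intro j hj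
        exact (ag₂.tmp j (by omega)).trans (ag₁.tmp j hj)
  | flip r =>
    unfold check at hc
    split_ifs at hc with hif
    simp only [Option.some.injEq, Prod.mk.injEq] at hc
    obtain ⟨rfl, rfl⟩ := hc
    simp only [Bool.and_eq_true, bne_iff_ne] at hif
    have hb : (σ.coins 0).toNat ≤ (Kd.sm 0).bd S := by
      simpa [Kd.bd] using Bool.toNat_le _
    refine ⟨⟨hσ.mem, (hσ.setReg hS hb hif.1).reg⟩, ?_, fun d s hs => ?_⟩
    · simp [Cmd.den, setReg_reg, hif.2.symm]
    · refine ⟨_, _, .flip _ _, by simp, ?_, ?_⟩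
      · simp only [Cmd.den, hs.coins]
        exact ⟨(hs.setReg r _).reg, hs.mem, rfl⟩
      · intro i hi
        simp only [setReg_reg, tmp_ne, if_false]
  | seq c₁ c₂ ih₁ ih₂ =>
    unfold check at hc
    split at hc <;> try cases hc
    rename_i B g C h h₁ h₂
    obtain ⟨a1, a2, a3⟩ := ih₁ h₁ hσ hq
    obtain ⟨b1, b2, b3⟩ := ih₂ h₂ a1 (by rw [a2]; exact hq)
    refine ⟨b1, b2.trans a2, (a3.seq b3).mono ?_⟩
    have e1 := Nat.mul_le_mul (Kd.pow_mono_exp hS (le_max_left B C)) (hmono (f := g) (g := h)).1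
    have e2 := Nat.mul_le_mul (Kd.pow_mono_exp hS (le_max_right B C)) (hmono (f := g) (g := h)).2
    have e3 := Nat.mul_le_mul_right (if g || h then M else 1) (Kd.two_mul_pow_le hS (max B C))
    rw [add_mul] at e3
    omega
  | ite e c₁ c₂ ih₁ ih₂ =>
    unfold check at hc
    split at hc <;> try cases hc
    rename_i k C B₁ g B₂ h he h₁ h₂
    set D := max C (max (k.exp + 2) (max B₁ B₂))
    have hb := infer_bd hS hσ.mem e hσ.reg he
    have g1 := Kd.len_le hS hb (show _ ≤ D by omega)
    have g2 := Kd.pow_mono_exp hS (show C ≤ D by omega)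
    have key : ∀ {c : Cmd} {B T}, (if e.eval σ.mem σ.reg ≠ 0 then c₁ else c₂) = c → B ≤ D →
        T ≤ (if g || h then M else 1) → Runs c σ (S ^ B * T) →
        Runs (.ite e c₁ c₂) σ (S ^ (D + 3) * if g || h then M else 1) := by
      intro c B T hcc hBD hT hr d s hs
      obtain ⟨s₁, t₁, hx₁, ht₁, ag₁, hv₁⟩ := infer_computes hS e (d := d) hs.reg
        (by rw [hs.mem]; exact hσ.mem) hσ.reg he
      rw [hs.mem] at hv₁
      obtain ⟨s₂, t₂, hx₂, ht₂, hr₂, hag₂⟩ := hr d s₁ (hs.agree ag₁)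
      have htime : t₁ + (len (e.eval σ.mem σ.reg) + t₂) ≤ S ^ (D + 3) * if g || h then M else 1 := by
        have e1 := Nat.mul_le_mul (Kd.pow_mono_exp hS hBD) hT
        have e2 : S ^ D * 1 ≤ S ^ D * (if g || h then M else 1) := Nat.mul_le_mul_left _ hpos
        have e3 := Nat.mul_le_mul_right (if g || h then M else 1)
          (le_pow_add (S := S) (A := D) hS 3 le_rfl)
        rw [mul_assoc] at e3
        omega
      by_cases h0 : e.eval σ.mem σ.reg = 0
      · rw [if_neg (by simpa using h0)] at hcc
        subst hcc
        refine ⟨s₂, _, .seq hx₁ (.ite_false (by simp [Expr.eval, hv₁, h0]) hx₂), ?_, ?_, ?_⟩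
        · simpa only [Expr.cost, hv₁] using htime
        · simpa [Cmd.den, h0] using hr₂
        · exact fun i hi => (hag₂ i hi).trans (ag₁.tmp i hi)
      · rw [if_pos h0] at hcc
        subst hcc
        refine ⟨s₂, _, .seq hx₁ (.ite_true (by simp [Expr.eval, hv₁, h0]) hx₂), ?_, ?_, ?_⟩
        · simpa only [Expr.cost, hv₁] using htime
        · simpa [Cmd.den, h0] using hr₂
        · exact fun i hi => (hag₂ i hi).trans (ag₁.tmp i hi)
    by_cases h0 : e.eval σ.mem σ.reg = 0
    · obtain ⟨a1, a2, a3⟩ := ih₂ h₂ hσ hq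
      exact ⟨by simpa [Cmd.den, h0] using a1, by simpa [Cmd.den, h0] using a2,
        key (if_neg (by simpa using h0)) (by omega) hmono.2 a3⟩
    · obtain ⟨a1, a2, a3⟩ := ih₁ h₁ hσ hq
      exact ⟨by simpa [Cmd.den, h0] using a1, by simpa [Cmd.den, h0] using a2,
        key (if_pos h0) (by omega) hmono.1 a3⟩
  | loop r N c ih =>
    have main : ∀ {k : Kd} {A B n : ℕ} {f : Bool}, infer Δ N Γ = some (k, A) →
        check Δ Γ q c = some (B, f) → N.eval σ.mem σ.reg = n → k.le (Γ r) = true → r ≠ q →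
        InCtx S Δ Γ ((Cmd.loop r N c).den σ) ∧ ((Cmd.loop r N c).den σ).reg q = σ.reg q ∧
        Runs (.loop r N c) σ (S ^ A + n * (S ^ B * (if f then M else 1) +
          16 * S ^ max A (max (k.exp + 3) B)) + 8 * S ^ max A (max (k.exp + 3) B)) := by
      intro k A B n f hN hc hn hk hr
      have hb := infer_bd hS hσ.mem N hσ.reg hN
      rw [hn] at hb
      have inv : ∀ i ≤ n, InCtx S Δ Γ (iter (fun i s => c.den (s.setReg r i)) i σ) ∧
          (iter (fun i s => c.den (s.setReg r i)) i σ).reg q = σ.reg q := by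
        intro i hi
        induction i with
        | zero => exact ⟨hσ, rfl⟩
        | succ i ihi =>
          obtain ⟨a1, a2⟩ := ihi (by omega)
          have e : ((iter (fun i s => c.den (s.setReg r i)) i σ).setReg r i).reg q = σ.reg q := by
            rw [setReg_reg, if_neg hr.symm, a2]
          obtain ⟨b1, b2, -⟩ := ih hc (a1.setReg hS (show i ≤ k.bd S by omega) hk)
            (by rw [e]; exact hq)
          exact ⟨b1, b2.trans e⟩
      refine ⟨?_, ?_, Runs.loop hn (fun d s hs => ?_) (fun i hi => ?_) ?_ ?_⟩
      · simp only [Cmd.den, hn]; exact (inv n le_rfl).1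
      · simp only [Cmd.den, hn]; exact (inv n le_rfl).2
      · have := infer_computes hS N (d := d) hs.reg (by rw [hs.mem]; exact hσ.mem) hσ.reg hN
        rwa [hs.mem, hn] at this
      · obtain ⟨a1, a2⟩ := inv i (by omega)
        exact (ih hc (a1.setReg hS (show i ≤ k.bd S by omega) hk)
          (by rw [setReg_reg, if_neg hr.symm, a2]; exact hq)).2.2
      · exact Kd.len_le hS hb (by omega)
      · exact len_const_le hS 1 _ (by omega)
    unfold check at hc
    split at hc
    · rename_i a B₁ B₂ g hN hc'
      split_ifs at hc with hif
      simp only [Option.some.injEq, Prod.mk.injEq] at hc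
      obtain ⟨rfl, rfl⟩ := hc
      simp only [Bool.and_eq_true, bne_iff_ne] at hif
      obtain ⟨a1, a2, a3⟩ := main hN hc' rfl hif.1 hif.2
      refine ⟨a1, a2, a3.mono ?_⟩
      have hb : N.eval σ.mem σ.reg ≤ S ^ a := infer_bd hS hσ.mem N hσ.reg hN
      simp only [Kd.exp]
      set D := max B₁ (max (a + 3) B₂)
      set F := if g then M else 1
      have hF : 1 ≤ F := hpos
      have e1 := Kd.pow_mono_exp hS (show B₁ ≤ D by omega)
      have e2 := Kd.pow_mono_exp hS (show B₂ ≤ D by omega)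
      calc S ^ B₁ + N.eval σ.mem σ.reg * (S ^ B₂ * F + 16 * S ^ D) + 8 * S ^ D
          ≤ S ^ D * (S ^ a * F) + S ^ a * (S ^ D * F + 16 * (S ^ D * F)) + 8 * (S ^ D * (S ^ a * F)) := by
            have hF' : 1 ≤ S ^ a * F := Nat.mul_pos (Nat.pow_pos (by omega)) hF
            have x1 : S ^ D * 1 ≤ S ^ D * (S ^ a * F) := Nat.mul_le_mul_left _ hF'
            have x2 : S ^ D * 1 ≤ S ^ D * F := Nat.mul_le_mul_left _ hF
            have x3 : S ^ B₂ * F ≤ S ^ D * F := Nat.mul_le_mul_right _ e2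
            gcongr
            · omega
            · omega
            · omega
        _ = 26 * S ^ D * S ^ a * F := by ring
        _ ≤ 2 ^ 6 * S ^ D * S ^ a * F := by gcongr; norm_num
        _ ≤ S ^ (D + 6) * S ^ a * F := by gcongr; exact le_pow_add hS 6 le_rfl
        _ = S ^ (D + a + 6) * F := by rw [← pow_add]; congr 2; omega
    · rename_i a B₁ B₂ g hN hc'
      split at hc <;> try cases hc
      rename_i q'
      split_ifs at hc with hif
      simp only [Option.some.injEq, Prod.mk.injEq] at hc
      obtain ⟨rfl, rfl⟩ := hc
      simp only [Bool.and_eq_true, bne_iff_ne, beq_iff_eq, Bool.not_eq_true'] at hif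
      obtain ⟨⟨⟨h1, h2⟩, rfl⟩, rfl⟩ := hif
      obtain ⟨a1, a2, a3⟩ := main hN hc' rfl h1 h2
      refine ⟨a1, a2, a3.mono ?_⟩
      simp only [Kd.exp, Bool.false_eq_true, if_false, mul_one, if_true, Ex.eval]
      set D := max B₁ (max (a + 3) B₂)
      have e1 := Kd.pow_mono_exp hS (show B₁ ≤ D by omega)
      have e2 := Kd.pow_mono_exp hS (show B₂ ≤ D by omega)
      calc S ^ B₁ + σ.reg q' * (S ^ B₂ + 16 * S ^ D) + 8 * S ^ D
          ≤ S ^ D * M + M * (S ^ D + 16 * S ^ D) + 8 * (S ^ D * M) := by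
            have x1 : S ^ D * 1 ≤ S ^ D * M := Nat.mul_le_mul_left _ hM
            gcongr
            · omega
            · omega
        _ = 26 * S ^ D * M := by ring
        _ ≤ 2 ^ 6 * S ^ D * M := by gcongr; norm_num
        _ ≤ S ^ (D + 6) * M := by gcongr; exact le_pow_add hS 6 le_rfl
    · cases hc

end RAM

/-! ### Modular decomposition -/

/-- `X` induces a connected graph (or is empty): no proper part of `X` is closed under adjacency. -/
def ConnectedOn {V : Type*} (G : SimpleGraph V) (X : Set V) : Prop :=
  ∀ C ⊆ X, C.Nonempty → (∀ a ∈ C, ∀ b ∈ X, G.Adj a b → b ∈ C) → X ⊆ C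

theorem SimpleGraph.Reachable.mem_of_closed {V : Type*} {G : SimpleGraph V} {C : Set V} {a b : V}
    (h : G.Reachable a b) (hC : ∀ a ∈ C, ∀ b, G.Adj a b → b ∈ C) (ha : a ∈ C) : b ∈ C := by
  obtain ⟨w⟩ := h
  induction w with
  | nil => exact ha
  | cons hab _ ih => exact ih (hC _ ha _ hab)

/-- Connectedness is used below only through closed sets: an argument consists in exhibiting a
nonempty set that is closed under adjacency. -/
theorem induce_preconnected_iff {V : Type*} {G : SimpleGraph V} {X : Set V} :
    (G.induce X).Preconnected ↔ ConnectedOn G X := by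
  constructor
  · rintro h C hCX ⟨x, hx⟩ hC y hy
    have := (h ⟨x, hCX hx⟩ ⟨y, hy⟩).mem_of_closed (C := Subtype.val ⁻¹' C)
      (fun a ha b hab => hC a ha b b.2 hab) hx
    exact this
  · rintro h ⟨x, hx⟩ ⟨y, hy⟩
    obtain ⟨_, h'⟩ := h {y | ∃ hy : y ∈ X, (G.induce X).Reachable ⟨x, hx⟩ ⟨y, hy⟩} (fun y hy => hy.1)
      ⟨x, hx, .refl _⟩ (fun a ⟨ha, hr⟩ b hb hab =>
        ⟨hb, hr.trans (SimpleGraph.Adj.reachable (by exact hab))⟩) hy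
    exact h'

namespace ModularDecomposition

variable {V : Type*} {G : SimpleGraph V}

theorem isModule_iff {M : Set V} :
    IsModule G M ↔ ∀ v ∈ M, ∀ w ∈ M, ∀ x ∉ M, G.Adj v x → G.Adj w x := by
  constructor
  · intro h v hv w hw x hx hvx
    have : x ∈ G.neighborSet w \ M := h v hv w hw ▸ ⟨hvx, hx⟩
    exact this.1
  · intro h v hv w hw
    ext x
    exact ⟨fun ⟨h1, h2⟩ => ⟨h v hv w hw x h2 h1, h2⟩, fun ⟨h1, h2⟩ => ⟨h w hw v hv x h2 h1, h2⟩⟩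

theorem isModule_compl {M : Set V} (h : IsModule Gᶜ M) : IsModule G M := by
  rw [isModule_iff] at h ⊢
  intro v hv w hw x hx hvx
  by_contra hwx
  have := h w hw v hv x hx ((SimpleGraph.compl_adj _ _ _).2 ⟨fun e => hx (e ▸ hw), hwx⟩)
  exact ((SimpleGraph.compl_adj _ _ _).1 this).2 hvx

theorem isModule_compl_iff {M : Set V} : IsModule Gᶜ M ↔ IsModule G M :=
  ⟨isModule_compl, fun h => isModule_compl (by rwa [compl_compl])⟩

theorem isStrongModule_compl_iff {M : Set V} : IsStrongModule Gᶜ M ↔ IsStrongModule G M := by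
  simp only [IsStrongModule, isModule_compl_iff]

theorem isStrongModule_univ : IsStrongModule G Set.univ :=
  ⟨isModule_iff.2 fun _ _ _ _ x hx => absurd (Set.mem_univ x) hx, fun _ _ => .inr (.inr (Set.subset_univ _))⟩

theorem isStrongModule_singleton (v : V) : IsStrongModule G {v} := by
  refine ⟨isModule_iff.2 ?_, fun M' _ => ?_⟩
  · rintro a rfl b rfl x _ h; exact h
  · by_cases h : v ∈ M'
    · exact .inr (.inl (by simpa using h))
    · exact .inl (by simpa using h)

/-- The common vertex `z` carries an adjacency to an outer vertex from one module to the other. -/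
theorem IsModule.union {A B : Set V} (hA : IsModule G A) (hB : IsModule G B) {z : V} (hzA : z ∈ A)
    (hzB : z ∈ B) : IsModule G (A ∪ B) := by
  rw [isModule_iff] at *
  intro v hv w hw x hx hvx
  simp only [Set.mem_union, not_or] at hx hv hw
  have h1 : G.Adj z x := hv.elim (fun h => hA v h z hzA x hx.1 hvx) fun h => hB v h z hzB x hx.2 hvx
  exact hw.elim (fun h => hA z hzA w h x hx.1 h1) fun h => hB z hzB w h x hx.2 h1

/-- Components are strong modules. -/
theorem isStrongModule_reachable (x : V) : IsStrongModule G {y | G.Reachable x y} := by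
  refine ⟨isModule_iff.2 fun v hv w _ y hy hvy => absurd (hv.trans hvy.reachable) hy, fun M' hM' => ?_⟩
  by_contra! h
  obtain ⟨h0, h1, h2⟩ := h
  obtain ⟨u, hu, huM⟩ := h0
  obtain ⟨w, hw, hwD⟩ := Set.not_subset.1 h2
  refine h1 fun y hy => ?_
  -- The part of the component inside `M'` is closed: an edge from it to a vertex `b ∉ M'` would, as
  -- `M'` is a module, give an edge from `w` to `b` and put `w` into the component.
  refine ((hu.symm.trans hy).mem_of_closed (C := {y | G.Reachable x y} ∩ M') ?_ ⟨hu, huM⟩).2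
  intro a ha b hab
  have hb : G.Reachable x b := ha.1.trans hab.reachable
  refine ⟨hb, ?_⟩
  by_contra hbM
  have := isModule_iff.1 hM' a ha.2 w hw b hbM hab
  exact hwD (hb.trans this.symm.reachable)

/-- The trace on `M` of a module of `G` is a module of `G[M]`, which `N` does not overlap. The lemma
carries components and parts of `G[M]` back to strong modules of `G`, where the minimality of `M`
applies. -/
theorem IsStrongModule.image {M : Set V} {N : Set M} (hM : IsStrongModule G M)
    (hN : IsStrongModule (G.induce M) N) : IsStrongModule G (Subtype.val '' N) := by
  constructor
  · rw [isModule_iff]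
    rintro _ ⟨v, hv, rfl⟩ _ ⟨w, hw, rfl⟩ x hx hvx
    by_cases hxM : x ∈ M
    · exact isModule_iff.1 hN.1 v hv w hw ⟨x, hxM⟩ (fun h => hx ⟨_, h, rfl⟩) hvx
    · exact isModule_iff.1 hM.1 v v.2 w w.2 x hxM hvx
  · intro M' hM'
    rcases hM.2 M' hM' with h | h | h
    · left
      ext x
      simp only [Set.mem_inter_iff, Set.mem_empty_iff_false, iff_false, not_and]
      rintro ⟨v, _, rfl⟩ hv
      have : (v : V) ∈ M ∩ M' := ⟨v.2, hv⟩
      rw [h] at this; exact this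
    · right; left
      rintro _ ⟨v, _, rfl⟩
      exact h v.2
    · have hmod : IsModule (G.induce M) (Subtype.val ⁻¹' M') := by
        rw [isModule_iff]
        intro v hv w hw x hx hvx
        exact isModule_iff.1 hM' v hv w hw x hx hvx
      rcases hN.2 _ hmod with h' | h' | h'
      · left
        ext x
        simp only [Set.mem_inter_iff, Set.mem_empty_iff_false, iff_false, not_and]
        rintro ⟨v, hv, rfl⟩ hv'
        have : v ∈ N ∩ Subtype.val ⁻¹' M' := ⟨hv, hv'⟩
        rw [h'] at this; exact this
      · right; left
        rintro _ ⟨v, hv, rfl⟩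
        exact h' hv
      · right; right
        intro x hx
        exact ⟨⟨x, h hx⟩, h' hx, rfl⟩

/-- Inclusion-maximal proper modules. -/
def IsMaximalModule (G : SimpleGraph V) (P : Set V) : Prop :=
  Maximal (fun N => IsModule G N ∧ N.Nonempty ∧ N ≠ Set.univ) P

/-- If two different maximal modules meet, their union is a module and hence everything. Each then
contains the complement of the other, and the two module properties together make the pairs between
`B` and its complement all adjacent or all non-adjacent. So the graph or its complement is
disconnected. -/
theorem IsMaximalModule.eq_of_mem (hG : G.Preconnected) (hGc : Gᶜ.Preconnected) {A B : Set V}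
    (hA : IsMaximalModule G A) (hB : IsMaximalModule G B) {z : V} (hzA : z ∈ A) (hzB : z ∈ B) :
    A = B := by
  by_contra hne
  have hU : A ∪ B = Set.univ := by
    by_contra hU
    have hm := hA.1.1.union hB.1.1 hzA hzB
    have h1 := hA.2 ⟨hm, ⟨z, .inl hzA⟩, hU⟩ Set.subset_union_left
    have h2 := hB.2 ⟨hm, ⟨z, .inl hzA⟩, hU⟩ Set.subset_union_right
    exact hne ((Set.subset_union_left.trans h2).antisymm (Set.subset_union_right.trans h1))
  obtain ⟨p, hpB⟩ := (Set.ne_univ_iff_exists_notMem B).1 hB.1.2.2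
  obtain ⟨q, hqA⟩ := (Set.ne_univ_iff_exists_notMem A).1 hA.1.2.2
  have hin : ∀ x, x ∉ B → x ∈ A := fun x hx => by
    have : x ∈ A ∪ B := hU ▸ Set.mem_univ x
    exact this.resolve_right hx
  have hin' : ∀ x, x ∉ A → x ∈ B := fun x hx => by
    have : x ∈ A ∪ B := hU ▸ Set.mem_univ x
    exact this.resolve_left hx
  have mA := isModule_iff.1 hA.1.1
  have mB := isModule_iff.1 hB.1.1
  -- all pairs between `Bᶜ` and `B` are adjacent, or none is
  have key : ∀ x ∉ B, ∀ b ∈ B, G.Adj x b ↔ G.Adj q z := by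
    intro x hx b hb
    constructor
    · intro h
      exact (mA x (hin x hx) z hzA q hqA (mB b hb q (hin' q hqA) x hx h.symm).symm).symm
    · intro h
      exact (mB q (hin' q hqA) b hb x hx (mA z hzA x (hin x hx) q hqA h.symm).symm).symm
  by_cases hadj : G.Adj q z
  · refine hpB ((hGc z p).mem_of_closed (C := B) ?_ hzB)
    intro a ha b hab
    by_contra hb
    exact ((SimpleGraph.compl_adj _ _ _).1 hab).2 ((key b hb a ha).2 hadj).symm
  · refine hpB ((hG z p).mem_of_closed (C := B) ?_ hzB)
    intro a ha b hab
    by_contra hb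
    exact hadj ((key b hb a ha).1 hab.symm)

theorem exists_isMaximalModule [Finite V] {N : Set V} (hN : IsModule G N) (h0 : N.Nonempty)
    (h1 : N ≠ Set.univ) : ∃ P, N ⊆ P ∧ IsMaximalModule G P :=
  (Set.toFinite {N | IsModule G N ∧ N.Nonempty ∧ N ≠ Set.univ}).exists_le_maximal ⟨hN, h0, h1⟩

/-- A proper module meeting `P` lies in some maximal module, and the maximal modules are disjoint,
so that one is `P`. -/
theorem IsMaximalModule.isStrongModule [Finite V] (hG : G.Preconnected) (hGc : Gᶜ.Preconnected)
    {P : Set V} (hP : IsMaximalModule G P) : IsStrongModule G P := by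
  refine ⟨hP.1.1, fun M' hM' => ?_⟩
  by_cases h0 : (P ∩ M').Nonempty
  · obtain ⟨z, hz, hz'⟩ := h0
    by_cases h1 : M' = Set.univ
    · exact .inr (.inl (h1 ▸ Set.subset_univ _))
    · obtain ⟨P', hMP', hP'⟩ := exists_isMaximalModule hM' ⟨z, hz'⟩ h1
      obtain rfl := hP.eq_of_mem hG hGc hP' hz (hMP' hz')
      exact .inr (.inr hMP')
  · exact .inl (Set.not_nonempty_iff_eq_empty.1 h0)

theorem mem_canonicalPartition_iff [Finite V] (hG : G.Preconnected) (hGc : Gᶜ.Preconnected)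
    {P : Set V} : P ∈ canonicalPartition G ↔ IsMaximalModule G P := by
  constructor
  · intro h
    obtain ⟨P', hPP', hP'⟩ := exists_isMaximalModule h.1.1.1 h.1.2.1 h.1.2.2
    have := h.2 ⟨hP'.isStrongModule hG hGc, hP'.1.2⟩ hPP'
    rwa [hPP'.antisymm this]
  · intro h
    exact ⟨⟨h.isStrongModule hG hGc, h.1.2⟩, fun N hN hle => h.2 ⟨hN.1.1, hN.2⟩ hle⟩

theorem eq_of_mem_canonicalPartition {P Q : Set V} (hP : P ∈ canonicalPartition G)
    (hQ : Q ∈ canonicalPartition G) {z : V} (hzP : z ∈ P) (hzQ : z ∈ Q) : P = Q := by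
  rcases hP.1.1.2 Q hQ.1.1.1 with h | h | h
  · have : z ∈ P ∩ Q := ⟨hzP, hzQ⟩
    rw [h] at this; exact this.elim
  · exact h.antisymm (hP.2 hQ.1 h)
  · exact (hQ.2 hP.1 h).antisymm h

theorem exists_mem_canonicalPartition_superset [Finite V] {N : Set V} (hN : IsStrongModule G N)
    (h0 : N.Nonempty) (h1 : N ≠ Set.univ) : ∃ P ∈ canonicalPartition G, N ⊆ P := by
  obtain ⟨P, h, hP⟩ := (Set.toFinite {N | IsStrongModule G N ∧ N.Nonempty ∧ N ≠ Set.univ}).exists_le_maximal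
    (show N ∈ _ from ⟨hN, h0, h1⟩)
  exact ⟨P, hP, h⟩

theorem exists_mem_canonicalPartition [Finite V] [Nontrivial V] (v : V) :
    ∃ P ∈ canonicalPartition G, v ∈ P := by
  obtain ⟨P, hP, h⟩ := exists_mem_canonicalPartition_superset (isStrongModule_singleton (G := G) v)
    (Set.singleton_nonempty v) (by
      obtain ⟨w, hw⟩ := exists_ne v
      exact fun h => hw (by simpa using (h ▸ Set.mem_univ w : w ∈ ({v} : Set V))))
  exact ⟨P, hP, h rfl⟩

/-- Adjacency between vertices in different parts depends on the parts only. -/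
theorem adj_of_parts {P Q : Set V} (hP : IsModule G P) (hQ : IsModule G Q) (hd : ∀ x ∈ P, x ∉ Q)
    {u u' v v' : V} (hu : u ∈ P) (hu' : u' ∈ P) (hv : v ∈ Q) (hv' : v' ∈ Q) (h : G.Adj u v) :
    G.Adj u' v' := by
  have h1 := isModule_iff.1 hP u hu u' hu' v (fun h => hd v h hv) h
  exact (isModule_iff.1 hQ v hv v' hv' u' (hd u' hu') h1.symm).symm

/-- Gallai's theorem. The union of the parts in a module of the quotient is a module of `G`; if it
is not everything, it lies in a maximal module, that is, in a single part. The quotient has an edge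
and a non-edge because, by connectedness of the graph and of its complement, every part is left by
an edge and by a non-edge. -/
theorem quotient_prime [Finite V] [Nontrivial V] (hG : G.Preconnected) (hGc : Gᶜ.Preconnected) :
    HasOnlyTrivialModules (quotientGraph G (canonicalPartition G)) ∧
      quotientGraph G (canonicalPartition G) ≠ ⊥ ∧ quotientGraph G (canonicalPartition G) ≠ ⊤ := by
  have hdisj : ∀ {P Q : canonicalPartition G}, P ≠ Q → ∀ x ∈ (P : Set V), x ∉ (Q : Set V) :=
    fun {P Q} hne x hx hx' => hne (Subtype.ext (eq_of_mem_canonicalPartition P.2 Q.2 hx hx'))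
  have hmod : ∀ P : canonicalPartition G, IsModule G (P : Set V) := fun P => P.2.1.1.1
  have cross : ∀ P : canonicalPartition G, ∀ H : SimpleGraph V, H.Preconnected →
      ∃ x ∈ (P : Set V), ∃ y ∉ (P : Set V), H.Adj x y := by
    intro P H hH
    by_contra! hcon
    obtain ⟨x, hx⟩ := P.2.1.2.1
    obtain ⟨y, hy⟩ := (Set.ne_univ_iff_exists_notMem _).1 P.2.1.2.2
    refine hy ((hH x y).mem_of_closed (fun a ha b hab => ?_) hx)
    by_contra hb
    exact hcon a ha b hb hab
  obtain ⟨v₀⟩ : Nonempty V := inferInstance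
  obtain ⟨P₀, hP₀, hv₀⟩ := exists_mem_canonicalPartition (G := G) v₀
  refine ⟨?_, ?_, ?_⟩
  · intro 𝒜 h𝒜
    by_cases h0 : 𝒜.Nonempty
    swap
    · exact .inl (Set.not_nonempty_iff_eq_empty.1 h0)
    right
    have hU : IsModule G {x | ∃ P ∈ 𝒜, x ∈ (P : Set V)} := by
      rw [isModule_iff]
      rintro v ⟨P, hP, hv⟩ w ⟨Q, hQ, hw⟩ x hx hvx
      obtain ⟨R, hR, hxR⟩ := exists_mem_canonicalPartition (G := G) x
      have hR𝒜 : (⟨R, hR⟩ : canonicalPartition G) ∉ 𝒜 := fun h => hx ⟨_, h, hxR⟩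
      have hPR : P ≠ ⟨R, hR⟩ := fun h => hR𝒜 (h ▸ hP)
      have hQR : Q ≠ ⟨R, hR⟩ := fun h => hR𝒜 (h ▸ hQ)
      obtain ⟨-, u, hu, y, hy, huy⟩ :=
        isModule_iff.1 h𝒜 P hP Q hQ ⟨R, hR⟩ hR𝒜 ⟨hPR, v, hv, x, hxR, hvx⟩
      exact adj_of_parts (hmod Q) (hmod ⟨R, hR⟩) (hdisj hQR) hu hw hy hxR huy
    by_cases h1 : {x | ∃ P ∈ 𝒜, x ∈ (P : Set V)} = Set.univ
    · left
      ext Q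
      simp only [Set.mem_univ, iff_true]
      obtain ⟨x, hx⟩ := Q.2.1.2.1
      have : x ∈ {x | ∃ P ∈ 𝒜, x ∈ (P : Set V)} := h1 ▸ Set.mem_univ x
      obtain ⟨P, hP, hxP⟩ := this
      have : P = Q := Subtype.ext (eq_of_mem_canonicalPartition P.2 Q.2 hxP hx)
      exact this ▸ hP
    · right
      obtain ⟨P, hP⟩ := h0
      obtain ⟨x, hx⟩ := P.2.1.2.1
      obtain ⟨R, hUR, hR⟩ := exists_isMaximalModule hU ⟨x, P, hP, hx⟩ h1
      have hR' := (mem_canonicalPartition_iff hG hGc).2 hR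
      refine ⟨⟨R, hR'⟩, Set.eq_singleton_iff_nonempty_unique_mem.2 ⟨⟨P, hP⟩, fun Q hQ => ?_⟩⟩
      obtain ⟨y, hy⟩ := Q.2.1.2.1
      exact Subtype.ext (eq_of_mem_canonicalPartition Q.2 hR' hy (hUR ⟨Q, hQ, hy⟩))
  · obtain ⟨x, hx, y, hy, hxy⟩ := cross ⟨P₀, hP₀⟩ G hG
    obtain ⟨Q, hQ, hyQ⟩ := exists_mem_canonicalPartition (G := G) y
    intro h
    have : (quotientGraph G (canonicalPartition G)).Adj ⟨P₀, hP₀⟩ ⟨Q, hQ⟩ :=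
      ⟨fun e => hy (by rw [e]; exact hyQ), x, hx, y, hyQ, hxy⟩
    rw [h] at this
    exact this
  · obtain ⟨x, hx, y, hy, hxy⟩ := cross ⟨P₀, hP₀⟩ Gᶜ hGc
    obtain ⟨Q, hQ, hyQ⟩ := exists_mem_canonicalPartition (G := G) y
    have hne : (⟨P₀, hP₀⟩ : canonicalPartition G) ≠ ⟨Q, hQ⟩ := fun e => hy (by rw [e]; exact hyQ)
    intro h
    have : (quotientGraph G (canonicalPartition G)).Adj ⟨P₀, hP₀⟩ ⟨Q, hQ⟩ := by
      rw [h]; exact hne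
    obtain ⟨-, u, hu, v, hv, huv⟩ := this
    exact ((SimpleGraph.compl_adj _ _ _).1 hxy).2
      (adj_of_parts (hmod ⟨P₀, hP₀⟩) (hmod ⟨Q, hQ⟩) (hdisj hne) hu hx hv hyQ huv)

/-- If a connected set `X` contains `K`, then `K` has diameter at most two, or some vertex of `X` is
adjacent to all of `K`, or `X` lies in the smallest strong module containing `K`, a prime node. -/
theorem terminals_trichotomy [Finite V] {K X : Set V} (hKX : K ⊆ X) (hX : ConnectedOn G X) :
    (∀ u ∈ K, ∀ w ∈ K, u = w ∨ G.Adj u w ∨ ∃ x ∈ K, G.Adj u x ∧ G.Adj w x) ∨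
    (∃ v ∈ X, v ∉ K ∧ ∀ u ∈ K, G.Adj u v) ∨
    ∃ M, IsPrimeNode G M ∧ X ⊆ M ∧ ∀ N ∈ canonicalPartition (G.induce M), ¬ K ⊆ Subtype.val '' N := by
  rcases K.subsingleton_or_nontrivial with hK | hK
  · exact .inl fun u hu w hw => .inl (hK hu hw)
  -- A minimal strong module containing `K`. Minimality is used in the form `small`: no strong
  -- module of `G[M]` except the whole of `M` contains `K`.
  obtain ⟨M, hM⟩ := (Set.toFinite {M | IsStrongModule G M ∧ K ⊆ M}).exists_minimal
    ⟨Set.univ, isStrongModule_univ, Set.subset_univ _⟩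
  obtain ⟨⟨hMs, hKM⟩, hmin⟩ := hM
  obtain ⟨k₀, hk₀⟩ := hK.nonempty
  have small : ∀ N : Set M, IsStrongModule (G.induce M) N → K ⊆ Subtype.val '' N → N = Set.univ := by
    intro N hN hKN
    have := hmin ⟨hMs.image hN, hKN⟩ (by rintro _ ⟨v, _, rfl⟩; exact v.2)
    ext x
    obtain ⟨y, hy, hyx⟩ := this x.2
    simpa [Subtype.ext hyx] using hy
  by_cases hXM : X ⊆ M
  swap
  -- Some edge of `X` leaves `M`, and its outer end is adjacent to the whole module `M`, in
  -- particular to all terminals.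
  · right; left
    by_contra! hcon
    refine hXM fun x hx => (hX (X ∩ M) Set.inter_subset_left ⟨k₀, hKX hk₀, hKM hk₀⟩ ?_ hx).2
    intro a ha b hb hab
    refine ⟨hb, ?_⟩
    by_contra hbM
    obtain ⟨u, hu, hub⟩ := hcon b hb fun h => hbM (hKM h)
    exact hub (isModule_iff.1 hMs.1 a ha.2 u (hKM hu) b hbM hab)
  by_cases hc : (G.induce M).Preconnected
  swap
  -- As `X` is connected and lies in `M`, one component of `G[M]` contains all terminals; by `small`
  -- it is everything.
  · exfalso
    apply hc
    set D : Set M := {y | (G.induce M).Reachable ⟨k₀, hKM hk₀⟩ y} with hD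
    have hKD : K ⊆ Subtype.val '' D := by
      intro k hk
      have := hX (X ∩ Subtype.val '' D) Set.inter_subset_left
        ⟨k₀, hKX hk₀, ⟨k₀, hKM hk₀⟩, SimpleGraph.Reachable.refl _, rfl⟩ ?_ (hKX hk)
      · exact this.2
      · rintro a ⟨ha, a, haD, rfl⟩ b hb hab
        exact ⟨hb, ⟨b, hXM hb⟩, haD.trans (SimpleGraph.Adj.reachable (by exact hab)), rfl⟩
    have hDu := small D (isStrongModule_reachable _) hKD
    intro x y
    have hx : x ∈ D := hDu ▸ Set.mem_univ x
    have hy : y ∈ D := hDu ▸ Set.mem_univ y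
    exact hx.symm.trans hy
  by_cases hcc : (G.induce M)ᶜ.Preconnected
  swap
  -- Suppose that `u` and `w` are non-adjacent and have no common neighbour in `K`. They lie in one
  -- co-component `D`. A terminal outside `D` would be adjacent to both, so all of `K` lies in `D`,
  -- and `small` makes the complement of `G[M]` connected.
  · left
    intro u hu w hw
    by_contra! hcon
    obtain ⟨huw, hnadj, hno⟩ := hcon
    apply hcc
    set D : Set M := {y | (G.induce M)ᶜ.Reachable ⟨u, hKM hu⟩ y} with hD
    have hwD : (⟨w, hKM hw⟩ : M) ∈ D := by
      refine SimpleGraph.Adj.reachable ((SimpleGraph.compl_adj _ _ _).2 ⟨?_, hnadj⟩)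
      simpa using huw
    have hKD : K ⊆ Subtype.val '' D := by
      intro k hk
      by_contra hkD
      have hk' : (⟨k, hKM hk⟩ : M) ∉ D := fun h => hkD ⟨_, h, rfl⟩
      have adj : ∀ y ∈ D, G.Adj y k := by
        intro y hy
        by_contra hyk
        refine hk' (SimpleGraph.Reachable.trans hy (SimpleGraph.Adj.reachable
          ((SimpleGraph.compl_adj _ _ _).2 ⟨?_, hyk⟩)))
        rintro rfl
        exact hk' hy
      exact hno k hk (adj ⟨u, hKM hu⟩ (SimpleGraph.Reachable.refl _)) (adj _ hwD)
    have hDu := small D (isStrongModule_compl_iff.1 (isStrongModule_reachable _)) hKD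
    intro x y
    have hx : x ∈ D := hDu ▸ Set.mem_univ x
    have hy : y ∈ D := hDu ▸ Set.mem_univ y
    exact hx.symm.trans hy
  -- Now `G[M]` and its complement are connected, and by `small` no part contains all terminals.
  · right; right
    have hMn : M.Nontrivial := hK.mono hKM
    have : Nontrivial M := Set.nontrivial_coe_sort.2 hMn
    obtain ⟨h1, h2, h3⟩ := quotient_prime hc hcc
    exact ⟨M, ⟨⟨hMs, hMn.nonempty⟩, hMn, h1, h2, h3⟩, hXM, fun N hN hKN => hN.1.2.2 (small N hN.1.1 hKN)⟩

end ModularDecomposition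

/-! ### Steiner trees in a graph and in its quotient -/

/-- `r` sends each vertex of `M` to a representative of its part, for a partition of `M` into
modules. -/
structure IsRepMap {V : Type*} (G : SimpleGraph V) (M : Set V) (r : V → V) : Prop where
  mem : ∀ v ∈ M, r v ∈ M
  idem : ∀ v ∈ M, r (r v) = r v
  adj : ∀ u ∈ M, ∀ u' ∈ M, ∀ v ∈ M, ∀ v' ∈ M, r u = r u' → r v = r v' → r u ≠ r v →
    G.Adj u v → G.Adj u' v'

section
variable {V : Type*} [DecidableEq V] (r : V → V) (K : Finset V) (c : V → ℕ)

/-- The cost of a part: the cost of its terminals or, if there are none, of its representative. -/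
def partCost (v : V) : ℕ :=
  if v ∈ K.image r then ∑ u ∈ K with r u = v, c u else c v

variable {r K c} {G : SimpleGraph V} {M : Set V}

/-- In the parts with terminals, the representative is replaced by all the terminals. Several
terminals of one part need not be connected inside the part, but since `K` meets two parts, the part
has a neighbour in the connected set `X`, and this neighbour is adjacent to the entire part. -/
theorem lift_solution (hr : IsRepMap G M r) {X : Finset V} (hK : ↑K ⊆ M)
    {k₁ k₂ : V} (hk₁ : k₁ ∈ K) (hk₂ : k₂ ∈ K) (hk : r k₁ ≠ r k₂)
    (hXM : ∀ v ∈ X, v ∈ M ∧ r v = v) (hKX : K.image r ⊆ X) (hX : ConnectedOn G (X : Set V)) :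
    ∃ Y : Finset V, K ⊆ Y ∧ ConnectedOn G (Y : Set V) ∧ ∑ v ∈ Y, c v = ∑ v ∈ X, partCost r K c v := by
  have hKX' : ∀ k ∈ K, r k ∈ X := fun k hk => hKX (Finset.mem_image_of_mem r hk)
  set Y := K ∪ X \ K.image r with hY
  have hYM : ∀ y ∈ Y, y ∈ M ∧ r y ∈ X := by
    intro y hy
    rcases Finset.mem_union.1 hy with h | h
    · exact ⟨hK h, hKX' y h⟩
    · have := hXM y (Finset.mem_sdiff.1 h).1
      exact ⟨this.1, this.2.symm ▸ (Finset.mem_sdiff.1 h).1⟩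
  have surj : ∀ x ∈ X, ∃ y ∈ Y, r y = x := by
    intro x hx
    by_cases h : x ∈ K.image r
    · obtain ⟨k, hk, rfl⟩ := Finset.mem_image.1 h
      exact ⟨k, Finset.mem_union_left _ hk, rfl⟩
    · exact ⟨x, Finset.mem_union_right _ (Finset.mem_sdiff.2 ⟨hx, h⟩), (hXM x hx).2⟩
  have lift : ∀ y ∈ Y, ∀ z ∈ Y, G.Adj (r y) (r z) → G.Adj y z := by
    intro y hy z hz h
    exact hr.adj _ (hr.mem y (hYM y hy).1) _ (hYM y hy).1 _ (hr.mem z (hYM z hz).1) _ (hYM z hz).1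
      (hr.idem y (hYM y hy).1) (hr.idem z (hYM z hz).1)
      (by rw [hr.idem y (hYM y hy).1, hr.idem z (hYM z hz).1]; exact h.ne) h
  refine ⟨Y, Finset.subset_union_left, ?_, ?_⟩
  · intro C hCY ⟨y₀, hy₀⟩ hC z hz
    have hall := hX {x | x ∈ X ∧ ∃ y ∈ C, r y = x} (fun x hx => hx.1)
      ⟨r y₀, (hYM y₀ (hCY hy₀)).2, y₀, hy₀, rfl⟩ (by
        rintro a ⟨-, y, hy, rfl⟩ b hb hab
        obtain ⟨w, hw, rfl⟩ := surj b hb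
        exact ⟨hb, w, hC y hy w hw (lift y (hCY hy) w hw hab), rfl⟩)
    -- the part of `z` has a neighbour in the quotient
    have hz' := hYM z hz
    obtain ⟨a, haX, ha⟩ : ∃ a ∈ X, G.Adj a (r z) := by
      by_contra! hcon
      have := hX {r z} (by simpa using hz'.2) ⟨r z, rfl⟩ (by
        rintro _ rfl b hb hab
        exact absurd hab.symm (hcon b hb))
      exact hk ((this (hKX' k₁ hk₁)).trans (this (hKX' k₂ hk₂)).symm)
    obtain ⟨-, y, hy, rfl⟩ := hall haX
    exact hC y hy z hz (lift y (hCY hy) z hz ha)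
  · rw [hY, Finset.sum_union]
    · rw [← Finset.sum_sdiff hKX, add_comm]
      congr 1
      · refine Finset.sum_congr rfl fun x hx => ?_
        rw [partCost, if_neg (Finset.mem_sdiff.1 hx).2]
      · rw [← Finset.sum_fiberwise_of_maps_to (g := r) (t := K.image r)
          (fun k hk => Finset.mem_image_of_mem r hk)]
        exact Finset.sum_congr rfl fun x hx => by rw [partCost, if_pos hx]
    · rw [Finset.disjoint_left]
      intro k hk hk'
      obtain ⟨h1, h2⟩ := Finset.mem_sdiff.1 hk'
      exact h2 ((hXM k h1).2 ▸ Finset.mem_image_of_mem r hk)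

/-- Edges between different parts survive in the quotient. In each part that it meets, `Y` pays for
all the terminals there, and for at least the cheapest vertex if there are none. -/
theorem project_solution (hr : IsRepMap G M r) (hc : ∀ v ∈ M, c (r v) ≤ c v) {Y : Finset V}
    (hYM : ↑Y ⊆ M) (hKY : K ⊆ Y) (hY : ConnectedOn G (Y : Set V)) :
    (∀ v ∈ Y.image r, v ∈ M ∧ r v = v) ∧ K.image r ⊆ Y.image r ∧
      ConnectedOn G (Y.image r : Set V) ∧
      ∑ v ∈ Y.image r, partCost r K c v ≤ ∑ v ∈ Y, c v := by
  refine ⟨?_, Finset.image_subset_image hKY, ?_, ?_⟩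
  · intro v hv
    obtain ⟨y, hy, rfl⟩ := Finset.mem_image.1 hv
    exact ⟨hr.mem y (hYM hy), hr.idem y (hYM hy)⟩
  · intro C hC ⟨c₀, hc₀⟩ hcl
    obtain ⟨y₀, hy₀, rfl⟩ := Finset.mem_image.1 (Finset.mem_coe.1 (hC hc₀))
    have := hY {y | y ∈ Y ∧ r y ∈ C} (fun y hy => hy.1) ⟨y₀, hy₀, hc₀⟩ (by
      rintro a ⟨ha, haC⟩ b hb hab
      refine ⟨hb, ?_⟩
      by_cases h : r a = r b
      · exact h ▸ haC
      · refine hcl _ haC _ (Finset.mem_coe.2 (Finset.mem_image_of_mem r hb)) ?_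
        exact hr.adj _ (hYM ha) _ (hr.mem a (hYM ha)) _ (hYM hb) _ (hr.mem b (hYM hb))
          (hr.idem a (hYM ha)).symm (hr.idem b (hYM hb)).symm h hab)
    intro x hx
    obtain ⟨y, hy, rfl⟩ := Finset.mem_image.1 (Finset.mem_coe.1 hx)
    exact (this hy).2
  · rw [← Finset.sum_fiberwise_of_maps_to (g := r) (t := Y.image r) (s := Y)
      (fun k hk => Finset.mem_image_of_mem r hk)]
    refine Finset.sum_le_sum fun v hv => ?_
    unfold partCost
    split_ifs with h
    · exact Finset.sum_le_sum_of_subset (Finset.filter_subset_filter _ hKY)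
    · obtain ⟨y, hy, rfl⟩ := Finset.mem_image.1 hv
      exact (hc y (hYM hy)).trans (Finset.single_le_sum (f := c) (fun _ _ => Nat.zero_le _)
        (Finset.mem_filter.2 ⟨hy, rfl⟩))

end

/-! ### Summing over colourings along a tree decomposition -/

section elimination
variable {V ι : Type*} [Fintype V] [DecidableEq V] [Fintype ι] [DecidableEq ι]
  {A : Type*} [CommSemiring A]

/-- The colourings that vanish outside `U`. -/
def colorings (U : Finset V) : Finset (V → Fin 3) :=
  Fintype.piFinset fun v => if v ∈ U then Finset.univ else {0}

def restr (f : V → Fin 3) (U : Finset V) : V → Fin 3 := fun v => if v ∈ U then f v else 0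

theorem mem_colorings {U : Finset V} {f : V → Fin 3} : f ∈ colorings U ↔ ∀ v ∉ U, f v = 0 := by
  simp only [colorings, Fintype.mem_piFinset]
  refine forall_congr' fun v => ?_
  by_cases h : v ∈ U <;> simp [h]

theorem restr_mem (f : V → Fin 3) (U : Finset V) : restr f U ∈ colorings U :=
  mem_colorings.2 fun v hv => by simp [restr, hv]

theorem restr_restr (f : V → Fin 3) (U W : Finset V) : restr (restr f U) W = restr f (U ∩ W) := by
  ext v; by_cases h1 : v ∈ U <;> by_cases h2 : v ∈ W <;> simp [restr, h1, h2]

theorem restr_of_mem {f : V → Fin 3} {U : Finset V} (h : f ∈ colorings U) : restr f U = f := by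
  ext v; by_cases h1 : v ∈ U <;> simp [restr, h1, mem_colorings.1 h v]

variable (T : SimpleGraph ι) [DecidableRel T.Adj] (B : ι → Finset V) (a : V → Fin 3 → A)
  (loc : ι → (V → Fin 3) → A)

/-- The factor at `t`, given the messages of the nodes outside `S`. -/
def nodeFactor (S : Finset ι) (m : ι → (V → Fin 3) → A) (t : ι) (g : V → Fin 3) : A :=
  loc t g * ∏ c with c ∉ S ∧ T.Adj t c, m c (restr g (B c))

/-- The sum over all colourings of the vertices in the bags of `S`. -/
def totalSum (S : Finset ι) (m : ι → (V → Fin 3) → A) : A :=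
  ∑ f ∈ colorings (S.biUnion B), (∏ v ∈ S.biUnion B, a v (f v)) *
    ∏ t ∈ S, nodeFactor T B loc S m t (restr f (B t))

/-- The vertices of the bag of `l` that also lie in the bag of a neighbour in `S`. -/
def boundary (S : Finset ι) (l : ι) : Finset V :=
  (B l).filter fun v => ∃ u ∈ S, T.Adj l u ∧ v ∈ B u

variable {T B} in
theorem mem_boundary {S : Finset ι} {l : ι} {v : V} :
    v ∈ boundary T B S l ↔ v ∈ B l ∧ ∃ u ∈ S, T.Adj l u ∧ v ∈ B u := Finset.mem_filter

/-- The message of the node `l`. -/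
def message (S : Finset ι) (m : ι → (V → Fin 3) → A) (l : ι) (σ : V → Fin 3) : A :=
  ∑ g ∈ colorings (B l) with restr g (boundary T B S l) = σ,
    (∏ v ∈ B l \ boundary T B S l, a v (g v)) * nodeFactor T B loc S m l g

variable {T B a loc}

/-- Distributivity: the colours of the vertices that occur only in the bag of the leaf `l` are
summed out first. The inner sum is the message of `l`. It depends only on the colours of the
vertices shared with other bags; by `hB` these all lie in the bag of the single neighbour `u`, so
the message can be absorbed in the factor of `u`. -/
theorem totalSum_erase {S : Finset ι} {m m' : ι → (V → Fin 3) → A} {l u : ι} (hl : l ∈ S) (hu : u ∈ S)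
    (hlu : T.Adj l u) (huniq : ∀ t ∈ S, T.Adj l t → t = u)
    (hB : ∀ v ∈ B l, ∀ t ∈ S, t ≠ l → v ∈ B t → v ∈ B u)
    (hm : ∀ c ∉ S, m' c = m c)
    (hml : ∀ g, m' l (restr g (boundary T B S l)) =
      message T B a loc S m l (restr g (boundary T B S l))) :
    totalSum T B a loc (S.erase l) m' = totalSum T B a loc S m := by
  have hbd : boundary T B S l = B l ∩ B u := by
    ext v
    simp only [boundary, Finset.mem_filter, Finset.mem_inter, and_congr_right_iff]
    intro _
    exact ⟨fun ⟨t, ht, hlt, hv⟩ => huniq t ht hlt ▸ hv, fun hv => ⟨u, hu, hlu, hv⟩⟩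
  set S' := S.erase l with hS'
  set D := boundary T B S l with hD
  have huS' : u ∈ S' := Finset.mem_erase.2 ⟨hlu.ne', hu⟩
  have hBU : ∀ t ∈ S', B t ⊆ S'.biUnion B := fun t ht => Finset.subset_biUnion_of_mem B ht
  have hdisj : Disjoint (S'.biUnion B) (B l \ D) := by
    rw [Finset.disjoint_left]
    intro v hv hv'
    obtain ⟨t, ht, hvt⟩ := Finset.mem_biUnion.1 hv
    obtain ⟨h1, h2⟩ := Finset.mem_sdiff.1 hv'
    rw [hbd, Finset.mem_inter, not_and] at h2
    exact h2 h1 (hB v h1 t (Finset.mem_erase.1 ht).2 (Finset.mem_erase.1 ht).1 hvt)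
  have hDU : D ⊆ S'.biUnion B := by
    rw [hbd]; exact Finset.inter_subset_right.trans (hBU u huS')
  have hU : S.biUnion B = S'.biUnion B ∪ (B l \ D) := by
    ext v
    simp only [Finset.mem_union, Finset.mem_biUnion]
    constructor
    · rintro ⟨t, ht, hv⟩
      by_cases htl : t = l
      · subst htl
        by_cases hvD : v ∈ D
        · exact .inl (Finset.mem_biUnion.1 (hDU hvD))
        · exact .inr (Finset.mem_sdiff.2 ⟨hv, hvD⟩)
      · exact .inl ⟨t, Finset.mem_erase.2 ⟨htl, ht⟩, hv⟩
    · rintro (⟨t, ht, hv⟩ | hv)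
      · exact ⟨t, (Finset.mem_erase.1 ht).2, hv⟩
      · exact ⟨l, hl, (Finset.mem_sdiff.1 hv).1⟩
  have hBlU : B l ⊆ S.biUnion B := Finset.subset_biUnion_of_mem B hl
  have hU'U : S'.biUnion B ⊆ S.biUnion B := hU ▸ Finset.subset_union_left
  -- the factors of the remaining nodes
  have hfac : ∀ f : V → Fin 3, ∏ t ∈ S', nodeFactor T B loc S' m' t (restr f (B t)) =
      (∏ t ∈ S', nodeFactor T B loc S m t (restr f (B t))) * m' l (restr f D) := by
    intro f
    have hne : ∀ t ∈ S', t ≠ u → nodeFactor T B loc S' m' t (restr f (B t)) =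
        nodeFactor T B loc S m t (restr f (B t)) := by
      intro t ht htu
      obtain ⟨htl, htS⟩ := Finset.mem_erase.1 ht
      unfold nodeFactor
      congr 1
      refine Finset.prod_congr ?_ fun c hc => ?_
      · ext c
        simp only [Finset.mem_filter, Finset.mem_univ, true_and, hS', Finset.mem_erase, not_and]
        constructor
        · rintro ⟨h1, h2⟩
          refine ⟨h1 ?_, h2⟩
          rintro rfl
          exact htu (huniq t htS h2.symm)
        · rintro ⟨h1, h2⟩
          exact ⟨fun _ => h1, h2⟩
      · rw [hm c (Finset.mem_filter.1 hc).2.1]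
    have hue : nodeFactor T B loc S' m' u (restr f (B u)) =
        nodeFactor T B loc S m u (restr f (B u)) * m' l (restr f D) := by
      unfold nodeFactor
      have : (Finset.univ.filter fun c => c ∉ S' ∧ T.Adj u c) =
          insert l (Finset.univ.filter fun c => c ∉ S ∧ T.Adj u c) := by
        ext c
        simp only [Finset.mem_filter, Finset.mem_univ, true_and, hS', Finset.mem_erase, not_and,
          Finset.mem_insert]
        constructor
        · rintro ⟨h1, h2⟩
          by_cases h : c = l
          · exact .inl h
          · exact .inr ⟨h1 h, h2⟩
        · rintro (rfl | ⟨h1, h2⟩)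
          · exact ⟨fun h => absurd rfl h, hlu.symm⟩
          · exact ⟨fun _ => h1, h2⟩
      rw [this, Finset.prod_insert (by simp [hl]), restr_restr, Finset.inter_comm, ← hbd, mul_assoc,
        mul_comm (m' l _)]
      congr 2
      exact Finset.prod_congr rfl fun c hc => by rw [hm c (Finset.mem_filter.1 hc).2.1]
    rw [← Finset.mul_prod_erase _ _ huS', ← Finset.mul_prod_erase _ _ huS', hue,
      Finset.prod_congr rfl fun t ht => hne t (Finset.mem_erase.1 ht).2 (Finset.mem_erase.1 ht).1]
    ring
  unfold totalSum
  simp only [hfac, hml, message, Finset.mul_sum]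
  rw [Finset.sum_sigma']
  -- A colouring of all the vertices is the same as a colouring of the vertices that remain and a
  -- colouring of the bag of `l` that agree on `D`.
  refine Finset.sum_nbij' (fun p v => if v ∈ S'.biUnion B then p.1 v else p.2 v)
    (fun f => ⟨restr f (S'.biUnion B), restr f (B l)⟩) ?_ ?_ ?_ ?_ ?_
  · rintro ⟨f, g⟩ hfg
    simp only [Finset.mem_sigma, Finset.mem_filter] at hfg
    rw [mem_colorings]
    intro v hv
    rw [hU, Finset.mem_union, not_or] at hv
    simp only [hv.1, if_false]
    refine mem_colorings.1 hfg.2.1 v fun h => hv.2 (Finset.mem_sdiff.2 ⟨h, fun h' => hv.1 (hDU h')⟩)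
  · intro f hf
    simp only [Finset.mem_sigma, Finset.mem_filter]
    refine ⟨restr_mem _ _, restr_mem _ _, ?_⟩
    rw [restr_restr, restr_restr, Finset.inter_eq_right.2 hDU,
      Finset.inter_eq_right.2 (show D ⊆ B l by rw [hbd]; exact Finset.inter_subset_left)]
  · rintro ⟨f, g⟩ hfg
    simp only [Finset.mem_sigma, Finset.mem_filter] at hfg
    obtain ⟨hf, hg, hfgD⟩ := hfg
    rw [← hD] at hfgD
    have e1 : restr (fun v => if v ∈ S'.biUnion B then f v else g v) (S'.biUnion B) = f := by
      ext v; by_cases h : v ∈ S'.biUnion B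
      · simp only [restr, h, if_true]
      · simp only [restr, h, if_false, mem_colorings.1 hf v h]
    have e2 : restr (fun v => if v ∈ S'.biUnion B then f v else g v) (B l) = g := by
      ext v; by_cases h : v ∈ B l
      · by_cases h' : v ∈ S'.biUnion B
        · have hvD : v ∈ D := by
            by_contra hvD
            exact Finset.disjoint_left.1 hdisj h' (Finset.mem_sdiff.2 ⟨h, hvD⟩)
          have := congrFun hfgD v
          simp only [restr, hvD, if_true] at this
          simp only [restr, h, h', if_true, this]
        · simp only [restr, h, h', if_true, if_false]
      · simp only [restr, h, if_false, mem_colorings.1 hg v h]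
    simp only [e1, e2]
  · intro f hf
    ext v
    by_cases h : v ∈ S'.biUnion B
    · simp only [restr, h, if_true]
    · by_cases h' : v ∈ B l
      · simp only [restr, h, h', if_false, if_true]
      · have : v ∉ S.biUnion B := by
          rw [hU, Finset.mem_union, not_or]
          exact ⟨h, fun h'' => h' (Finset.mem_sdiff.1 h'').1⟩
        simp only [restr, h, h', if_false, mem_colorings.1 hf v this]
  · rintro ⟨f, g⟩ hfg
    simp only [Finset.mem_sigma, Finset.mem_filter] at hfg
    obtain ⟨hf, hg, hfgD⟩ := hfg
    rw [← hD] at hfgD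
    set h := fun v => if v ∈ S'.biUnion B then f v else g v with hh
    have e1 : ∀ t ∈ S', restr h (B t) = restr f (B t) := by
      intro t ht
      ext v; by_cases hv : v ∈ B t
      · simp only [restr, hh, hv, hBU t ht hv, if_true]
      · simp only [restr, hv, if_false]
    have e2 : restr h (B l) = g := by
      ext v; by_cases hv : v ∈ B l
      · by_cases h' : v ∈ S'.biUnion B
        · have hvD : v ∈ D := by
            by_contra hvD
            exact Finset.disjoint_left.1 hdisj h' (Finset.mem_sdiff.2 ⟨hv, hvD⟩)
          have := congrFun hfgD v
          simp only [restr, hvD, if_true] at this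
          simp only [restr, hh, hv, h', if_true, this]
        · simp only [restr, hh, hv, h', if_true, if_false]
      · simp only [restr, hv, if_false, mem_colorings.1 hg v hv]
    have e3 : ∏ v ∈ S.biUnion B, a v (h v) =
        (∏ v ∈ S'.biUnion B, a v (f v)) * ∏ v ∈ B l \ D, a v (g v) := by
      rw [hU, Finset.prod_union hdisj]
      congr 1
      · exact Finset.prod_congr rfl fun v hv => by simp only [hh, hv, if_true]
      · exact Finset.prod_congr rfl fun v hv => by
          simp only [hh, Finset.disjoint_right.1 hdisj hv, if_false]
    have e4 : ∏ t ∈ S', nodeFactor T B loc S m t (restr h (B t)) =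
        ∏ t ∈ S', nodeFactor T B loc S m t (restr f (B t)) :=
      Finset.prod_congr rfl fun t ht => by rw [e1 t ht]
    rw [e3, ← Finset.mul_prod_erase S _ hl, e2, ← hS', e4]
    ring

/-- The boundary of the last node is empty, so its message has a single entry, at the zero
colouring, and this entry is the whole sum. -/
theorem totalSum_singleton {m : ι → (V → Fin 3) → A} (l : ι) :
    totalSum T B a loc {l} m = message T B a loc {l} m l 0 := by
  have hbd : boundary T B {l} l = ∅ := by
    simp [boundary]
  unfold totalSum message
  rw [hbd, Finset.singleton_biUnion, Finset.sdiff_empty]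
  rw [Finset.filter_true_of_mem fun g _ => by ext v; simp [restr]]
  refine Finset.sum_congr rfl fun f hf => ?_
  rw [Finset.prod_singleton, restr_of_mem hf]

end elimination

/-! ### Leaves of connected sets of tree nodes -/

section leaves
variable {ι : Type*} {T : SimpleGraph ι}

/-- Let `C` be closed in `X \ {l}`. If `C` contains the only neighbour of `l`, then `C` with `l`
added is closed in `X`; if `C` contains no neighbour of `l`, then `C` itself is. -/
theorem ConnectedOn.erase {X : Set ι} (h : ConnectedOn T X) {l : ι}
    (hl : ∀ u ∈ X, ∀ w ∈ X, T.Adj l u → T.Adj l w → u = w) : ConnectedOn T (X \ {l}) := by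
  intro C hC hne hcl
  by_cases hu : ∃ u ∈ C, T.Adj l u
  · obtain ⟨u, huC, hlu⟩ := hu
    have hsub : X ⊆ insert l C := by
      by_cases hlX : l ∈ X
      · refine h _ (Set.insert_subset hlX (hC.trans Set.sdiff_subset)) ⟨l, Set.mem_insert _ _⟩ ?_
        intro a ha b hb hab
        by_cases hbl : b = l
        · exact .inl hbl
        right
        rcases ha with rfl | ha
        · exact hl u (hC huC).1 b hb hlu hab ▸ huC
        · exact hcl a ha b ⟨hb, hbl⟩ hab
      · refine (h C (hC.trans Set.sdiff_subset) hne fun a ha b hb hab =>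
          hcl a ha b ⟨hb, ?_⟩ hab).trans (Set.subset_insert _ _)
        rintro rfl; exact hlX hb
    intro x hx
    exact (hsub hx.1).resolve_left hx.2
  · push Not at hu
    have := h C (hC.trans Set.sdiff_subset) hne fun a ha b hb hab => by
      refine hcl a ha b ⟨hb, ?_⟩ hab
      rintro rfl
      exact hu a ha hab.symm
    exact Set.sdiff_subset.trans this

theorem ConnectedOn.exists_adj {X : Set ι} (h : ConnectedOn T X) {l t : ι} (hl : l ∈ X) (ht : t ∈ X)
    (hne : t ≠ l) : ∃ u ∈ X, T.Adj l u := by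
  by_contra! hcon
  exact hne (h {l} (by simpa using hl) ⟨l, rfl⟩ (by
    rintro _ rfl b hb hab; exact absurd hab (hcon b hb)) ht)

theorem SimpleGraph.IsTree.exists_leaf [Finite ι] (hT : T.IsTree) {S : Set ι} (hS : ConnectedOn T S)
    (hne : S.Nonempty) : ∃ l ∈ S, ∀ u ∈ S, ∀ w ∈ S, T.Adj l u → T.Adj l w → u = w := by
  classical
  rcases S.subsingleton_or_nontrivial with h | h
  · obtain ⟨l, hl⟩ := hne
    exact ⟨l, hl, fun u hu w hw _ _ => h hu hw⟩
  · have : Nontrivial S := Set.nontrivial_coe_sort.2 h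
    have := Fintype.ofFinite S
    have : Nonempty S := hne.to_subtype
    have htree : (T.induce S).IsTree :=
      ⟨⟨induce_preconnected_iff.2 hS⟩, hT.isAcyclic.induce S⟩
    obtain ⟨l, hl⟩ := htree.exists_vert_degree_one_of_nontrivial
    refine ⟨l, l.2, fun u hu w hw hlu hlw => ?_⟩
    obtain ⟨x, hx, hux⟩ := SimpleGraph.degree_eq_one_iff_existsUnique_adj.1 hl
    have h1 := hux ⟨u, hu⟩ hlu
    have h2 := hux ⟨w, hw⟩ hlw
    exact congrArg Subtype.val (h1.trans h2.symm)

end leaves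

/-! ### Counting consistent cuts modulo two -/

section cuts
variable {V : Type*} [Fintype V] [DecidableEq V]

/-- A consistent cut: the sides of a cut of `support f` are the vertices of colours 1 and 2; the
terminals lie in the support and `v₁` lies on the first side. -/
def IsCut (G : SimpleGraph V) (R K : Finset V) (v₁ : V) (f : V → Fin 3) : Prop :=
  f ∈ colorings R ∧ (∀ v ∈ K, f v ≠ 0) ∧ f v₁ ≠ 2 ∧ ∀ u v, G.Adj u v → ¬(f u = 1 ∧ f v = 2)

def colorSupport (f : V → Fin 3) : Finset V := {v | f v ≠ 0}

open Classical in
noncomputable def cuts (G : SimpleGraph V) (R K : Finset V) (v₁ : V) : Finset (V → Fin 3) :=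
  {f | IsCut G R K v₁ f}

variable {G : SimpleGraph V} {R K : Finset V} {v₁ : V}

theorem mem_cuts {f : V → Fin 3} : f ∈ cuts G R K v₁ ↔ IsCut G R K v₁ f := by simp [cuts]

theorem mem_colorSupport {f : V → Fin 3} {v : V} : v ∈ colorSupport f ↔ f v ≠ 0 := by
  simp [colorSupport]

/-- The first side contains `v₁` and is closed under adjacency within the connected set `X`, so it
is all of `X` and the second side is empty. -/
theorem card_cuts_of_connected {X : Finset V} (hv₁ : v₁ ∈ K) (hK : K ⊆ X) (hX : X ⊆ R)
    (hc : ConnectedOn G (X : Set V)) : ((cuts G R K v₁).filter fun f => colorSupport f = X).card = 1 := by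
  rw [Finset.card_eq_one]
  refine ⟨fun v => if v ∈ X then 1 else 0, ?_⟩
  ext f
  simp only [Finset.mem_filter, mem_cuts, Finset.mem_singleton]
  constructor
  · rintro ⟨⟨h1, h2, h3, h4⟩, rfl⟩
    have hv : f v₁ = 1 := by have := h2 v₁ hv₁; omega
    have := hc {v | f v = 1} (fun v hv => by
      have hv : f v = 1 := hv
      simp [mem_colorSupport, hv]) ⟨v₁, hv⟩ (fun a ha b hb hab => by
        have := h4 a b hab
        have hb' := mem_colorSupport.1 (Finset.mem_coe.1 hb)
        have ha : f a = 1 := ha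
        show f b = 1
        omega)
    funext v
    by_cases h : v ∈ colorSupport f
    · rw [if_pos h]; exact this h
    · rw [if_neg h]; simpa [mem_colorSupport] using h
  · rintro rfl
    refine ⟨⟨mem_colorings.2 fun v hv => if_neg fun h => hv (hX h), fun v hv => ?_, ?_, ?_⟩, ?_⟩
    · simp [hK hv]
    · simp [hK hv₁]
    · rintro u v - ⟨-, h⟩
      by_cases hv : v ∈ X <;> simp [hv] at h
    · ext v; simp [mem_colorSupport]

/-- If `X` misses a terminal or leaves `R`, there is no cut at all. If `X` is disconnected, some
nonempty closed part `C` of it avoids `v₁`, and exchanging the colours 1 and 2 on `C` is an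
involution of the cuts without fixed points. -/
theorem even_card_cuts {X : Finset V} (hX : ¬ (K ⊆ X ∧ X ⊆ R ∧ ConnectedOn G (X : Set V))) :
    Even ((cuts G R K v₁).filter fun f => colorSupport f = X).card := by
  by_cases hKX : K ⊆ X
  swap
  · rw [Finset.filter_false_of_mem]
    · simp
    rintro f hf rfl
    exact hKX fun v hv => mem_colorSupport.2 ((mem_cuts.1 hf).2.1 v hv)
  by_cases hXR : X ⊆ R
  swap
  · rw [Finset.filter_false_of_mem]
    · simp
    rintro f hf rfl
    refine hXR fun v hv => ?_
    by_contra h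
    exact mem_colorSupport.1 hv (mem_colorings.1 (mem_cuts.1 hf).1 v h)
  have hnc : ¬ ConnectedOn G (X : Set V) := fun h => hX ⟨hKX, hXR, h⟩
  -- A closed part that contains `v₁` is replaced by its complement in `X`, which is closed too.
  obtain ⟨C, hCX, ⟨c, hc⟩, hcl, hv₁⟩ : ∃ C ⊆ (X : Set V), C.Nonempty ∧
      (∀ a ∈ C, ∀ b ∈ (X : Set V), G.Adj a b → b ∈ C) ∧ v₁ ∉ C := by
    unfold ConnectedOn at hnc
    push Not at hnc
    obtain ⟨C, h1, h2, h3, h4⟩ := hnc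
    by_cases hv : v₁ ∈ C
    · obtain ⟨x, hx, hxC⟩ := Set.not_subset.1 h4
      refine ⟨X \ C, Set.sdiff_subset, ⟨x, hx, hxC⟩, fun a ha b hb hab => ⟨hb, fun hbC => ?_⟩,
        fun h => h.2 hv⟩
      exact ha.2 (h3 b hbC a ha.1 hab.symm)
    · exact ⟨C, h1, h2, h3, hv⟩
  classical
  obtain ⟨sw, swz, sws, swn, sweq1, sweq2⟩ : ∃ sw : Fin 3 → Fin 3, (∀ x, sw x = 0 ↔ x = 0) ∧
      (∀ x, sw (sw x) = x) ∧ (∀ x, x ≠ 0 → sw x ≠ x) ∧ (∀ x, sw x = 1 ↔ x = 2) ∧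
      (∀ x, sw x = 2 ↔ x = 1) :=
    ⟨fun x => if x = 1 then 2 else if x = 2 then 1 else 0, by decide⟩
  set g : (V → Fin 3) → (V → Fin 3) := fun f v => if v ∈ C then sw (f v) else f v with hg
  have gz : ∀ f v, g f v = 0 ↔ f v = 0 := by
    intro f v; simp only [hg]; split_ifs
    · exact swz _
    · rfl
  have hzero : ∑ f ∈ (cuts G R K v₁).filter fun f => colorSupport f = X, (1 : ZMod 2) = 0 := by
    refine Finset.sum_involution (fun f _ => g f) (fun _ _ => by decide) ?_ ?_ ?_
    · intro f hf _ h
      obtain ⟨hf, rfl⟩ := Finset.mem_filter.1 hf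
      have := congrFun h c
      simp only [hg, hc, if_true] at this
      exact swn _ (mem_colorSupport.1 (hCX hc)) this
    · intro f hf
      obtain ⟨hf', rfl⟩ := Finset.mem_filter.1 hf
      obtain ⟨h1, h2, h3, h4⟩ := mem_cuts.1 hf'
      refine Finset.mem_filter.2 ⟨mem_cuts.2 ⟨?_, ?_, ?_, ?_⟩, ?_⟩
      · exact mem_colorings.2 fun v hv => (gz f v).2 (mem_colorings.1 h1 v hv)
      · exact fun v hv => fun h => h2 v hv ((gz f v).1 h)
      · simpa only [hg, hv₁, if_false] using h3
      · rintro u v huv ⟨hu, hv⟩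
        have hus : u ∈ colorSupport f := mem_colorSupport.2 fun h => by
          rw [(gz f u).2 h] at hu; exact absurd hu (by decide)
        have hvs : v ∈ colorSupport f := mem_colorSupport.2 fun h => by
          rw [(gz f v).2 h] at hv; exact absurd hv (by decide)
        by_cases huC : u ∈ C
        · have hvC := hcl u huC v hvs huv
          simp only [hg, huC, hvC, if_true, sweq1, sweq2] at hu hv
          exact h4 v u huv.symm ⟨hv, hu⟩
        · have hvC : v ∉ C := fun h => huC (hcl v h u hus huv.symm)
          simp only [hg, huC, hvC, if_false] at hu hv
          exact h4 u v huv ⟨hu, hv⟩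
      · ext v; rw [mem_colorSupport, mem_colorSupport, Ne, gz]
    · intro f hf
      funext v
      by_cases h : v ∈ C <;> simp [hg, h, sws]
  simpa [ZMod.natCast_eq_zero_iff_even] using hzero

/-- The number of consistent cuts by the weight of the support. -/
noncomputable def cutNumber (G : SimpleGraph V) (R K : Finset V) (v₁ : V) (e : V → ℕ) (i : ℕ) : ℕ :=
  ((cuts G R K v₁).filter fun f => ∑ v ∈ colorSupport f, e v = i).card

theorem cutNumber_eq (e : V → ℕ) (i : ℕ) : cutNumber G R K v₁ e i =
    ∑ X : Finset V with ∑ v ∈ X, e v = i, ((cuts G R K v₁).filter fun f => colorSupport f = X).card := by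
  rw [cutNumber, Finset.card_eq_sum_card_fiberwise (f := colorSupport)
    (t := Finset.univ.filter fun X : Finset V => ∑ v ∈ X, e v = i)]
  · refine Finset.sum_congr rfl fun X hX => ?_
    rw [Finset.filter_filter]
    congr 1
    ext f
    simp only [Finset.mem_filter, Finset.mem_univ, true_and] at hX ⊢
    constructor
    · rintro ⟨h1, -, h2⟩; exact ⟨h1, h2⟩
    · rintro ⟨h1, rfl⟩; exact ⟨h1, hX, rfl⟩
  · intro f hf
    simpa using (Finset.mem_filter.1 hf).2

theorem exists_of_odd_cutNumber {e : V → ℕ} {i : ℕ} (h : Odd (cutNumber G R K v₁ e i)) :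
    ∃ X : Finset V, K ⊆ X ∧ X ⊆ R ∧ ConnectedOn G (X : Set V) ∧ ∑ v ∈ X, e v = i := by
  by_contra! hcon
  rw [cutNumber_eq] at h
  refine Nat.not_even_iff_odd.2 h (Finset.even_sum _ fun X hX => ?_)
  exact even_card_cuts fun ⟨h1, h2, h3⟩ => hcon X h1 h2 h3 (Finset.mem_filter.1 hX).2

/-- Among the sets of this weight, `X` contributes one cut; every other one is no solution and
contributes an even number. -/
theorem odd_cutNumber {e : V → ℕ} {X : Finset V} (hv₁ : v₁ ∈ K) (hK : K ⊆ X) (hX : X ⊆ R)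
    (hc : ConnectedOn G (X : Set V)) (huniq : ∀ Y : Finset V, K ⊆ Y → Y ⊆ R →
      ConnectedOn G (Y : Set V) → ∑ v ∈ Y, e v = ∑ v ∈ X, e v → Y = X) :
    Odd (cutNumber G R K v₁ e (∑ v ∈ X, e v)) := by
  rw [cutNumber_eq, ← Finset.add_sum_erase _ _ (a := X) (by simp),
    card_cuts_of_connected hv₁ hK hX hc]
  refine Odd.add_even odd_one (Finset.even_sum _ fun Y hY => even_card_cuts fun ⟨h1, h2, h3⟩ => ?_)
  obtain ⟨hne, hY⟩ := Finset.mem_erase.1 hY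
  exact hne (huniq Y h1 h2 h3 (Finset.mem_filter.1 hY).2)

theorem card_cuts_lt (hV : 0 < Fintype.card V) : (cuts G R K v₁).card < 4 ^ Fintype.card V := by
  refine (Finset.card_le_univ _).trans_lt ?_
  simp only [Fintype.card_pi, Fintype.card_fin, Finset.prod_const, Finset.card_univ]
  exact Nat.pow_lt_pow_left (by norm_num) hV.ne'

end cuts

/-! ### Reading off the coefficients of a sum of powers -/

theorem sum_pow_lt {α : Type*} (s : Finset α) (E : α → ℕ) {b P : ℕ} (hb : s.card < b)
    (hP : ∀ x ∈ s, E x < P) : ∑ x ∈ s, b ^ E x < b ^ P := by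
  rcases s.eq_empty_or_nonempty with rfl | ⟨x₀, hx₀⟩
  · simpa using Nat.pow_pos hb
  · obtain ⟨Q, rfl⟩ : ∃ Q, P = Q + 1 := ⟨P - 1, by have := hP x₀ hx₀; omega⟩
    calc ∑ x ∈ s, b ^ E x ≤ s.card * b ^ Q := by
          simpa using Finset.sum_le_card_nsmul s (fun x => b ^ E x) (b ^ Q) fun x hx =>
            Nat.pow_le_pow_right (by omega) (by have := hP x hx; omega)
      _ < b * b ^ Q := Nat.mul_lt_mul_of_pos_right hb (Nat.pow_pos (by omega))
      _ = b ^ (Q + 1) := by ring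

/-- With fewer than `b` summands there are no carries from below: the terms with exponent less than
`i` sum to less than `b ^ i`. Those with a larger exponent are multiples of `b ^ (i + 1)` and do not
affect the parity, because `b` is even. -/
theorem sum_pow_digit {α : Type*} (s : Finset α) (E : α → ℕ) {b : ℕ} (hb : s.card < b)
    (h2 : 2 ∣ b) (i : ℕ) : (∑ x ∈ s, b ^ E x) / b ^ i % 2 = (s.filter fun x => E x = i).card % 2 := by
  have h1 : ∑ x ∈ s with E x < i, b ^ E x < b ^ i :=
    sum_pow_lt _ E ((Finset.card_filter_le _ _).trans_lt hb) fun x hx => (Finset.mem_filter.1 hx).2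
  have h3 : ∑ x ∈ s with E x = i, b ^ E x = (s.filter fun x => E x = i).card * b ^ i := by
    rw [← smul_eq_mul, ← Finset.sum_const]
    exact Finset.sum_congr rfl fun x hx => by rw [(Finset.mem_filter.1 hx).2]
  obtain ⟨c, h4⟩ : b ^ (i + 1) ∣ ∑ x ∈ s with i < E x, b ^ E x :=
    Finset.dvd_sum fun x hx => pow_dvd_pow b (Finset.mem_filter.1 hx).2
  have h5 : ∑ x ∈ s, b ^ E x = ∑ x ∈ s with E x < i, b ^ E x +
      b ^ i * ((s.filter fun x => E x = i).card + b * c) := by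
    rw [mul_add, mul_comm (b ^ i), ← h3, ← mul_assoc, ← pow_succ, ← h4,
      ← Finset.sum_filter_add_sum_filter_not s (fun x => E x < i), add_right_inj,
      ← Finset.sum_filter_add_sum_filter_not (s.filter fun x => ¬ E x < i) (fun x => E x = i),
      Finset.filter_filter, Finset.filter_filter]
    congr 1 <;> refine Finset.sum_congr (Finset.filter_congr fun x _ => by omega) fun _ _ => rfl
  rw [h5, Nat.add_mul_div_left _ _ (Nat.pow_pos (by omega)), Nat.div_eq_of_lt h1, zero_add]
  obtain ⟨d, rfl⟩ := h2
  rw [mul_assoc, Nat.add_mul_mod_self_left]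

/-! ### The isolation lemma -/

/-- The weight of `v`: block `v` of the coins, read as a binary number with `⌈log₂ (2 n)⌉` digits. -/
def coinWeight (n : ℕ) (ω : ℕ → Bool) (v : ℕ) : ℕ :=
  ∑ i ∈ Finset.range (2 * n), if 2 ^ i < 2 * n then 2 ^ i * (ω (2 * n * v + i)).toNat else 0

/-- The definition has the test `2 ^ i < 2 * n` because the program performs it; the test selects
exactly the first `⌈log₂ (2 n)⌉` digits. -/
theorem coinWeight_eq (n : ℕ) (ω : ℕ → Bool) (v : ℕ) : coinWeight n ω v =
    ∑ i ∈ Finset.range (Nat.clog 2 (2 * n)), 2 ^ i * (ω (2 * n * v + i)).toNat := by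
  rw [coinWeight, ← Finset.sum_filter]
  refine Finset.sum_congr ?_ fun _ _ => rfl
  ext i
  simp only [Finset.mem_filter, Finset.mem_range, Nat.lt_clog_iff_pow_lt one_lt_two]
  exact ⟨fun h => h.2, fun h => ⟨Nat.lt_two_pow_self.trans h, h⟩⟩

theorem coinWeight_le (n : ℕ) (ω : ℕ → Bool) (v : ℕ) : coinWeight n ω v ≤ 2 * n * (2 * n) := by
  have := Finset.sum_le_card_nsmul (Finset.range (2 * n))
    (fun i => if 2 ^ i < 2 * n then 2 ^ i * (ω (2 * n * v + i)).toNat else 0) (2 * n) (by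
      intro i _
      split_ifs with h
      · have := Bool.toNat_le (ω (2 * n * v + i)); nlinarith
      · omega)
  simpa [coinWeight] using this

theorem binary_injective {j : ℕ} {x y : ℕ → Bool}
    (h : ∑ i ∈ Finset.range j, 2 ^ i * (x i).toNat = ∑ i ∈ Finset.range j, 2 ^ i * (y i).toNat) :
    ∀ i < j, x i = y i := by
  induction j generalizing x y with
  | zero => intro i hi; omega
  | succ j ih =>
    have key : ∀ z : ℕ → Bool, ∑ i ∈ Finset.range (j + 1), 2 ^ i * (z i).toNat =
        2 * (∑ i ∈ Finset.range j, 2 ^ i * (z (i + 1)).toNat) + (z 0).toNat := by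
      intro z
      rw [Finset.sum_range_succ', Finset.mul_sum]
      simp only [pow_zero, one_mul, pow_succ]
      congr 1
      exact Finset.sum_congr rfl fun _ _ => by ring
    rw [key, key] at h
    have hx := Bool.toNat_le (x 0)
    have hy := Bool.toNat_le (y 0)
    intro i hi
    cases i with
    | zero =>
      have : (x 0).toNat = (y 0).toNat := by omega
      revert this; cases x 0 <;> cases y 0 <;> simp
    | succ i =>
      exact ih (x := fun i => x (i + 1)) (y := fun i => y (i + 1)) (by omega) i (by omega)

/-- Union bound over the cylinders given by the patterns in `s`, each of measure `2⁻¹ ^ N`. -/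
theorem fairCoins_le {N : ℕ} (s : Finset (Fin N → Bool)) :
    RAM.fairCoins {ω | (fun i : Fin N => ω i) ∈ s} ≤ s.card * (2⁻¹ : ENNReal) ^ N := by
  have hsub : {ω : ℕ → Bool | (fun i : Fin N => ω i) ∈ s} ⊆
      ⋃ x ∈ s, Set.pi (Finset.range N : Set ℕ) fun i => {if h : i < N then x ⟨i, h⟩ else false} := by
    intro ω hω
    simp only [Set.mem_iUnion]
    refine ⟨_, hω, fun i hi => ?_⟩
    have : i < N := by simpa using hi
    simp [this]
  refine (MeasureTheory.measure_mono hsub).trans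
    ((MeasureTheory.measure_biUnion_finset_le _ _).trans ?_)
  have : ∀ x ∈ s, RAM.fairCoins (Set.pi (Finset.range N : Set ℕ) fun i =>
      {if h : i < N then x ⟨i, h⟩ else false}) = (2⁻¹ : ENNReal) ^ N := by
    intro x _
    rw [RAM.fairCoins, MeasureTheory.Measure.infinitePi_pi _ (fun i _ => MeasurableSet.of_discrete)]
    rw [Finset.prod_congr rfl fun i _ => PMF.toMeasure_apply_singleton _ _ (MeasurableSet.of_discrete)]
    simp
  rw [Finset.sum_congr rfl this]
  simp

section isolation
variable {n : ℕ}

/-- Extension of finitely many coins. -/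
def extendCoins {N : ℕ} (x : Fin N → Bool) (i : ℕ) : Bool := if h : i < N then x ⟨i, h⟩ else false

/-- The coins of block `v` are replaced by `y`. -/
def replaceBlock (v : Fin n) (x : Fin (2 * n * n) → Bool) (y : Fin (Nat.clog 2 (2 * n)) → Bool)
    (k : Fin (2 * n * n)) : Bool :=
  if h : 2 * n * v ≤ k ∧ (k : ℕ) < 2 * n * v + Nat.clog 2 (2 * n) then y ⟨k - 2 * n * v, by omega⟩ else x k

theorem clog_le (n : ℕ) : Nat.clog 2 (2 * n) ≤ 2 * n := by
  by_contra h
  have := Nat.pow_lt_of_lt_clog (not_le.1 h)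
  exact absurd (Nat.lt_two_pow_self (n := 2 * n)) (by omega)

theorem block_lt {v : ℕ} (hv : v < n) {i : ℕ} (hi : i < Nat.clog 2 (2 * n)) :
    2 * n * v + i < 2 * n * n := by
  have h1 := clog_le n
  have h2 : 2 * n * (v + 1) ≤ 2 * n * n := Nat.mul_le_mul_left _ hv
  rw [mul_add] at h2
  omega

theorem block_disjoint {v u : ℕ} (huv : u ≠ v) {i : ℕ} (hi : i < Nat.clog 2 (2 * n)) :
    ¬(2 * n * v ≤ 2 * n * u + i ∧ 2 * n * u + i < 2 * n * v + Nat.clog 2 (2 * n)) := by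
  have h1 := clog_le n
  rintro ⟨h2, h3⟩
  rcases Nat.lt_or_gt_of_ne huv with h | h
  · have := Nat.mul_le_mul_left (2 * n) (Nat.succ_le_of_lt h)
    rw [Nat.succ_eq_add_one, mul_add] at this
    omega
  · have := Nat.mul_le_mul_left (2 * n) (Nat.succ_le_of_lt h)
    rw [Nat.succ_eq_add_one, mul_add] at this
    omega

/-- Both the sets with `v` and the sets without `v` attain the minimum. -/
def Ambiguous (F : Set (Finset (Fin n))) (w : ℕ → ℕ) (v : Fin n) : Prop :=
  ∃ X ∈ F, ∃ Y ∈ F, v ∈ X ∧ v ∉ Y ∧ (∀ Z ∈ F, ∑ u ∈ X, w u ≤ ∑ u ∈ Z, w u) ∧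
    ∀ Z ∈ F, ∑ u ∈ Y, w u ≤ ∑ u ∈ Z, w u

/-- When the other weights are fixed, the minimum over the sets with `v` is `w v` plus a constant,
and the minimum over the sets without `v` is a constant. Ambiguity makes them equal and so
determines `w v`. -/
theorem Ambiguous.eq {F : Set (Finset (Fin n))} {w w' : ℕ → ℕ} {v : Fin n} (h : Ambiguous F w v)
    (h' : Ambiguous F w' v) (hw : ∀ u : Fin n, u ≠ v → w u = w' u) : w v = w' v := by
  obtain ⟨X, hX, Y, hY, hvX, hvY, hXm, hYm⟩ := h
  obtain ⟨X', hX', Y', hY', hvX', hvY', hXm', hYm'⟩ := h'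
  have e0 : ∀ Z : Finset (Fin n), v ∉ Z → ∑ u ∈ Z, w u = ∑ u ∈ Z, w' u := fun Z hZ =>
    Finset.sum_congr rfl fun u hu => hw u fun h => hZ (h ▸ hu)
  have e1 : ∀ Z : Finset (Fin n), v ∈ Z → ∑ u ∈ Z, w u + w' v = ∑ u ∈ Z, w' u + w v := by
    intro Z hZ
    rw [← Finset.add_sum_erase _ _ hZ, ← Finset.add_sum_erase _ _ hZ, e0 _ (Finset.notMem_erase v Z)]
    ring
  have a1 := hYm Y' hY'
  have a2 := hYm' Y hY
  have a3 := hXm X' hX'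
  have a4 := hXm' X hX
  have a5 := hXm Y hY
  have a6 := hYm X hX
  have a7 := hXm' Y' hY'
  have a8 := hYm' X' hX'
  have b1 := e0 Y hvY
  have b2 := e0 Y' hvY'
  have b3 := e1 X hvX
  have b4 := e1 X' hvX'
  omega

open Classical in
-- Overwriting the digits of `v` in an ambiguous sequence by arbitrary ones loses no information:
-- the other coins are still there, they determine the weight of `v` by `Ambiguous.eq`, and the
-- weight determines its binary digits. So at most one sequence in `2 ^ ⌈log₂ (2 n)⌉` is ambiguous
-- for `v`.
theorem card_ambiguous (F : Set (Finset (Fin n))) (v : Fin n) :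
    (Finset.univ.filter fun x : Fin (2 * n * n) → Bool =>
      Ambiguous F (coinWeight n (extendCoins x)) v).card * 2 ^ Nat.clog 2 (2 * n) ≤
      2 ^ (2 * n * n) := by
  set bad := Finset.univ.filter fun x : Fin (2 * n * n) → Bool =>
      Ambiguous F (coinWeight n (extendCoins x)) v with hbad
  have hcard : (bad ×ˢ (Finset.univ : Finset (Fin (Nat.clog 2 (2 * n)) → Bool))).card ≤
      (Finset.univ : Finset (Fin (2 * n * n) → Bool)).card := by
    refine Finset.card_le_card_of_injOn (fun p => replaceBlock v p.1 p.2) (fun _ _ => by simp) ?_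
    rintro ⟨x, y⟩ hxy ⟨x', y'⟩ hxy' heq
    have hx := (Finset.mem_filter.1 (Finset.mem_product.1 hxy).1).2
    have hx' := (Finset.mem_filter.1 (Finset.mem_product.1 hxy').1).2
    have hoff : ∀ k : Fin (2 * n * n), ¬(2 * n * v ≤ (k : ℕ) ∧ (k : ℕ) < 2 * n * v + Nat.clog 2 (2 * n)) →
        x k = x' k := by
      intro k hk
      have := congrFun heq k
      simpa only [replaceBlock, dif_neg hk] using this
    have hw := hx.eq hx' (fun u hu => by
      rw [coinWeight_eq, coinWeight_eq]
      refine Finset.sum_congr rfl fun i hi => ?_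
      have hi := Finset.mem_range.1 hi
      have hlt := block_lt u.2 hi
      simp only [extendCoins, hlt, dif_pos]
      rw [hoff ⟨_, hlt⟩ (block_disjoint (fun h => hu (Fin.ext h)) hi)])
    rw [coinWeight_eq, coinWeight_eq] at hw
    have hin := binary_injective (x := fun i => extendCoins x (2 * n * v + i))
      (y := fun i => extendCoins x' (2 * n * v + i)) hw
    have hxx : x = x' := by
      funext k
      by_cases hk : 2 * n * v ≤ (k : ℕ) ∧ (k : ℕ) < 2 * n * v + Nat.clog 2 (2 * n)
      · have := hin (k - 2 * n * v) (by omega)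
        have e : 2 * n * (v : ℕ) + (k - 2 * n * v) = k := by omega
        simpa [extendCoins, e] using this
      · exact hoff k hk
    have hyy : y = y' := by
      funext i
      have hlt := block_lt v.2 i.2
      have := congrFun heq ⟨_, hlt⟩
      simpa [replaceBlock] using this
    rw [hxx, hyy]
  simpa [Finset.card_product] using hcard

/-- With probability at least one half, the random weights have a unique minimum over `F`. -/
theorem isolation (hn : 0 < n) {F : Set (Finset (Fin n))} (hF : F.Nonempty) :
    RAM.fairCoins {ω | ¬∃ X ∈ F, ∀ Y ∈ F,
      ∑ v ∈ Y, coinWeight n ω v ≤ ∑ v ∈ X, coinWeight n ω v → Y = X} ≤ 1 / 2 := by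
  classical
  set bad : Finset (Fin (2 * n * n) → Bool) := Finset.univ.biUnion fun v : Fin n =>
    Finset.univ.filter fun x => Ambiguous F (coinWeight n (extendCoins x)) v with hbad
  have hext : ∀ (ω : ℕ → Bool) (v : Fin n),
      coinWeight n (extendCoins fun i : Fin (2 * n * n) => ω i) v = coinWeight n ω v := by
    intro ω v
    rw [coinWeight_eq, coinWeight_eq]
    refine Finset.sum_congr rfl fun i hi => ?_
    simp [extendCoins, block_lt v.2 (Finset.mem_range.1 hi)]
  have hsub : {ω | ¬∃ X ∈ F, ∀ Y ∈ F, ∑ v ∈ Y, coinWeight n ω v ≤ ∑ v ∈ X, coinWeight n ω v → Y = X} ⊆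
      {ω | (fun i : Fin (2 * n * n) => ω i) ∈ bad} := by
    intro ω hω
    -- If the minimum is attained twice, any vertex in which two minimisers differ is ambiguous.
    obtain ⟨X, hX, hmin⟩ := (Set.toFinite F).exists_minimalFor
      (fun X : Finset (Fin n) => ∑ v ∈ X, coinWeight n ω v) F hF
    have hXm : ∀ Z ∈ F, ∑ v ∈ X, coinWeight n ω v ≤ ∑ v ∈ Z, coinWeight n ω v := by
      intro Z hZ
      by_contra hlt
      exact hlt (hmin hZ (not_le.1 hlt).le)
    simp only [Set.mem_ofPred_eq] at hω
    push Not at hω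
    obtain ⟨Y, hY, hYX, hne⟩ := hω X hX
    have hYm : ∀ Z ∈ F, ∑ v ∈ Y, coinWeight n ω v ≤ ∑ v ∈ Z, coinWeight n ω v :=
      fun Z hZ => hYX.trans (hXm Z hZ)
    have hamb : ∀ v, Ambiguous F (coinWeight n ω) v → (fun i : Fin (2 * n * n) => ω i) ∈ bad := by
      intro v hv
      refine Finset.mem_biUnion.2 ⟨v, Finset.mem_univ _, Finset.mem_filter.2 ⟨Finset.mem_univ _, ?_⟩⟩
      simpa only [Ambiguous, hext] using hv
    by_cases h : X ⊆ Y
    · have : ¬ Y ⊆ X := fun h' => hne (h'.antisymm h)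
      obtain ⟨v, hv, hv'⟩ := Finset.not_subset.1 this
      exact hamb v ⟨Y, hY, X, hX, hv, hv', hYm, hXm⟩
    · obtain ⟨v, hv, hv'⟩ := Finset.not_subset.1 h
      exact hamb v ⟨X, hX, Y, hY, hv, hv', hXm, hYm⟩
  refine (MeasureTheory.measure_mono hsub).trans ((fairCoins_le bad).trans ?_)
  -- Union bound: each of the `n` vertices is ambiguous for at most a fraction `1 / (2 n)` of the
  -- sequences.
  have hcount : bad.card * 2 ≤ 2 ^ (2 * n * n) := by
    have h1 : bad.card * 2 ^ Nat.clog 2 (2 * n) ≤ n * 2 ^ (2 * n * n) := by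
      calc bad.card * 2 ^ Nat.clog 2 (2 * n)
          ≤ (∑ v : Fin n, (Finset.univ.filter fun x : Fin (2 * n * n) → Bool =>
              Ambiguous F (coinWeight n (extendCoins x)) v).card) * 2 ^ Nat.clog 2 (2 * n) :=
            Nat.mul_le_mul_right _ Finset.card_biUnion_le
        _ ≤ ∑ _v : Fin n, 2 ^ (2 * n * n) := by
            rw [Finset.sum_mul]
            exact Finset.sum_le_sum fun v _ => card_ambiguous F v
        _ = n * 2 ^ (2 * n * n) := by simp
    have h2 : 2 * n ≤ 2 ^ Nat.clog 2 (2 * n) := Nat.le_pow_clog one_lt_two _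
    have h3 : n * (bad.card * 2) ≤ n * 2 ^ (2 * n * n) := by
      calc n * (bad.card * 2) = bad.card * (2 * n) := by ring
        _ ≤ bad.card * 2 ^ Nat.clog 2 (2 * n) := Nat.mul_le_mul_left _ h2
        _ ≤ _ := h1
    exact Nat.le_of_mul_le_mul_left h3 hn
  have h4 : (bad.card : ENNReal) * 2 ≤ 2 ^ (2 * n * n) := by exact_mod_cast hcount
  have h5 : ∀ x y : ENNReal, x * 2 ≤ y → x ≤ 2⁻¹ * y := fun x y h => by
    calc x = 2⁻¹ * (x * 2) := by
          rw [mul_comm x, ← mul_assoc, ENNReal.inv_mul_cancel (by norm_num) (by norm_num), one_mul]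
      _ ≤ _ := by gcongr
  rw [← ENNReal.inv_pow, ← div_eq_mul_inv, ENNReal.div_le_iff (by positivity) (by finiteness), one_div]
  exact h5 _ _ h4

end isolation

/-! ### The expressions of the program -/

theorem propBit_and (p q : Prop) : propBit p * propBit q = propBit (p ∧ q) := by
  by_cases hp : p <;> by_cases hq : q <;> simp [propBit, hp, hq]

theorem propBit_not (p : Prop) : 1 - propBit p = propBit ¬p := by
  by_cases hp : p <;> simp [propBit, hp]

theorem propBit_ne_zero {p : Prop} : propBit p ≠ 0 ↔ p := by
  by_cases hp : p <;> simp [propBit, hp]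

theorem propBit_eq_one {p : Prop} : propBit p = 1 ↔ p := by
  by_cases hp : p <;> simp [propBit, hp]

theorem propBit_of_true {p : Prop} (h : p) : propBit p = 1 := propBit_eq_one.2 h

theorem propBit_of_false {p : Prop} (h : ¬p) : propBit p = 0 := by simp [propBit, h]

theorem propBit_ite (p : Prop) [Decidable p] : (if p then 1 else 0) = propBit p := by
  by_cases hp : p <;> simp [propBit, hp]

namespace RAM
namespace Ex

instance : Add Ex := ⟨.op .add⟩
instance : Mul Ex := ⟨.op .mul⟩
instance (k : ℕ) : OfNat Ex k := ⟨.const k⟩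

def and (a b : Ex) : Ex := a * b
def not (a : Ex) : Ex := .op .sub 1 a
def lt (a b : Ex) : Ex := .op .lt a b
def eq (a b : Ex) : Ex := .op .eq a b
def ex (r : ℕ) (N e : Ex) : Ex := .lt 0 (.sum r N e)
def pow (b N : Ex) : Ex := .prod 45 N b

variable {μ : ℕ → ℕ → ℕ} {ρ : ℕ → ℕ}

@[simp] theorem eval_add (a b : Ex) : (a + b).eval μ ρ = a.eval μ ρ + b.eval μ ρ := rfl
@[simp] theorem eval_mul (a b : Ex) : (a * b).eval μ ρ = a.eval μ ρ * b.eval μ ρ := rfl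
@[simp] theorem eval_ofNat (k : ℕ) : (OfNat.ofNat k : Ex).eval μ ρ = k := rfl
@[simp] theorem eval_zero : (0 : Ex).eval μ ρ = 0 := rfl
@[simp] theorem eval_one : (1 : Ex).eval μ ρ = 1 := rfl
@[simp] theorem eval_two : (2 : Ex).eval μ ρ = 2 := rfl
@[simp] theorem eval_three : (3 : Ex).eval μ ρ = 3 := rfl
theorem eval_var_eq {r x : ℕ} (h : ρ r = x) : (Ex.var r).eval μ ρ = x := h
@[simp] theorem eval_var (r : ℕ) : (Ex.var r).eval μ ρ = ρ r := rfl
@[simp] theorem eval_read (a : ℕ) (e : Ex) : (Ex.read a e).eval μ ρ = μ a (e.eval μ ρ) := rfl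

theorem eval_and {a b : Ex} {p q : Prop} (ha : a.eval μ ρ = propBit p) (hb : b.eval μ ρ = propBit q) :
    (a.and b).eval μ ρ = propBit (p ∧ q) := by
  rw [← propBit_and, ← ha, ← hb]; rfl

theorem eval_not {a : Ex} {p : Prop} (ha : a.eval μ ρ = propBit p) :
    a.not.eval μ ρ = propBit ¬p := by
  rw [← propBit_not, ← ha]; rfl

theorem eval_lt {a b : Ex} {x y : ℕ} (ha : a.eval μ ρ = x) (hb : b.eval μ ρ = y) :
    (a.lt b).eval μ ρ = propBit (x < y) := by
  rw [← propBit_ite, ← ha, ← hb]; rfl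

theorem eval_eq {a b : Ex} {x y : ℕ} (ha : a.eval μ ρ = x) (hb : b.eval μ ρ = y) :
    (a.eq b).eval μ ρ = propBit (x = y) := by
  rw [← propBit_ite, ← ha, ← hb]; rfl

theorem eval_cond {a b c : Ex} {p : Prop} [Decidable p] {x y : ℕ} (ha : a.eval μ ρ = propBit p)
    (hb : p → b.eval μ ρ = x) (hc : ¬p → c.eval μ ρ = y) :
    (Ex.cond a b c).eval μ ρ = if p then x else y := by
  by_cases hp : p
  · rw [if_pos hp, ← hb hp]; simp [Ex.eval, ha, propBit_of_true hp]
  · rw [if_neg hp, ← hc hp]; simp [Ex.eval, ha, propBit_of_false hp]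

theorem eval_sum {r k : ℕ} {N e : Ex} {f : Fin k → ℕ} (hN : N.eval μ ρ = k)
    (he : ∀ i : Fin k, e.eval μ (Function.update ρ r i) = f i) :
    (Ex.sum r N e).eval μ ρ = ∑ i, f i := by
  simp only [Ex.eval, hN, Finset.sum_range, he]

theorem eval_prod {r k : ℕ} {N e : Ex} {f : Fin k → ℕ} (hN : N.eval μ ρ = k)
    (he : ∀ i : Fin k, e.eval μ (Function.update ρ r i) = f i) :
    (Ex.prod r N e).eval μ ρ = ∏ i, f i := by
  simp only [Ex.eval, hN, Finset.prod_range, he]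

theorem eval_ex {r k : ℕ} {N e : Ex} {p : Fin k → Prop} (hN : N.eval μ ρ = k)
    (he : ∀ i : Fin k, e.eval μ (Function.update ρ r i) = propBit (p i)) :
    (Ex.ex r N e).eval μ ρ = propBit (∃ i, p i) := by
  rw [Ex.ex, eval_lt (eval_ofNat 0) (eval_sum hN he)]
  congr 1
  simp only [Finset.sum_pos_iff, Finset.mem_univ, true_and, Nat.pos_iff_ne_zero, propBit_ne_zero]

theorem eval_pow {b N : Ex} {x k : ℕ} (hb : ∀ i, b.eval μ (Function.update ρ 45 i) = x)
    (hN : N.eval μ ρ = k) : (Ex.pow b N).eval μ ρ = x ^ k := by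
  rw [Ex.pow, eval_prod hN fun i => hb i]
  simp

end Ex

open Ex

/-- Commands use the variables up to 15, expressions bind variables from 20 on. A bound variable
always has a larger number than the variables whose outer values are still needed under it; this is
what `upd_ne` exploits. -/
def nE : Ex := .var 1
def adjE (x y : ℕ) : Ex := .read 0 (1 + .var x * nE + .var y)
def termE (x : ℕ) : Ex := .read 0 (1 + nE * nE + .var x)
def costE (x : ℕ) : Ex := .read 0 (1 + nE * nE + nE + .var x)
def signPosE : Ex := 1 + nE * nE + nE + nE
def budgetE : Ex := .var 3
/-- Cost of the terminals. -/
def termCostE : Ex := .sum 23 nE (termE 23 * costE 23)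
def diamTwoE : Ex :=
  .not (.ex 20 nE (.ex 21 nE (.and (.and (.and (termE 20) (termE 21)) (.and (.not (.eq (.var 20) (.var 21)))
    (.not (adjE 20 21)))) (.not (.ex 22 nE (.and (termE 22) (.and (adjE 20 22) (adjE 21 22))))))))
def starE : Ex :=
  .ex 20 nE (.and (.not (.ex 21 nE (.and (termE 21) (.not (adjE 21 20)))))
    (.not (.lt budgetE (termCostE + costE 20))))

/-- In the decomposition that starts at position `p`: `x` and `y` are in the same child module. -/
def sameE (p x y : ℕ) : Ex := .read 0 (.var p + .var x * nE + .var y)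
def sizeE (p : ℕ) : Ex := .read 0 (.var p + nE * nE)
def relevantE (p : ℕ) : Ex :=
  .and (.not (.ex 20 nE (.and (termE 20) (.not (sameE p 20 20)))))
    (.ex 20 nE (.ex 21 nE (.and (.and (termE 20) (termE 21)) (.not (sameE p 20 21)))))

def tE : Ex := .var 7
def treeE (s t : ℕ) : Ex := .read 0 (.var 4 + nE * nE + 1 + .var s * tE + .var t)
def bagE (t x : ℕ) : Ex := .read 0 (.var 4 + nE * nE + 1 + tE * tE + .var t * nE + .var x)

/-- `x` represents its child module: it is the cheapest vertex (the first one, if there are ties). -/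
def repE (x : ℕ) : Ex :=
  .and (sameE 4 x x) (.not (.ex 50 nE (.and (sameE 4 50 x)
    (.lt (costE 50 * nE + .var 50) (costE x * nE + .var x)))))
def inBagE (t x : ℕ) : Ex := .and (bagE t x) (repE x)
def hasTermE (x : ℕ) : Ex := .ex 40 nE (.and (termE 40) (sameE 4 40 x))
def partCostE (x : ℕ) : Ex :=
  .cond (hasTermE x) (.sum 41 nE (.and (termE 41) (sameE 4 41 x) * costE 41)) (costE x)
-- Reduction modulo `2 n + 1` does not change a power that is below `2 n`, but it lets `infer` see a
-- polynomially bounded number. The weights enter exponents, so they must be small.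
def coinWeightE (x : ℕ) : Ex :=
  .sum 35 (2 * nE) (.cond (.lt (.pow 2 (.var 35)) (2 * nE))
    (.op .mod (.pow 2 (.var 35)) (2 * nE + 1) * .read 1 (2 * nE * .var x + .var 35)) 0)
-- Exceeds the random weight of every vertex set, so that division of an exponent by it recovers the
-- cost.
def unitE : Ex := nE * (2 * nE * (2 * nE)) + 1
-- For `n > 0` it is even and larger than the number of colourings, as `sum_pow_digit` requires.
def baseE : Ex := .pow 4 nE
def exponentE (x : ℕ) : Ex := partCostE x * unitE + coinWeightE x
def weightE (x : ℕ) : Ex := .pow baseE (exponentE x)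
def rangeE : Ex := (nE * .sum 43 nE (costE 43) + 1) * unitE
-- Exceeds the sum to be computed, so reduction modulo it loses nothing and keeps the stored numbers
-- short. The final `+ 1` shows `opKd` that it is positive.
def modulusE : Ex := .pow baseE rangeE + 1
-- The vertex that is kept on the first side of all cuts: the first representative of a part with
-- terminals.
def firstE (x : ℕ) : Ex :=
  .and (.and (repE x) (hasTermE x))
    (.not (.ex 30 nE (.and (.lt (.var 30) (.var x)) (.and (repE 30) (hasTermE 30)))))

def aliveE (t : ℕ) : Ex := .not (.read 2 (.var t))
def leafE (t : ℕ) : Ex :=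
  .and (aliveE t) (.not (.lt 1 (.sum 31 tE (.and (aliveE 31) (treeE t 31)))))
def boundaryE (t x : ℕ) : Ex :=
  .and (inBagE t x) (.ex 32 tE (.and (aliveE 32) (.and (treeE t 32) (inBagE 32 x))))
def rankE (t x : ℕ) : Ex := .sum 33 nE (.and (inBagE t 33) (.lt (.var 33) (.var x)))
def bagSizeE (t : ℕ) : Ex := .sum 34 nE (inBagE t 34)
/-- The colour of `x` in the colouring of the bag of node 14 that has the number in variable 15. -/
def colorE (x : ℕ) : Ex :=
  .cond (inBagE 14 x) (.op .mod (.op .div (.var 15) (.pow 3 (rankE 14 x))) 3) 0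
-- A partial colouring is stored under a code that does not depend on the bag, so that a node and
-- its neighbour address the same cell. The table is sparse, but its addresses have polynomial
-- length.
def codeE : Ex := .sum 24 nE (.pow 3 (.var 24) * .cond (boundaryE 14 24) (colorE 24) 0)
-- A colouring of the bag of node 14 vanishes outside this bag, so restricting it to the bag of an
-- eliminated neighbour is restricting it to the intersection, the boundary for which the message of
-- the neighbour was computed.
def childCodeE (c : ℕ) : Ex := .sum 24 nE (.pow 3 (.var 24) * .cond (inBagE c 24) (colorE 24) 0)
def factorE (x : ℕ) : Ex :=
  .cond (.eq (colorE x) 0) (.not (hasTermE x))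
    (.cond (.eq (colorE x) 1) (weightE x) (.cond (firstE x) 0 (weightE x)))
def consistentE : Ex :=
  .not (.ex 21 nE (.ex 22 nE (.and (.and (inBagE 14 21) (inBagE 14 22)) (.and (adjE 21 22)
    (.and (.eq (colorE 21) 1) (.eq (colorE 22) 2))))))
-- The loop runs up to 3 to the size of the largest bag for every node; the first factor cancels the
-- numbers that exceed the number of colourings of the present bag.
def valueE : Ex :=
  .lt (.var 15) (.pow 3 (bagSizeE 14)) *
    (.prod 20 nE (.cond (.and (inBagE 14 20) (.not (boundaryE 14 20))) (factorE 20) 1) *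
    (consistentE *
    .prod 23 tE (.cond (.and (.not (aliveE 23)) (treeE 14 23))
      (.read 3 (childCodeE 23 * tE + .var 23)) 1)))
def addressE : Ex := codeE * tE + .var 14
def maxBagE : Ex := .sum 20 nE (.ex 21 tE (.lt (.var 20) (bagSizeE 21)))
def foundE : Ex :=
  .ex 20 rangeE (.and (.not (.lt budgetE (.op .div (.var 20) unitE)))
    (.eq (.op .mod (.op .div (.op .mod (.var 9) modulusE) (.pow baseE (.var 20))) 2) 1))
def answerE : Ex :=
  .and (.not (.var 2)) (.not (.and (.not (.and diamTwoE (.not (.lt budgetE termCostE))))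
    (.and (.not starE) (.not (.and (.var 5) foundE)))))

/-! ### The program -/

/-- The budget is the only input number without a polynomial bound. It is moved to variable 3 and
its cell is cleared, after which array 0 contains only small numbers. -/
def setupCmd : Cmd :=
  .seq (.set 1 (.read 0 0)) <| .seq (.set 2 (.read 0 signPosE)) <|
  .seq (.set 3 (.read 0 (signPosE + 1))) (.write 0 (signPosE + 1) 0)
def coinCmd : Cmd := .loop 12 (2 * nE * nE) (.seq (.flip 11) (.write 1 (.var 12) (.var 11)))
def scanBody : Cmd := .ite (relevantE 6) (.seq (.set 4 (.var 6)) (.set 5 1)) .skip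
def advanceCmd : Cmd :=
  .set 6 (.var 6 + nE * nE + 1 + sizeE 6 * sizeE 6 + sizeE 6 * nE)
def scanCmd : Cmd :=
  .seq (.set 6 (signPosE + 3)) (.loop 10 (.read 0 (signPosE + 2)) (.seq scanBody advanceCmd))
-- The only loop that is not polynomially long. Its bound is a variable because `check` measures
-- such loops by the content of a register.
def messageCmd : Cmd :=
  .loop 15 (.var 8) (.write 3 addressE (.op .mod (.read 3 addressE + valueE) modulusE))
-- Variable 9 receives the entry with code 0. It matters only for the last node, whose boundary is
-- empty.
def eliminateCmd : Cmd :=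
  .ite (leafE 14) (.seq messageCmd (.seq (.set 9 (.read 3 (.var 14))) (.write 2 (.var 14) 1))) .skip
-- The nodes that are alive induce a subtree, which has a leaf as long as it is nonempty; so each
-- pass eliminates a node, and as many passes as nodes suffice, without an elimination order being
-- computed.
def sweepCmd : Cmd := .loop 13 tE (.loop 14 tE eliminateCmd)
def prepareCmd : Cmd := .ite (.var 5) (.seq (.set 7 (sizeE 4)) (.set 8 (.pow 3 maxBagE))) .skip
def steinerCmd : Cmd :=
  .seq setupCmd <| .seq coinCmd <| .seq scanCmd <| .seq prepareCmd <| .seq sweepCmd (.set 0 answerE)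

/-- The kinds of the arrays and of the variables. -/
def arrayKd (a : ℕ) : Kd := if a = 0 then .sm 1 else if a = 3 then .bg 60 else .sm 0
-- The exponents 9 and 60 are confirmed by running `check`. The bound `S ^ 1` for the input position
-- in variable 6 is beyond the static rules and is justified in `exists_scan_runs`.
def varKd (r : ℕ) : Kd :=
  if r = 1 then .sm 1 else if r = 3 then .bg 1 else if r = 4 ∨ r = 6 ∨ r = 7 then .sm 1
  else if r = 8 ∨ r = 9 ∨ r = 15 then .bg 60
  else if r = 10 ∨ r = 12 ∨ r = 13 ∨ r = 14 then .sm 9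
  else .sm 0

end RAM

/-! ### The values of the expressions -/

namespace RAM
open Ex

variable {n : ℕ}

/-- Variable 1 and array 0 hold the graph, the terminals and the costs. -/
structure ReadsGraph (G : SimpleGraph (Fin n)) (K : Finset (Fin n)) (c : Fin n → ℕ)
    (μ : ℕ → ℕ → ℕ) (ρ : ℕ → ℕ) : Prop where
  numVertices : ρ 1 = n
  adj : ∀ u v : Fin n, μ 0 (1 + u * n + v) = propBit (G.Adj u v)
  term : ∀ u : Fin n, μ 0 (1 + n * n + u) = propBit (u ∈ K)
  cost : ∀ u : Fin n, μ 0 (1 + n * n + n + u) = c u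

/-- Variables 4 and 7 and array 0 describe a decomposition. -/
structure ReadsDecomposition {T : ℕ} (same : Fin n → Fin n → Prop) (tree : SimpleGraph (Fin T))
    (bag : Fin T → Fin n → Prop) (μ : ℕ → ℕ → ℕ) (ρ : ℕ → ℕ) : Prop where
  numNodes : ρ 7 = T
  same : ∀ u v : Fin n, μ 0 (ρ 4 + u * n + v) = propBit (same u v)
  tree : ∀ s t : Fin T, μ 0 (ρ 4 + n * n + 1 + s * T + t) = propBit (tree.Adj s t)
  bag : ∀ (t : Fin T) (u : Fin n), μ 0 (ρ 4 + n * n + 1 + T * T + t * n + u) = propBit (bag t u)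

def ReadsCoins (n : ℕ) (ω : ℕ → Bool) (μ : ℕ → ℕ → ℕ) : Prop :=
  ∀ i < 2 * n * n, μ 1 i = (ω i).toNat

/-- Array 2 marks the nodes that are not in `S`. -/
def ReadsAlive {T : ℕ} (S : Finset (Fin T)) (μ : ℕ → ℕ → ℕ) : Prop :=
  ∀ t : Fin T, μ 2 t = propBit (t ∉ S)

theorem ReadsGraph.update {G : SimpleGraph (Fin n)} {K : Finset (Fin n)} {c : Fin n → ℕ}
    {μ : ℕ → ℕ → ℕ} {ρ : ℕ → ℕ} (h : ReadsGraph G K c μ ρ) {r : ℕ} (x : ℕ) (hr : 9 ≤ r := by omega) :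
    ReadsGraph G K c μ (Function.update ρ r x) := by
  refine ⟨?_, h.adj, h.term, h.cost⟩
  rw [Function.update_of_ne (by omega), h.numVertices]

theorem ReadsDecomposition.update {T : ℕ} {same : Fin n → Fin n → Prop} {tree : SimpleGraph (Fin T)}
    {bag : Fin T → Fin n → Prop} {μ : ℕ → ℕ → ℕ} {ρ : ℕ → ℕ}
    (h : ReadsDecomposition same tree bag μ ρ) {r : ℕ} (x : ℕ) (hr : 9 ≤ r := by omega) :
    ReadsDecomposition same tree bag μ (Function.update ρ r x) := by
  have h4 : Function.update ρ r x 4 = ρ 4 := Function.update_of_ne (by omega) _ _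
  have h7 : Function.update ρ r x 7 = ρ 7 := Function.update_of_ne (by omega) _ _
  exact ⟨by rw [h7, h.numNodes], by rw [h4]; exact h.same, by rw [h4]; exact h.tree, by rw [h4]; exact h.bag⟩

theorem upd_ne {ρ : ℕ → ℕ} {r s x y : ℕ} (h : ρ s = y) (hs : s < r := by omega) :
    Function.update ρ r x s = y := by
  rw [Function.update_of_ne (by omega), h]

theorem upd_eq {ρ : ℕ → ℕ} {r x : ℕ} : Function.update ρ r x r = x := Function.update_self ..

section
variable {G : SimpleGraph (Fin n)} {K : Finset (Fin n)} {c : Fin n → ℕ} {μ : ℕ → ℕ → ℕ}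
  {ρ : ℕ → ℕ}

theorem eval_nE (h : ReadsGraph G K c μ ρ) : nE.eval μ ρ = n := h.numVertices

theorem eval_adjE (h : ReadsGraph G K c μ ρ) {x y : ℕ} {u v : Fin n} (hx : ρ x = u) (hy : ρ y = v) :
    (adjE x y).eval μ ρ = propBit (G.Adj u v) := by
  simp [adjE, eval_nE h, hx, hy, h.adj]

theorem eval_termE (h : ReadsGraph G K c μ ρ) {x : ℕ} {u : Fin n} (hx : ρ x = u) :
    (termE x).eval μ ρ = propBit (u ∈ K) := by
  simp [termE, eval_nE h, hx, h.term]

theorem eval_costE (h : ReadsGraph G K c μ ρ) {x : ℕ} {u : Fin n} (hx : ρ x = u) :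
    (costE x).eval μ ρ = c u := by
  simp [costE, eval_nE h, hx, h.cost]

theorem sum_propBit_mul {ι : Type*} [Fintype ι] (p : ι → Prop) [DecidablePred p] (f : ι → ℕ) :
    ∑ i, propBit (p i) * f i = ∑ i with p i, f i := by
  rw [Finset.sum_filter]
  refine Finset.sum_congr rfl fun i _ => ?_
  by_cases h : p i <;> simp [h, propBit]

theorem sum_propBit {ι : Type*} [Fintype ι] (p : ι → Prop) [DecidablePred p] :
    ∑ i, propBit (p i) = (Finset.univ.filter p).card := by
  have := sum_propBit_mul p fun _ => 1
  simpa using this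

theorem eval_termCostE (h : ReadsGraph G K c μ ρ) : termCostE.eval μ ρ = ∑ u ∈ K, c u := by
  rw [termCostE, eval_sum (eval_nE h) (f := fun u => propBit (u ∈ K) * c u) fun u => by
    rw [eval_mul, eval_termE (h.update _) upd_eq, eval_costE (h.update _) upd_eq],
    sum_propBit_mul]
  simp

theorem eval_diamTwoE (h : ReadsGraph G K c μ ρ) : diamTwoE.eval μ ρ =
    propBit (∀ u ∈ K, ∀ w ∈ K, u = w ∨ G.Adj u w ∨ ∃ x ∈ K, G.Adj u x ∧ G.Adj w x) := by
  rw [diamTwoE, eval_not (eval_ex (eval_nE h) fun u => eval_ex (eval_nE (h.update _)) fun w =>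
    have h2 := (h.update (r := 20) u).update (r := 21) w
    eval_and (eval_and (eval_and (eval_termE h2 (upd_ne upd_eq)) (eval_termE h2 upd_eq))
      (eval_and (eval_not (eval_eq (eval_var_eq (upd_ne upd_eq)) (eval_var_eq upd_eq))) (eval_not (eval_adjE h2 (upd_ne upd_eq) upd_eq))))
    (eval_not (eval_ex (eval_nE h2) fun x =>
      have h3 := h2.update (r := 22) x
      eval_and (eval_termE h3 upd_eq) (eval_and (eval_adjE h3 (upd_ne (upd_ne upd_eq)) upd_eq)
        (eval_adjE h3 (upd_ne upd_eq) upd_eq)))))]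
  congr 1
  simp only [Fin.val_inj]
  apply propext
  constructor
  · intro h u hu w hw
    by_contra! hcon
    exact h ⟨u, w, ⟨⟨hu, hw⟩, hcon.1, hcon.2.1⟩, fun ⟨x, hx, h1, h2⟩ => hcon.2.2 x hx h1 h2⟩
  · rintro h ⟨u, w, ⟨⟨hu, hw⟩, h1, h2⟩, h3⟩
    rcases h u hu w hw with h | h | ⟨x, hx, h⟩
    · exact h1 h
    · exact h2 h
    · exact h3 ⟨x, hx, h⟩

theorem eval_starE (h : ReadsGraph G K c μ ρ) : starE.eval μ ρ =
    propBit (∃ v, (∀ u ∈ K, G.Adj u v) ∧ ∑ u ∈ K, c u + c v ≤ ρ 3) := by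
  rw [starE, budgetE, eval_ex (eval_nE h) fun v =>
    have h1 := h.update (r := 20) v
    eval_and (eval_not (eval_ex (eval_nE h1) fun u =>
      have h2 := h1.update (r := 21) u
      eval_and (eval_termE h2 upd_eq) (eval_not (eval_adjE h2 upd_eq (upd_ne upd_eq)))))
    (eval_not (eval_lt (eval_var_eq (upd_ne rfl)) (show (termCostE + costE 20).eval μ _ = _ by
      rw [eval_add, eval_termCostE h1, eval_costE h1 upd_eq])))]
  congr 1
  simp

theorem eval_relevantE (h : ReadsGraph G K c μ ρ) {same : Fin n → Fin n → Prop} {p : ℕ} (hp : p < 20)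
    (hs : ∀ u v : Fin n, μ 0 (ρ p + u * n + v) = propBit (same u v)) :
    (relevantE p).eval μ ρ =
      propBit ((∀ u ∈ K, same u u) ∧ ∃ u ∈ K, ∃ w ∈ K, ¬ same u w) := by
  have key : ∀ {ρ' : ℕ → ℕ} {x y : ℕ} {u v : Fin n}, ρ' p = ρ p → ReadsGraph G K c μ ρ' →
      ρ' x = u → ρ' y = v → (sameE p x y).eval μ ρ' = propBit (same u v) := by
    intro ρ' x y u v h1 h2 hx hy
    simp [sameE, eval_nE h2, hx, hy, h1, hs]
  rw [relevantE, eval_and (eval_not (eval_ex (eval_nE h) fun u =>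
      have h1 := h.update (r := 20) u
      eval_and (eval_termE h1 upd_eq) (eval_not (key (upd_ne rfl) h1 upd_eq upd_eq))))
    (eval_ex (eval_nE h) fun u => eval_ex (eval_nE (h.update _)) fun w =>
      have h2 := (h.update (r := 20) u).update (r := 21) w
      eval_and (eval_and (eval_termE h2 (upd_ne upd_eq)) (eval_termE h2 upd_eq))
        (eval_not (key (upd_ne (upd_ne rfl)) h2 (upd_ne upd_eq) upd_eq)))]
  congr 1
  simp only [not_exists, not_and, not_not, and_assoc, exists_and_left]

theorem eval_unitE (h : ReadsGraph G K c μ ρ) : unitE.eval μ ρ = n * (2 * n * (2 * n)) + 1 := by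
  simp [unitE, eval_nE h]

theorem eval_baseE (h : ReadsGraph G K c μ ρ) : baseE.eval μ ρ = 4 ^ n :=
  eval_pow (fun _ => rfl) (eval_nE h)

/-- A bound for the exponents. -/
def expRange (c : Fin n → ℕ) : ℕ := (n * ∑ u, c u + 1) * (n * (2 * n * (2 * n)) + 1)

theorem eval_rangeE (h : ReadsGraph G K c μ ρ) : rangeE.eval μ ρ = expRange c := by
  have : (Ex.sum 43 nE (costE 43)).eval μ ρ = ∑ u : Fin n, c u :=
    eval_sum (eval_nE h) fun u => eval_costE (h.update _) upd_eq
  simp only [rangeE, eval_mul, eval_add, this, eval_nE h, eval_unitE h, expRange]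
  rfl

theorem eval_modulusE (h : ReadsGraph G K c μ ρ) :
    modulusE.eval μ ρ = (4 ^ n) ^ expRange c + 1 := by
  rw [modulusE, eval_add, eval_pow (fun i => eval_baseE (h.update _)) (eval_rangeE h)]
  rfl

theorem eval_coinWeightE (h : ReadsGraph G K c μ ρ) {ω : ℕ → Bool} (hω : ReadsCoins n ω μ) {x : ℕ}
    {u : Fin n} (hx : ρ x = u) (hx' : x < 35 := by omega) :
    (coinWeightE x).eval μ ρ = coinWeight n ω u := by
  have hN : (2 * nE).eval μ ρ = 2 * n := by rw [eval_mul, eval_nE h]; rfl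
  rw [coinWeightE, eval_sum hN (f := fun i => if 2 ^ (i : ℕ) < 2 * n then
    2 ^ (i : ℕ) * (ω (2 * n * u + i)).toNat else 0), coinWeight, Finset.sum_range]
  intro i
  have h1 := h.update (r := 35) i
  have hN1 : (2 * nE).eval μ (Function.update ρ 35 i) = 2 * n := by rw [eval_mul, eval_nE h1]; rfl
  have hpow : (Ex.pow 2 (.var 35)).eval μ (Function.update ρ 35 i) = 2 ^ (i : ℕ) :=
    eval_pow (fun _ => rfl) upd_eq
  refine eval_cond (eval_lt hpow hN1) (fun hi => ?_) (fun _ => rfl)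
  have e1 : (Ex.op .mod (.pow 2 (.var 35)) (2 * nE + 1)).eval μ (Function.update ρ 35 i) = 2 ^ (i : ℕ) := by
    show Op.eval .mod _ _ = _
    rw [hpow, eval_add, hN1]
    exact Nat.mod_eq_of_lt (by have : (1 : Ex).eval μ (Function.update ρ 35 i) = 1 := rfl; omega)
  have hlt : 2 * n * u + i < 2 * n * n := by
    have h2 : 2 * n * (u + 1) ≤ 2 * n * n := Nat.mul_le_mul_left _ u.2
    rw [mul_add] at h2
    omega
  rw [eval_mul, e1, eval_read, eval_add, eval_mul, hN1, eval_var, eval_var, upd_eq, upd_ne hx, hω _ hlt]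

end

/-! #### The quotient problem -/

section
variable (K : Finset (Fin n)) (c : Fin n → ℕ) (same : Fin n → Fin n → Prop) {T : ℕ}
  (tree : SimpleGraph (Fin T)) (bag : Fin T → Fin n → Prop) (ω : ℕ → Bool)

/-- As vertex numbers are below `n`, comparing `c u * n + u` is comparing costs, with ties broken by
the number. -/
def IsRep (u : Fin n) : Prop := same u u ∧ ¬∃ w, same w u ∧ c w * n + w < c u * n + u
def HasTerm (u : Fin n) : Prop := ∃ w, w ∈ K ∧ same w u
def IsFirst (u : Fin n) : Prop :=
  (IsRep c same u ∧ HasTerm K same u) ∧ ¬∃ w, w < u ∧ IsRep c same w ∧ HasTerm K same w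

open Classical in
/-- The vertices of the quotient graph (as representatives) in the bag of `t`. -/
noncomputable def repBag (t : Fin T) : Finset (Fin n) := {u | bag t u ∧ IsRep c same u}

open Classical in
noncomputable def quotientCost (u : Fin n) : ℕ :=
  if HasTerm K same u then ∑ w with w ∈ K ∧ same w u, c w else c u

noncomputable def exponent (u : Fin n) : ℕ :=
  quotientCost K c same u * (n * (2 * n * (2 * n)) + 1) + coinWeight n ω u

open Classical in
/-- The factor of the vertex `u` when it has colour `x`. -/
noncomputable def vertexFactor (u : Fin n) (x : Fin 3) : ℕ :=
  if x = 0 then propBit (¬HasTerm K same u) else if x = 1 then (4 ^ n) ^ exponent K c same ω u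
    else if IsFirst K c same u then 0 else (4 ^ n) ^ exponent K c same ω u

/-- The colour of `u` in the colouring of `B` with number `j`. -/
def colorOf (B : Finset (Fin n)) (j : ℕ) (u : Fin n) : Fin 3 :=
  if u ∈ B then ⟨j / 3 ^ (B.filter (· < u)).card % 3, Nat.mod_lt _ (by norm_num)⟩ else 0

def colorCode (f : Fin n → Fin 3) : ℕ := ∑ u : Fin n, 3 ^ (u : ℕ) * (f u : ℕ)

/-- No edge inside `B` joins the two sides. -/
noncomputable def localFactor (G : SimpleGraph (Fin n)) (B : Finset (Fin n)) (f : Fin n → Fin 3) : ℕ :=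
  propBit (¬∃ u v, (u ∈ B ∧ v ∈ B) ∧ G.Adj u v ∧ f u = 1 ∧ f v = 2)

variable {K c same tree bag ω} {G : SimpleGraph (Fin n)} {μ : ℕ → ℕ → ℕ} {ρ : ℕ → ℕ}

theorem eval_tE (d : ReadsDecomposition same tree bag μ ρ) : tE.eval μ ρ = T := d.numNodes

theorem eval_sameE (h : ReadsGraph G K c μ ρ) (d : ReadsDecomposition same tree bag μ ρ) {x y : ℕ}
    {u v : Fin n} (hx : ρ x = u) (hy : ρ y = v) : (sameE 4 x y).eval μ ρ = propBit (same u v) := by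
  simp [sameE, eval_nE h, hx, hy, d.same]

theorem eval_treeE (h : ReadsGraph G K c μ ρ) (d : ReadsDecomposition same tree bag μ ρ) {x y : ℕ}
    {s t : Fin T} (hx : ρ x = s) (hy : ρ y = t) : (treeE x y).eval μ ρ = propBit (tree.Adj s t) := by
  simp [treeE, eval_nE h, eval_tE d, hx, hy, d.tree]

theorem eval_bagE (h : ReadsGraph G K c μ ρ) (d : ReadsDecomposition same tree bag μ ρ) {x y : ℕ}
    {t : Fin T} {u : Fin n} (hx : ρ x = t) (hy : ρ y = u) :
    (bagE x y).eval μ ρ = propBit (bag t u) := by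
  simp [bagE, eval_nE h, eval_tE d, hx, hy, d.bag]

theorem eval_repE (h : ReadsGraph G K c μ ρ) (d : ReadsDecomposition same tree bag μ ρ) {x : ℕ}
    {u : Fin n} (hx : ρ x = u) (hx' : x < 50 := by omega) :
    (repE x).eval μ ρ = propBit (IsRep c same u) :=
  eval_and (eval_sameE h d hx hx) <| eval_not <| eval_ex (eval_nE h) fun w =>
    have h1 := h.update (r := 50) w
    have d1 := d.update (r := 50) w
    eval_and (eval_sameE h1 d1 upd_eq (upd_ne hx)) <| eval_lt
      (by rw [eval_add, eval_mul, eval_costE h1 upd_eq, eval_nE h1, eval_var, upd_eq])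
      (by rw [eval_add, eval_mul, eval_costE h1 (upd_ne hx), eval_nE h1, eval_var, upd_ne hx])

theorem eval_inBagE (h : ReadsGraph G K c μ ρ) (d : ReadsDecomposition same tree bag μ ρ) {x y : ℕ}
    {t : Fin T} {u : Fin n} (hx : ρ x = t) (hy : ρ y = u) (hy' : y < 50 := by omega) :
    (inBagE x y).eval μ ρ = propBit (u ∈ repBag c same bag t) := by
  rw [inBagE, eval_and (eval_bagE h d hx hy) (eval_repE h d hy)]
  simp [repBag]

theorem eval_hasTermE (h : ReadsGraph G K c μ ρ) (d : ReadsDecomposition same tree bag μ ρ) {x : ℕ}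
    {u : Fin n} (hx : ρ x = u) (hx' : x < 40 := by omega) :
    (hasTermE x).eval μ ρ = propBit (HasTerm K same u) :=
  eval_ex (eval_nE h) fun w => eval_and (eval_termE (h.update _) upd_eq)
    (eval_sameE (h.update _) (d.update _) upd_eq (upd_ne hx))

theorem eval_partCostE (h : ReadsGraph G K c μ ρ) (d : ReadsDecomposition same tree bag μ ρ) {x : ℕ}
    {u : Fin n} (hx : ρ x = u) (hx' : x < 40 := by omega) :
    (partCostE x).eval μ ρ = quotientCost K c same u := by
  classical
  rw [partCostE, quotientCost]
  refine eval_cond (eval_hasTermE h d hx) (fun _ => ?_) (fun _ => eval_costE h hx)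
  rw [eval_sum (eval_nE h) (f := fun w => propBit (w ∈ K ∧ same w u) * c w), sum_propBit_mul]
  intro w
  rw [eval_mul, eval_and (eval_termE (h.update _) upd_eq)
    (eval_sameE (h.update _) (d.update _) upd_eq (upd_ne hx)), eval_costE (h.update _) upd_eq]

theorem eval_weightE (h : ReadsGraph G K c μ ρ) (d : ReadsDecomposition same tree bag μ ρ)
    (hω : ReadsCoins n ω μ) {x : ℕ} {u : Fin n} (hx : ρ x = u) (hx' : x < 35 := by omega) :
    (weightE x).eval μ ρ = (4 ^ n) ^ exponent K c same ω u := by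
  refine eval_pow (fun i => eval_baseE (h.update _)) ?_
  rw [exponentE, eval_add, eval_mul, eval_partCostE h d hx, eval_unitE h, eval_coinWeightE h hω hx, exponent]

theorem eval_firstE (h : ReadsGraph G K c μ ρ) (d : ReadsDecomposition same tree bag μ ρ) {x : ℕ}
    {u : Fin n} (hx : ρ x = u) (hx' : x < 30 := by omega) :
    (firstE x).eval μ ρ = propBit (IsFirst K c same u) := by
  rw [firstE, eval_and (eval_and (eval_repE h d hx) (eval_hasTermE h d hx))
    (eval_not (eval_ex (eval_nE h) fun w =>
      have h1 := h.update (r := 30) w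
      have d1 := d.update (r := 30) w
      eval_and (eval_lt (eval_var_eq upd_eq) (eval_var_eq (upd_ne hx))) (eval_and (eval_repE h1 d1 upd_eq)
        (eval_hasTermE h1 d1 upd_eq))))]
  simp only [IsFirst, Fin.val_fin_lt]

theorem eval_aliveE {S : Finset (Fin T)} (hS : ReadsAlive S μ) {x : ℕ} {t : Fin T} (hx : ρ x = t) :
    (aliveE x).eval μ ρ = propBit (t ∈ S) := by
  rw [aliveE, eval_not (p := t ∉ S) (by rw [eval_read, eval_var, hx, hS t]), not_not]

open Classical in
theorem eval_leafE (h : ReadsGraph G K c μ ρ) (d : ReadsDecomposition same tree bag μ ρ)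
    {S : Finset (Fin T)} (hS : ReadsAlive S μ) {x : ℕ} {t : Fin T} (hx : ρ x = t)
    (hx' : x < 30 := by omega) :
    (leafE x).eval μ ρ = propBit (t ∈ S ∧ ∀ s ∈ S, ∀ s' ∈ S, tree.Adj t s → tree.Adj t s' → s = s') := by
  rw [leafE, eval_and (eval_aliveE hS hx) (eval_not (eval_lt (eval_ofNat 1) (eval_sum (eval_tE d) fun s =>
    eval_and (eval_aliveE hS upd_eq) (eval_treeE (h.update _) (d.update _) (upd_ne hx) upd_eq)))),
    sum_propBit, not_lt, Finset.card_le_one]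
  congr 1
  simp only [Finset.mem_filter, Finset.mem_univ, true_and, and_imp]
  refine propext (and_congr_right fun _ => ⟨fun h s hs s' hs' h1 h2 => h s hs h1 s' hs' h2,
    fun h s hs h1 s' hs' h2 => h s hs s' hs' h1 h2⟩)

theorem eval_boundaryE [DecidableRel tree.Adj] (h : ReadsGraph G K c μ ρ)
    (d : ReadsDecomposition same tree bag μ ρ)
    {S : Finset (Fin T)} (hS : ReadsAlive S μ) {x y : ℕ} {t : Fin T} {u : Fin n} (hx : ρ x = t)
    (hy : ρ y = u) (hx' : x < 30 := by omega) (hy' : y < 30 := by omega) :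
    (boundaryE x y).eval μ ρ = propBit (u ∈ boundary tree (repBag c same bag) S t) := by
  rw [boundaryE, eval_and (eval_inBagE h d hx hy) (eval_ex (eval_tE d) fun s =>
    have h1 := h.update (r := 32) s
    have d1 := d.update (r := 32) s
    eval_and (eval_aliveE hS upd_eq) (eval_and (eval_treeE h1 d1 (upd_ne hx) upd_eq)
      (eval_inBagE h1 d1 upd_eq (upd_ne hy))))]
  congr 1
  exact propext mem_boundary.symm

theorem eval_bagSizeE (h : ReadsGraph G K c μ ρ) (d : ReadsDecomposition same tree bag μ ρ) {x : ℕ}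
    {t : Fin T} (hx : ρ x = t) (hx' : x < 30 := by omega) :
    (bagSizeE x).eval μ ρ = (repBag c same bag t).card := by
  rw [bagSizeE, eval_sum (eval_nE h) fun u => eval_inBagE (h.update _) (d.update _) (upd_ne hx) upd_eq,
    sum_propBit]
  simp

theorem eval_colorE (h : ReadsGraph G K c μ ρ) (d : ReadsDecomposition same tree bag μ ρ)
    {x : ℕ} {t : Fin T} {u : Fin n} (ht : ρ 14 = t) (hx : ρ x = u) (hx' : x < 30 := by omega) :
    (colorE x).eval μ ρ = colorOf (repBag c same bag t) (ρ 15) u := by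
  have hrank : (rankE 14 x).eval μ ρ = ((repBag c same bag t).filter (· < u)).card := by
    classical
    rw [rankE, eval_sum (eval_nE h) fun w =>
      have h1 := h.update (r := 33) w
      have d1 := d.update (r := 33) w
      eval_and (eval_inBagE h1 d1 (upd_ne ht) upd_eq) (eval_lt (eval_var_eq upd_eq) (eval_var_eq (upd_ne hx))), sum_propBit]
    congr 1
    ext w
    simp
  have := eval_cond (c := 0) (y := 0) (x := ρ 15 / 3 ^ ((repBag c same bag t).filter (· < u)).card % 3)
    (b := .op .mod (.op .div (.var 15) (.pow 3 (rankE 14 x))) 3)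
    (eval_inBagE h d ht hx) (fun _ => ?_) (fun _ => rfl)
  · rw [colorE, this, colorOf]
    split_ifs <;> rfl
  · show ρ 15 / (Ex.pow 3 (rankE 14 x)).eval μ ρ % 3 = _
    rw [eval_pow (x := 3) (fun _ => rfl) hrank]

theorem eval_factorE (h : ReadsGraph G K c μ ρ) (d : ReadsDecomposition same tree bag μ ρ)
    (hω : ReadsCoins n ω μ) {x : ℕ} {t : Fin T} {u : Fin n} (ht : ρ 14 = t) (hx : ρ x = u)
    (hx' : x < 30 := by omega) :
    (factorE x).eval μ ρ = vertexFactor K c same ω u (colorOf (repBag c same bag t) (ρ 15) u) := by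
  classical
  have hcol := eval_colorE h d ht hx
  have hw := eval_weightE h d hω hx
  rw [factorE, eval_cond (eval_eq hcol (eval_ofNat 0)) (fun _ => eval_not (eval_hasTermE h d hx)) fun _ =>
    eval_cond (eval_eq hcol (eval_ofNat 1)) (fun _ => hw) fun _ =>
    eval_cond (eval_firstE h d hx) (fun _ => eval_zero) (fun _ => hw)]
  have e0 : ∀ y : Fin 3, ((y : ℕ) = 0 ↔ y = 0) ∧ ((y : ℕ) = 1 ↔ y = 1) := by decide
  unfold vertexFactor
  simp only [(e0 _).1, (e0 _).2]

theorem eval_maskedCode {e : Ex} (h : ReadsGraph G K c μ ρ) (d : ReadsDecomposition same tree bag μ ρ)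
    {t : Fin T} (ht : ρ 14 = t) (B : Finset (Fin n))
    (he : ∀ u : Fin n, e.eval μ (Function.update ρ 24 u) = propBit (u ∈ B)) :
    (Ex.sum 24 nE (.pow 3 (.var 24) * .cond e (colorE 24) 0)).eval μ ρ =
      colorCode (restr (colorOf (repBag c same bag t) (ρ 15)) B) := by
  rw [colorCode]
  refine eval_sum (eval_nE h) fun u => ?_
  have h1 := h.update (r := 24) u
  have d1 := d.update (r := 24) u
  have e1 := eval_colorE (x := 24) h1 d1 (upd_ne ht) upd_eq
  rw [upd_ne (s := 15) rfl] at e1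
  rw [eval_mul, eval_pow (x := 3) (fun _ => rfl) (eval_var_eq upd_eq), eval_cond (he u) (fun _ => e1) fun _ => rfl, restr]
  split_ifs <;> rfl

theorem eval_valueE [DecidableRel tree.Adj] (h : ReadsGraph G K c μ ρ)
    (d : ReadsDecomposition same tree bag μ ρ)
    (hω : ReadsCoins n ω μ) {S : Finset (Fin T)} (hS : ReadsAlive S μ) {t : Fin T} (ht : ρ 14 = t) :
    valueE.eval μ ρ = propBit (ρ 15 < 3 ^ (repBag c same bag t).card) *
      ((∏ u ∈ repBag c same bag t \ boundary tree (repBag c same bag) S t,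
        vertexFactor K c same ω u (colorOf (repBag c same bag t) (ρ 15) u)) *
      nodeFactor tree (repBag c same bag) (fun t => localFactor G (repBag c same bag t)) S
        (fun s f => μ 3 (colorCode f * T + s)) t (colorOf (repBag c same bag t) (ρ 15))) := by
  classical
  rw [valueE, eval_mul, eval_mul, eval_mul]
  congr 1
  · exact eval_lt rfl (eval_pow (fun _ => rfl) (eval_bagSizeE h d ht))
  congr 1
  · rw [eval_prod (eval_nE h) (f := fun u => if u ∈ repBag c same bag t ∧
        u ∉ boundary tree (repBag c same bag) S t then
          vertexFactor K c same ω u (colorOf (repBag c same bag t) (ρ 15) u) else 1) fun u =>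
      have h1 := h.update (r := 20) u
      have d1 := d.update (r := 20) u
      eval_cond (eval_and (eval_inBagE h1 d1 (upd_ne ht) upd_eq)
        (eval_not (eval_boundaryE h1 d1 hS (upd_ne ht) upd_eq)))
        (fun _ => by
          have := eval_factorE (x := 20) h1 d1 hω (upd_ne ht) upd_eq
          rw [upd_ne (s := 15) rfl] at this
          exact this)
        (fun _ => eval_ofNat 1), ← Finset.prod_filter]
    refine Finset.prod_congr ?_ fun _ _ => rfl
    ext u; simp
  · rw [nodeFactor]
    congr 1
    · rw [consistentE, eval_not (eval_ex (eval_nE h) fun u => eval_ex (eval_nE (h.update _)) fun v =>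
        have h1 := (h.update (r := 21) u).update (r := 22) v
        have d1 := (d.update (r := 21) u).update (r := 22) v
        eval_and (eval_and (eval_inBagE h1 d1 (upd_ne (upd_ne ht)) (upd_ne upd_eq))
          (eval_inBagE h1 d1 (upd_ne (upd_ne ht)) upd_eq))
          (eval_and (eval_adjE h1 (upd_ne upd_eq) upd_eq)
          (eval_and (eval_eq (eval_colorE h1 d1 (upd_ne (upd_ne ht)) (upd_ne upd_eq)) (eval_ofNat 1))
            (eval_eq (eval_colorE h1 d1 (upd_ne (upd_ne ht)) upd_eq) (eval_ofNat 2)))))]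
      have e0 : ∀ y : Fin 3, ((y : ℕ) = 1 ↔ y = 1) ∧ ((y : ℕ) = 2 ↔ y = 2) := by decide
      simp only [localFactor, (e0 _).1, (e0 _).2, fun u v : Fin n => upd_ne (r := 22) (x := v) (upd_ne (ρ := ρ) (r := 21) (x := u) (s := 15) rfl)]
    · rw [eval_prod (eval_tE d) fun s =>
        have h1 := h.update (r := 23) s
        have d1 := d.update (r := 23) s
        eval_cond (eval_and (eval_not (eval_aliveE hS upd_eq)) (eval_treeE h1 d1 (upd_ne ht) upd_eq))
          (fun _ => by
            rw [eval_read, eval_add, eval_mul, eval_tE d1, eval_var, upd_eq, childCodeE,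
              eval_maskedCode h1 d1 (upd_ne ht) (repBag c same bag s) fun u =>
                eval_inBagE (h1.update _) (d1.update _) (upd_ne upd_eq) upd_eq,
              upd_ne (s := 15) rfl])
          (fun _ => eval_ofNat 1), ← Finset.prod_filter]

theorem eval_addressE [DecidableRel tree.Adj] (h : ReadsGraph G K c μ ρ)
    (d : ReadsDecomposition same tree bag μ ρ)
    {S : Finset (Fin T)} (hS : ReadsAlive S μ) {t : Fin T} (ht : ρ 14 = t) :
    addressE.eval μ ρ = colorCode (restr (colorOf (repBag c same bag t) (ρ 15))
      (boundary tree (repBag c same bag) S t)) * T + t := by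
  rw [addressE, eval_add, eval_mul, eval_tE d, eval_var, ht, codeE,
    eval_maskedCode h d ht (boundary tree (repBag c same bag) S t) fun u =>
      eval_boundaryE (h.update _) (d.update _) hS (upd_ne ht) upd_eq]

/-- The maximum is obtained by counting: a number lies below the largest bag size if and only if it
lies below some bag size, and all these sizes are at most `n`. -/
theorem eval_maxBagE (h : ReadsGraph G K c μ ρ) (d : ReadsDecomposition same tree bag μ ρ) :
    maxBagE.eval μ ρ = Finset.univ.sup fun t => (repBag c same bag t).card := by
  classical
  rw [maxBagE, eval_sum (eval_nE h) fun u => eval_ex (eval_tE (d.update _)) fun t =>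
    have h1 := (h.update (r := 20) u).update (r := 21) t
    have d1 := (d.update (r := 20) u).update (r := 21) t
    eval_lt (eval_var_eq (upd_ne upd_eq)) (eval_bagSizeE h1 d1 upd_eq), sum_propBit]
  have hle : (Finset.univ.sup fun t => (repBag c same bag t).card) ≤ n :=
    Finset.sup_le fun t _ => by simpa using Finset.card_le_univ (repBag c same bag t)
  have : ∀ u : Fin n, (∃ t, (u : ℕ) < (repBag c same bag t).card) ↔
      (u : ℕ) < Finset.univ.sup fun t => (repBag c same bag t).card := by
    intro u; rw [Finset.lt_sup_iff]; simp
  simp only [this]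
  generalize (Finset.univ.sup fun t => (repBag c same bag t).card) = m at hle
  rw [Fin.card_filter_val_lt]
  exact min_eq_right hle

end

end RAM

/-! ### The dynamic program -/

namespace RAM
open Ex

variable {n : ℕ}

theorem eval_foundE {G : SimpleGraph (Fin n)} {K : Finset (Fin n)} {c : Fin n → ℕ} {μ : ℕ → ℕ → ℕ}
    {ρ : ℕ → ℕ} (h : ReadsGraph G K c μ ρ) : foundE.eval μ ρ =
      propBit (∃ i : Fin (expRange c), (i : ℕ) / (n * (2 * n * (2 * n)) + 1) ≤ ρ 3 ∧
        ρ 9 % ((4 ^ n) ^ expRange c + 1) / (4 ^ n) ^ (i : ℕ) % 2 = 1) := by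
  rw [foundE]
  refine (eval_ex (p := fun i => ¬ρ 3 < (i : ℕ) / (n * (2 * n * (2 * n)) + 1) ∧
    ρ 9 % ((4 ^ n) ^ expRange c + 1) / (4 ^ n) ^ (i : ℕ) % 2 = 1) (eval_rangeE h) fun i => ?_).trans ?_
  · have h1 := h.update (r := 20) i
    refine eval_and (eval_not (eval_lt (eval_var_eq (r := 3) (upd_ne rfl)) ?_)) (eval_eq ?_ eval_one)
    · show (Ex.var 20).eval μ _ / unitE.eval μ _ = _
      rw [eval_unitE h1, eval_var_eq upd_eq]
    · show ((Ex.var 9).eval μ _ % modulusE.eval μ _) / (Ex.pow baseE (.var 20)).eval μ _ % 2 = _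
      rw [eval_modulusE h1, eval_pow (fun j => eval_baseE (h1.update j)) (eval_var_eq upd_eq),
        eval_var_eq (upd_ne (s := 9) rfl)]
  simp only [not_lt]

theorem eval_answerE {G : SimpleGraph (Fin n)} {K : Finset (Fin n)} {c : Fin n → ℕ} {μ : ℕ → ℕ → ℕ}
    {ρ : ℕ → ℕ} (h : ReadsGraph G K c μ ρ) {neg found : Prop} (h2 : ρ 2 = propBit neg)
    (h5 : ρ 5 = propBit found) : answerE.eval μ ρ =
      propBit (¬neg ∧
        (((∀ u ∈ K, ∀ w ∈ K, u = w ∨ G.Adj u w ∨ ∃ x ∈ K, G.Adj u x ∧ G.Adj w x) ∧ ∑ u ∈ K, c u ≤ ρ 3) ∨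
        (∃ v, (∀ u ∈ K, G.Adj u v) ∧ ∑ u ∈ K, c u + c v ≤ ρ 3) ∨
        (found ∧ ∃ i : Fin (expRange c), (i : ℕ) / (n * (2 * n * (2 * n)) + 1) ≤ ρ 3 ∧
          ρ 9 % ((4 ^ n) ^ expRange c + 1) / (4 ^ n) ^ (i : ℕ) % 2 = 1))) := by
  rw [answerE, budgetE, eval_and (eval_not (eval_var_eq h2)) (eval_not (eval_and (eval_not (eval_and (eval_diamTwoE h)
    (eval_not (eval_lt (eval_var_eq (r := 3) rfl) (eval_termCostE h))))) (eval_and (eval_not (eval_starE h))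
    (eval_not (eval_and (eval_var_eq h5) (eval_foundE h))))))]
  congr 1
  have key : ∀ p q r : Prop, (¬(¬p ∧ ¬q ∧ ¬r)) = (p ∨ q ∨ r) := fun p q r => propext (by tauto)
  simp only [not_lt, key]

/-! #### Numbering the colourings -/

theorem eq_of_digits_eq {b : ℕ} : ∀ {i j : ℕ}, i < 3 ^ b → j < 3 ^ b →
    (∀ k < b, i / 3 ^ k % 3 = j / 3 ^ k % 3) → i = j := by
  induction b with
  | zero => intro i j hi hj _; simp at hi hj; omega
  | succ b ih =>
    intro i j hi hj h
    have h0 := h 0 (by omega)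
    have hd : i / 3 = j / 3 := by
      rw [pow_succ] at hi hj
      refine ih (by omega) (by omega) fun k hk => ?_
      have := h (k + 1) (by omega)
      rwa [pow_succ', ← Nat.div_div_eq_div_mul, ← Nat.div_div_eq_div_mul] at this
    simp only [pow_zero, Nat.div_one] at h0
    omega

/-- The element of `B` with `k` predecessors in `B` is coloured by ternary digit `k`, so the
colouring determines all the digits. -/
theorem colorOf_injOn (B : Finset (Fin n)) :
    Set.InjOn (colorOf B) (Finset.range (3 ^ B.card) : Set ℕ) := by
  intro i hi j hj hij
  refine eq_of_digits_eq (by simpa using hi) (by simpa using hj) fun k hk => ?_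
  have hu := B.orderEmbOfFin_mem rfl ⟨k, hk⟩
  have hr : (B.filter (· < B.orderEmbOfFin rfl ⟨k, hk⟩)).card = k := by
    have : B.filter (· < B.orderEmbOfFin rfl ⟨k, hk⟩) =
        (Finset.univ.filter fun x : Fin B.card => x < ⟨k, hk⟩).map (B.orderEmbOfFin rfl).toEmbedding := by
      ext v
      simp only [Finset.mem_filter, Finset.mem_map, Finset.mem_univ, true_and]
      constructor
      · rintro ⟨hv, hlt⟩
        obtain ⟨x, rfl⟩ : v ∈ Set.range (B.orderEmbOfFin rfl) := by
          rw [Finset.range_orderEmbOfFin]; exact hv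
        exact ⟨x, (OrderEmbedding.lt_iff_lt _).1 hlt, rfl⟩
      · rintro ⟨x, hx, rfl⟩
        exact ⟨B.orderEmbOfFin_mem rfl x, (OrderEmbedding.lt_iff_lt _).2 hx⟩
    rw [this, Finset.card_map]
    have := Fin.card_filter_val_lt (n := B.card) (m := k)
    simpa [Fin.lt_def, min_eq_right hk.le] using this
  have := congrArg Fin.val (congrFun hij (B.orderEmbOfFin rfl ⟨k, hk⟩))
  simpa only [colorOf, if_pos hu, hr] using this

theorem colorOf_mem (B : Finset (Fin n)) (j : ℕ) : colorOf B j ∈ colorings B :=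
  mem_colorings.2 fun v hv => by simp [colorOf, hv]

theorem card_colorings (B : Finset (Fin n)) : (colorings B).card = 3 ^ B.card := by
  rw [colorings, Fintype.card_piFinset, ← Finset.prod_subset (Finset.subset_univ B)]
  · rw [Finset.prod_congr rfl (g := fun _ => 3) fun v hv => by simp [hv], Finset.prod_const]
  · intro v _ hv; simp [hv]

theorem sum_colorOf {A : Type*} [AddCommMonoid A] (B : Finset (Fin n)) (F : (Fin n → Fin 3) → A) :
    ∑ j ∈ Finset.range (3 ^ B.card), F (colorOf B j) = ∑ g ∈ colorings B, F g := by
  rw [← Finset.sum_image (s := Finset.range (3 ^ B.card)) (g := colorOf B) (f := F) (colorOf_injOn B)]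
  congr 1
  refine Finset.eq_of_subset_of_card_le ?_ ?_
  · intro g hg
    obtain ⟨j, _, rfl⟩ := Finset.mem_image.1 hg
    exact colorOf_mem B j
  · rw [card_colorings, Finset.card_image_of_injOn (colorOf_injOn B), Finset.card_range]

theorem colorCode_injective : Function.Injective (colorCode (n := n)) := by
  intro f g h
  apply finFunctionFinEquiv.injective
  apply Fin.ext
  rw [finFunctionFinEquiv_apply, finFunctionFinEquiv_apply]
  simpa only [colorCode, mul_comm] using h

theorem colorCode_zero : colorCode (0 : Fin n → Fin 3) = 0 := by simp [colorCode]

/-! #### The message loop -/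

section
variable (G : SimpleGraph (Fin n)) (K : Finset (Fin n)) (c : Fin n → ℕ) (same : Fin n → Fin n → Prop)
  {T : ℕ} (tree : SimpleGraph (Fin T)) (bag : Fin T → Fin n → Prop) (ω : ℕ → Bool)

/-- The messages that are stored in array 3. -/
def storedMessage (A : Type*) [CommSemiring A] (μ : ℕ → ℕ → ℕ) (s : Fin T) (f : Fin n → Fin 3) : A :=
  (μ 3 (colorCode f * T + s) : A)

/-- All that the dynamic program reads, with the nodes of `S` alive. -/
structure ReadsAll (S : Finset (Fin T)) (μ : ℕ → ℕ → ℕ) (ρ : ℕ → ℕ) : Prop where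
  graph : ReadsGraph G K c μ ρ
  decomposition : ReadsDecomposition same tree bag μ ρ
  coins : ReadsCoins n ω μ
  alive : ReadsAlive S μ

variable {G K c same tree bag ω}

theorem ReadsAll.congr {S : Finset (Fin T)} {μ μ' : ℕ → ℕ → ℕ} {ρ ρ' : ℕ → ℕ}
    (h : ReadsAll G K c same tree bag ω S μ ρ) (hμ : ∀ a < 3, μ' a = μ a) (hρ : ∀ r < 9, ρ' r = ρ r) :
    ReadsAll G K c same tree bag ω S μ' ρ' := by
  obtain ⟨⟨a1, a2, a3, a4⟩, ⟨b1, b2, b3, b4⟩, h3, h4⟩ := h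
  refine ⟨⟨?_, ?_, ?_, ?_⟩, ⟨?_, ?_, ?_, ?_⟩, ?_, ?_⟩ <;>
    simp only [ReadsCoins, ReadsAlive, hμ 0 (by omega), hμ 1 (by omega), hμ 2 (by omega), hρ 1 (by omega),
      hρ 4 (by omega), hρ 7 (by omega)] <;> assumption

open Classical in
-- Loop invariant: after `i` rounds the entries of node `t` are the parts of its message that come
-- from the first `i` colour numbers. Entries of other nodes are untouched, since `x * T + s`
-- determines `x` and `s`. Stating the identity in a semiring where the modulus vanishes makes the
-- reductions invisible.
theorem messageCmd_iter {S : Finset (Fin T)} {σ : State} {t : Fin T}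
    (h : ReadsAll G K c same tree bag ω S σ.mem σ.reg) (ht : σ.reg 14 = t) (htS : t ∈ S)
    (h0 : ∀ x, σ.mem 3 (x * T + t) = 0) (A : Type*) [CommSemiring A]
    (hA : (((4 ^ n) ^ expRange c + 1 : ℕ) : A) = 0) (i : ℕ) :
    ∀ τ, τ = iter (fun i s => (Cmd.write 3 addressE
        (.op .mod (.read 3 addressE + valueE) modulusE)).den (s.setReg 15 i)) i σ →
    (∀ a ≠ 3, τ.mem a = σ.mem a) ∧ (∀ r ≠ 15, τ.reg r = σ.reg r) ∧ τ.coins = σ.coins ∧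
    (∀ x, ∀ s : Fin T, s ≠ t → τ.mem 3 (x * T + s) = σ.mem 3 (x * T + s)) ∧
    ∀ f, storedMessage A τ.mem t f = ∑ j ∈ Finset.range i,
      if j < 3 ^ (repBag c same bag t).card ∧
        restr (colorOf (repBag c same bag t) j) (boundary tree (repBag c same bag) S t) = f then
      (∏ u ∈ repBag c same bag t \ boundary tree (repBag c same bag) S t,
        (vertexFactor K c same ω u (colorOf (repBag c same bag t) j u) : A)) *
      nodeFactor tree (repBag c same bag) (fun t g => (localFactor G (repBag c same bag t) g : A)) S
        (storedMessage A σ.mem) t (colorOf (repBag c same bag t) j) else 0 := by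
  induction i with
  | zero =>
    rintro τ rfl
    simp [iter, storedMessage, h0]
  | succ i ih =>
    rintro τ rfl
    rw [iter]
    obtain ⟨i1, i2, i3, i4, i5⟩ := ih _ rfl
    generalize iter _ i σ = τ at i1 i2 i3 i4 i5
    have hr := h.congr (μ' := τ.mem) (ρ' := Function.update τ.reg 15 i) (fun a ha => i1 a (by omega))
      fun r hr => by rw [Function.update_of_ne (by omega), i2 r (by omega)]
    have ht' : Function.update τ.reg 15 i 14 = t := by
      rw [Function.update_of_ne (by omega), i2 14 (by omega), ht]
    have hadd := eval_addressE hr.graph hr.decomposition hr.alive ht'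
    have hval := eval_valueE hr.graph hr.decomposition hr.coins hr.alive ht'
    have hmod := eval_modulusE hr.graph
    rw [upd_eq] at hadd hval
    set B := repBag c same bag with hB
    set D := boundary tree B S t with hD
    set σ' := restr (colorOf (B t) i) D with hσ'
    have hT : (t : ℕ) < T := t.2
    have hinj : ∀ (x y : ℕ) (s : Fin T), x * T + s = y * T + t ↔ x = y ∧ s = t := by
      intro x y s
      constructor
      · intro hxy
        have h1 := congrArg (· % T) hxy
        have h2 := congrArg (· / T) hxy
        simp only [Nat.mul_add_mod_self_right, Nat.mod_eq_of_lt t.2, Nat.mod_eq_of_lt s.2] at h1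
        simp only [mul_comm _ T, Nat.mul_add_div (Nat.zero_lt_of_lt hT), Nat.div_eq_of_lt t.2,
          Nat.div_eq_of_lt s.2, add_zero] at h2
        exact ⟨h2, Fin.ext h1⟩
      · rintro ⟨rfl, rfl⟩; rfl
    have hden : (Cmd.write 3 addressE (.op .mod (.read 3 addressE + valueE) modulusE)).den (τ.setReg 15 i) =
        (τ.setReg 15 i).setMem 3 (colorCode σ' * T + t)
          ((τ.mem 3 (colorCode σ' * T + t) + valueE.eval τ.mem (Function.update τ.reg 15 i)) %
            ((4 ^ n) ^ expRange c + 1)) := by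
      show State.setMem _ 3 (addressE.eval τ.mem (Function.update τ.reg 15 i))
        ((τ.mem 3 (addressE.eval τ.mem (Function.update τ.reg 15 i)) + _) % _) = _
      have hmod' : modulusE.eval (τ.setReg 15 i).mem (τ.setReg 15 i).reg = _ := hmod
      rw [hadd, hmod']
      rfl
    have hmem : ∀ x, ((Cmd.write 3 addressE (.op .mod (.read 3 addressE + valueE) modulusE)).den
        (τ.setReg 15 i)).mem 3 x = if x = colorCode σ' * T + t then
          ((τ.mem 3 (colorCode σ' * T + t) + valueE.eval τ.mem (Function.update τ.reg 15 i)) %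
            ((4 ^ n) ^ expRange c + 1)) else τ.mem 3 x := by
      intro x
      rw [hden]
      simp only [State.setMem, Function.update_self, State.setReg]
      rw [Function.update_apply]
    refine ⟨fun a ha => ?_, fun r hr => ?_, ?_, fun x s hs => ?_, fun f => ?_⟩
    · rw [← i1 a ha, hden]
      exact Function.update_of_ne ha _ _
    · rw [← i2 r hr, hden]
      exact Function.update_of_ne hr _ _
    · rw [← i3]; rfl
    · rw [hmem, if_neg (fun hx => hs ((hinj _ _ _).1 hx).2), i4 x s hs]
    · rw [Finset.sum_range_succ, ← i5 f]
      unfold storedMessage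
      rw [hmem]
      simp only [hinj, and_true, colorCode_injective.eq_iff]
      by_cases hf : σ' = f
      · subst hf
        rw [if_pos rfl]
        have hcast : ∀ y : ℕ, ((y % ((4 ^ n) ^ expRange c + 1) : ℕ) : A) = y := by
          intro y
          conv_rhs => rw [← Nat.mod_add_div y ((4 ^ n) ^ expRange c + 1)]
          rw [Nat.cast_add, Nat.cast_mul, hA, zero_mul, add_zero]
        rw [hcast, Nat.cast_add, hval]
        congr 1
        by_cases hi : i < 3 ^ (B t).card
        · rw [if_pos ⟨hi, rfl⟩, propBit_of_true hi, one_mul, Nat.cast_mul, Nat.cast_prod]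
          congr 1
          rw [nodeFactor, nodeFactor, Nat.cast_mul, Nat.cast_prod]
          congr 1
          refine Finset.prod_congr rfl fun s hs => ?_
          rw [i4 _ s (by rintro rfl; exact (Finset.mem_filter.1 hs).2.1 htS)]
        · rw [if_neg fun h => hi h.1, propBit_of_false hi]
          simp
      · rw [if_neg fun h => hf h.symm, if_neg fun h => hf h.2, add_zero]

open Classical in
theorem messageCmd_den {S : Finset (Fin T)} {σ : State} {t : Fin T}
    (h : ReadsAll G K c same tree bag ω S σ.mem σ.reg) (ht : σ.reg 14 = t) (htS : t ∈ S)
    (h0 : ∀ x, σ.mem 3 (x * T + t) = 0) (hQ : 3 ^ (repBag c same bag t).card ≤ σ.reg 8)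
    (A : Type*) [CommSemiring A] (hA : (((4 ^ n) ^ expRange c + 1 : ℕ) : A) = 0) :
    (∀ a ≠ 3, (messageCmd.den σ).mem a = σ.mem a) ∧ (∀ r ≠ 15, (messageCmd.den σ).reg r = σ.reg r) ∧
    (∀ x, ∀ s : Fin T, s ≠ t → (messageCmd.den σ).mem 3 (x * T + s) = σ.mem 3 (x * T + s)) ∧
    ∀ f, storedMessage A (messageCmd.den σ).mem t f =
      message tree (repBag c same bag) (fun u x => (vertexFactor K c same ω u x : A))
        (fun t g => (localFactor G (repBag c same bag t) g : A)) S (storedMessage A σ.mem) t f := by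
  obtain ⟨h1, h2, h3, h4, h5⟩ := messageCmd_iter h ht htS h0 A hA (σ.reg 8) _ rfl
  refine ⟨h1, h2, h4, fun f => ?_⟩
  refine (h5 f).trans ?_
  rw [message, Finset.sum_filter, ← sum_colorOf, ← Finset.sum_subset (Finset.range_mono hQ)]
  · refine Finset.sum_congr rfl fun j hj => ?_
    rw [Finset.mem_range] at hj
    simp only [hj, true_and]
  · intro j _ hj
    rw [Finset.mem_range] at hj
    simp [hj]

end

end RAM

/-! #### The elimination of the tree -/

namespace RAM
open Ex

section
variable {n : ℕ} (G : SimpleGraph (Fin n)) (K : Finset (Fin n)) (c : Fin n → ℕ)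
  (same : Fin n → Fin n → Prop) {T : ℕ} (tree : SimpleGraph (Fin T)) (bag : Fin T → Fin n → Prop)
  (ω : ℕ → Bool) (A : Type*) [CommSemiring A]

open Classical in
/-- The sum over the nodes of `S`. -/
noncomputable def remainingSum (S : Finset (Fin T)) (m : Fin T → (Fin n → Fin 3) → A) : A :=
  totalSum tree (repBag c same bag) (fun u x => (vertexFactor K c same ω u x : A))
    (fun t g => (localFactor G (repBag c same bag t) g : A)) S m

/-- The invariant of the elimination: `S` is the set of the nodes that are alive, and `Z` is the
value to be computed. -/
structure SweepInvariant (Z : A) (S : Finset (Fin T)) (σ : State) : Prop where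
  reads : ReadsAll G K c same tree bag ω S σ.mem σ.reg
  bound : ∀ t, 3 ^ (repBag c same bag t).card ≤ σ.reg 8
  zero : ∀ t ∈ S, ∀ x, σ.mem 3 (x * T + t) = 0
  connected : ConnectedOn tree (S : Set (Fin T))
  bag_connected : ∀ v, ConnectedOn tree {t | t ∈ S ∧ v ∈ repBag c same bag t}
  total : S.Nonempty → remainingSum G K c same tree bag ω A S (storedMessage A σ.mem) = Z
  result : S = ∅ → (σ.reg 9 : A) = Z

variable {G K c same tree bag ω A}

theorem SweepInvariant.setReg {Z : A} {S : Finset (Fin T)} {σ : State}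
    (h : SweepInvariant G K c same tree bag ω A Z S σ) {r : ℕ} (hr : 9 < r) (x : ℕ) :
    SweepInvariant G K c same tree bag ω A Z S (σ.setReg r x) := by
  have hreg : ∀ i < r, (σ.setReg r x).reg i = σ.reg i := fun i hi =>
    Function.update_of_ne (by omega) _ _
  refine ⟨h.reads.congr (fun _ _ => rfl) fun i hi => hreg i (by omega), fun t => ?_, h.zero, h.connected,
    h.bag_connected, h.total, fun hS => ?_⟩
  · rw [hreg 8 (by omega)]; exact h.bound t
  · rw [hreg 9 hr]; exact h.result hS

/-- `t` has at most one neighbour in `S`. -/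
def IsLeafOf (tree : SimpleGraph (Fin T)) (S : Finset (Fin T)) (t : Fin T) : Prop :=
  ∀ s ∈ S, ∀ s' ∈ S, tree.Adj t s → tree.Adj t s' → s = s'

open Classical in
-- Removal of a leaf preserves the connectedness of the alive nodes and of the alive nodes whose bag
-- contains a given vertex (`ConnectedOn.erase`). These two facts provide the hypotheses of
-- `totalSum_erase` at the next elimination.
theorem SweepInvariant.eliminate {Z : A} {S : Finset (Fin T)} {σ : State} {t : Fin T}
    (h : SweepInvariant G K c same tree bag ω A Z S σ) (ht : σ.reg 14 = t)
    (hA : (((4 ^ n) ^ expRange c + 1 : ℕ) : A) = 0) :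
    SweepInvariant G K c same tree bag ω A Z
      (if t ∈ S ∧ IsLeafOf tree S t then S.erase t else S) (eliminateCmd.den σ) := by
  have hcond : (leafE 14).eval σ.mem σ.reg = propBit (t ∈ S ∧ IsLeafOf tree S t) :=
    eval_leafE h.reads.graph h.reads.decomposition h.reads.alive ht
  rw [eliminateCmd, Cmd.den, hcond]
  by_cases hl : t ∈ S ∧ IsLeafOf tree S t
  swap
  · rw [if_neg hl, if_neg fun h => hl (propBit_ne_zero.1 h)]; exact h
  rw [if_pos hl, if_pos (propBit_ne_zero.2 hl)]
  obtain ⟨htS, hleaf⟩ := hl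
  obtain ⟨m1, m2, m3, m4⟩ := messageCmd_den h.reads ht htS (h.zero t htS) (h.bound t) A hA
  generalize hτ : messageCmd.den σ = τ at m1 m2 m3 m4
  have ht' : τ.reg 14 = t := by rw [m2 14 (by omega), ht]
  set σ' := (Cmd.seq messageCmd (.seq (.set 9 (.read 3 (.var 14))) (.write 2 (.var 14) 1))).den σ with hσ'
  have e : σ' = (τ.setReg 9 (τ.mem 3 t)).setMem 2 t 1 := by
    rw [hσ', Cmd.den, hτ]
    simp only [Cmd.den, Ex.eval, ht', State.setReg, Function.update_of_ne (show 14 ≠ 9 by omega)]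
  have eμ : ∀ a ≠ 2, σ'.mem a = τ.mem a := by
    intro a ha
    rw [e]
    exact Function.update_of_ne ha _ _
  have eμ2 : ∀ i, σ'.mem 2 i = if i = t then 1 else σ.mem 2 i := by
    intro i
    rw [e, ← m1 2 (by omega)]
    simp [State.setMem, State.setReg, Function.update_apply]
  have eρ : ∀ r, r ≠ 9 → r ≠ 15 → σ'.reg r = σ.reg r := by
    intro r hr hr'
    rw [e, ← m2 r hr']
    exact Function.update_of_ne hr _ _
  have e9 : σ'.reg 9 = τ.mem 3 t := by
    rw [e]; exact Function.update_self (f := τ.reg) 9 (τ.mem 3 t)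
  have hstored : storedMessage (n := n) (T := T) A σ'.mem = storedMessage A τ.mem := by
    unfold storedMessage; rw [eμ 3 (by omega)]
  refine ⟨⟨?_, ?_, ?_, ?_⟩, ?_, ?_, ?_, ?_, ?_, ?_⟩
  · have := h.reads.graph
    refine ⟨?_, ?_, ?_, ?_⟩
    · rw [eρ 1 (by omega) (by omega)]; exact this.numVertices
    all_goals rw [eμ 0 (by omega), m1 0 (by omega)]
    exacts [this.adj, this.term, this.cost]
  · have := h.reads.decomposition
    refine ⟨?_, ?_, ?_, ?_⟩
    · rw [eρ 7 (by omega) (by omega)]; exact this.numNodes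
    all_goals rw [eμ 0 (by omega), m1 0 (by omega), eρ 4 (by omega) (by omega)]
    exacts [this.same, this.tree, this.bag]
  · unfold ReadsCoins
    rw [eμ 1 (by omega), m1 1 (by omega)]
    exact h.reads.coins
  · intro s
    rw [eμ2]
    by_cases hs : s = t
    · subst hs
      rw [if_pos rfl, propBit_of_true (by simp)]
    · rw [if_neg fun h => hs (Fin.ext h), h.reads.alive s]
      simp [hs]
  · intro s
    rw [eρ 8 (by omega) (by omega)]; exact h.bound s
  · intro s hs x
    obtain ⟨hs1, hs2⟩ := Finset.mem_erase.1 hs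
    rw [eμ 3 (by omega), m3 x s hs1, h.zero s hs2]
  · have := h.connected.erase (l := t) fun u hu w hw => hleaf u hu w hw
    rwa [Finset.coe_erase]
  · intro v
    have := (h.bag_connected v).erase (l := t) fun u hu w hw => hleaf u hu.1 w hw.1
    convert this using 1
    ext s
    simp only [Finset.mem_erase, Set.mem_ofPred_eq, Set.mem_sdiff, Set.mem_singleton_iff]
    tauto
  · rintro ⟨s, hs⟩
    obtain ⟨hs1, hs2⟩ := Finset.mem_erase.1 hs
    obtain ⟨u, hu, htu⟩ := h.connected.exists_adj htS hs2 hs1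
    rw [← h.total ⟨t, htS⟩, hstored]
    refine totalSum_erase htS hu htu (fun w hw htw => hleaf w hw u hu htw htu) ?_ ?_ ?_
    -- The alive nodes whose bags contain `v` are connected, and `u` is the only alive neighbour of
    -- `t`, so the bag of `u` contains `v`.
    · intro v hv w hw hwt hvw
      obtain ⟨x, ⟨hx1, hx2⟩, htx⟩ := (h.bag_connected v).exists_adj (l := t) (t := w) ⟨htS, hv⟩ ⟨hw, hvw⟩ hwt
      rwa [← hleaf x hx1 u hu htx htu]
    · intro w hw
      funext f
      unfold storedMessage
      rw [m3 _ w (by rintro rfl; exact hw htS)]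
    · intro g
      exact m4 _
  · intro hS
    have hS' : S = {t} := by
      rcases Finset.erase_eq_empty_iff S t |>.1 hS with h' | h'
      · rw [h'] at htS; simp at htS
      · exact h'
    rw [← h.total ⟨t, htS⟩, e9]
    -- The zero colouring has code 0, so its entry for node `t` has address `t`, which is the cell
    -- copied to variable 9.
    have h0 := m4 0
    unfold storedMessage at h0
    rw [colorCode_zero, zero_mul, zero_add] at h0
    rw [h0]
    subst hS'
    exact (totalSum_singleton t).symm

/-- The set of alive nodes only shrinks during a pass, so a node that is a leaf at the start is
still one when its turn comes, and is removed. -/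
theorem SweepInvariant.pass {Z : A} {S : Finset (Fin T)} {σ : State}
    (h : SweepInvariant G K c same tree bag ω A Z S σ)
    (hA : (((4 ^ n) ^ expRange c + 1 : ℕ) : A) = 0) (i : ℕ) (hi : i ≤ T) :
    ∃ S' ⊆ S, SweepInvariant G K c same tree bag ω A Z S'
        (iter (fun i s => eliminateCmd.den (s.setReg 14 i)) i σ) ∧
      ∀ t ∈ S', (t : ℕ) < i → ¬IsLeafOf tree S t := by
  classical
  induction i with
  | zero => exact ⟨S, subset_rfl, h, by simp⟩
  | succ i ih =>
    obtain ⟨S', hS', h1, h2⟩ := ih (by omega)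
    refine ⟨_, ?_, SweepInvariant.eliminate (t := ⟨i, hi⟩)
      (h1.setReg (r := 14) (by omega) i) (by rw [setReg_reg, if_pos rfl]) hA, ?_⟩
    · split_ifs
      · exact (Finset.erase_subset _ _).trans hS'
      · exact hS'
    · intro t ht hti
      have htS : t ∈ S' := by
        split_ifs at ht
        · exact Finset.mem_of_mem_erase ht
        · exact ht
      rcases Nat.lt_succ_iff_lt_or_eq.1 hti with h | h
      · exact h2 t htS h
      · intro hl
        have hti : t = ⟨i, hi⟩ := Fin.ext h
        rw [if_pos ⟨hti ▸ htS, fun s hs s' hs' => hti ▸ hl s (hS' hs) s' (hS' hs')⟩] at ht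
        exact (Finset.mem_erase.1 ht).1 hti

/-- While nodes are left, the subtree of alive nodes has a leaf and every pass makes it smaller;
after `T` passes it is empty. -/
theorem SweepInvariant.sweep {Z : A} {σ : State}
    (h : SweepInvariant G K c same tree bag ω A Z Finset.univ σ) (htree : tree.IsTree)
    (hA : (((4 ^ n) ^ expRange c + 1 : ℕ) : A) = 0) :
    ((sweepCmd.den σ).reg 9 : A) = Z := by
  classical
  have key : ∀ i, ∃ S : Finset (Fin T), SweepInvariant G K c same tree bag ω A Z S
      (iter (fun i s => (Cmd.loop 14 tE eliminateCmd).den (s.setReg 13 i)) i σ) ∧ S.card ≤ T - i := by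
    intro i
    induction i with
    | zero => exact ⟨_, h, by simp⟩
    | succ i ih =>
      obtain ⟨S, h1, h2⟩ := ih
      have h3 := h1.setReg (r := 13) (by omega) i
      obtain ⟨S', hS', h4, h5⟩ := h3.pass hA T le_rfl
      refine ⟨S', ?_, ?_⟩
      · rw [iter, Cmd.den, eval_tE h3.reads.decomposition]
        exact h4
      · rcases S.eq_empty_or_nonempty with rfl | hne
        · rw [Finset.subset_empty.1 hS']; simp
        · obtain ⟨l, hl, hl'⟩ := htree.exists_leaf h1.connected (by simpa using hne)
          have hlt : S'.card < S.card := Finset.card_lt_card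
            ⟨hS', fun hsub => h5 l (hsub hl) l.2 fun s hs s' hs' => hl' s hs s' hs'⟩
          omega
  obtain ⟨S, h1, h2⟩ := key T
  rw [Nat.sub_self, Nat.le_zero, Finset.card_eq_zero] at h2
  have := h1.result h2
  rwa [sweepCmd, Cmd.den, eval_tE h.reads.decomposition]

end

end RAM

/-! #### The value of the dynamic program -/

namespace RAM

section
variable {n : ℕ} {G : SimpleGraph (Fin n)} {K : Finset (Fin n)} {c : Fin n → ℕ}
  {same : Fin n → Fin n → Prop} {T : ℕ} {tree : SimpleGraph (Fin T)} {bag : Fin T → Fin n → Prop}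
  {ω : ℕ → Bool}

open Classical in
/-- The representatives. -/
noncomputable def reps (c : Fin n → ℕ) (same : Fin n → Fin n → Prop) : Finset (Fin n) :=
  {u | IsRep c same u}

open Classical in
/-- The representatives of the parts with terminals. -/
noncomputable def termReps (K : Finset (Fin n)) (c : Fin n → ℕ) (same : Fin n → Fin n → Prop) :
    Finset (Fin n) := {u | IsRep c same u ∧ HasTerm K same u}

theorem mem_reps {u : Fin n} : u ∈ reps c same ↔ IsRep c same u := by simp [reps]

theorem mem_termReps {u : Fin n} : u ∈ termReps K c same ↔ IsRep c same u ∧ HasTerm K same u := by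
  simp [termReps]

theorem mem_repBag {t : Fin T} {u : Fin n} : u ∈ repBag c same bag t ↔ bag t u ∧ IsRep c same u := by
  simp [repBag]

theorem IsFirst.mem {v : Fin n} (h : IsFirst K c same v) : v ∈ termReps K c same := mem_termReps.2 h.1

theorem IsFirst.unique {v w : Fin n} (hv : IsFirst K c same v) (hw : IsFirst K c same w) : v = w := by
  rcases lt_trichotomy v w with h | h | h
  · exact absurd ⟨v, h, hv.1⟩ hw.2
  · exact h
  · exact absurd ⟨w, h, hw.1⟩ hv.2

theorem exists_isFirst (h : (termReps K c same).Nonempty) : ∃ v, IsFirst K c same v := by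
  refine ⟨(termReps K c same).min' h, mem_termReps.1 (Finset.min'_mem _ h), ?_⟩
  rintro ⟨w, hw, hw'⟩
  exact absurd (Finset.min'_le _ w (mem_termReps.2 hw')) (not_le.2 hw)

/-- Every representative and every edge between representatives lies in a bag. -/
structure BagsCover (G : SimpleGraph (Fin n)) (c : Fin n → ℕ) (same : Fin n → Fin n → Prop)
    (bag : Fin T → Fin n → Prop) : Prop where
  vertex : ∀ u, IsRep c same u → ∃ t, bag t u
  edge : ∀ u v, IsRep c same u → IsRep c same v → G.Adj u v → ∃ t, bag t u ∧ bag t v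

theorem prod_vertexFactor {v₁ : Fin n} (hv₁ : IsFirst K c same v₁) {f : Fin n → Fin 3}
    (hf : f ∈ colorings (reps c same)) :
    ∏ v ∈ reps c same, vertexFactor K c same ω v (f v) =
      propBit ((∀ v ∈ termReps K c same, f v ≠ 0) ∧ f v₁ ≠ 2) *
        (4 ^ n) ^ ∑ v ∈ colorSupport f, exponent K c same ω v := by
  classical
  by_cases h : (∀ v ∈ termReps K c same, f v ≠ 0) ∧ f v₁ ≠ 2
  · rw [propBit_of_true h, one_mul, ← Finset.prod_pow_eq_pow_sum]
    have hsub : colorSupport f ⊆ reps c same := fun v hv => by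
      by_contra hv'
      exact mem_colorSupport.1 hv (mem_colorings.1 hf v hv')
    rw [← Finset.prod_subset hsub]
    · refine Finset.prod_congr rfl fun v hv => ?_
      rw [vertexFactor, if_neg (mem_colorSupport.1 hv)]
      split_ifs with h1 h2
      · rfl
      · have h3 : f v ≠ 2 := by rw [h2.unique hv₁]; exact h.2
        have h4 := mem_colorSupport.1 hv
        generalize f v = x at *
        fin_cases x <;> simp_all
      · rfl
    · intro v hv hv'
      have h0 : f v = 0 := by simpa [mem_colorSupport] using hv'
      rw [vertexFactor, if_pos h0]
      exact propBit_of_true fun ht => h.1 v (mem_termReps.2 ⟨mem_reps.1 hv, ht⟩) h0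
  · rw [propBit_of_false h, zero_mul]
    rw [not_and_or, not_not] at h
    rcases h with h | h
    · push Not at h
      obtain ⟨v, hv, h0⟩ := h
      obtain ⟨h1, h2⟩ := mem_termReps.1 hv
      refine Finset.prod_eq_zero (mem_reps.2 h1) ?_
      rw [vertexFactor, if_pos h0]
      exact propBit_of_false (not_not.2 h2)
    · refine Finset.prod_eq_zero (mem_reps.2 hv₁.1.1) ?_
      rw [vertexFactor, h, if_neg (by decide), if_neg (by decide), if_pos hv₁]

/-- Coloured vertices are representatives, and every edge between representatives lies in some bag,
so the tests in the bags detect every forbidden pair. -/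
theorem prod_localFactor (hb : BagsCover G c same bag) {f : Fin n → Fin 3}
    (hf : f ∈ colorings (reps c same)) :
    ∏ t, localFactor G (repBag c same bag t) (restr f (repBag c same bag t)) =
      propBit (∀ u v, G.Adj u v → ¬(f u = 1 ∧ f v = 2)) := by
  by_cases h : ∀ u v, G.Adj u v → ¬(f u = 1 ∧ f v = 2)
  · rw [propBit_of_true h]
    refine Finset.prod_eq_one fun t _ => propBit_of_true ?_
    rintro ⟨u, v, ⟨hu, hv⟩, hadj, h1, h2⟩
    simp only [restr, if_pos hu, if_pos hv] at h1 h2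
    exact h u v hadj ⟨h1, h2⟩
  · rw [propBit_of_false h]
    push Not at h
    obtain ⟨u, v, hadj, h1, h2⟩ := h
    have hrep : ∀ w, f w ≠ 0 → IsRep c same w := fun w hw => by
      by_contra hw'
      exact hw (mem_colorings.1 hf w fun h => hw' (mem_reps.1 h))
    have hu := hrep u (by rw [h1]; decide)
    have hv := hrep v (by rw [h2]; decide)
    obtain ⟨t, ht1, ht2⟩ := hb.edge u v hu hv hadj
    refine Finset.prod_eq_zero (Finset.mem_univ t) (propBit_of_false ?_)
    rw [not_not]
    have hu' := mem_repBag.2 ⟨ht1, hu⟩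
    have hv' := mem_repBag.2 ⟨ht2, hv⟩
    exact ⟨u, v, ⟨hu', hv'⟩, hadj, by simp [restr, hu', h1], by simp [restr, hv', h2]⟩

/-- The generating function of the cuts. -/
noncomputable def cutSum (G : SimpleGraph (Fin n)) (K : Finset (Fin n)) (c : Fin n → ℕ)
    (same : Fin n → Fin n → Prop) (ω : ℕ → Bool) (v₁ : Fin n) : ℕ :=
  ∑ f ∈ cuts G (reps c same) (termReps K c same) v₁,
    (4 ^ n) ^ ∑ v ∈ colorSupport f, exponent K c same ω v

/-- Before the first elimination no messages enter, and the product of the vertex factors and the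
bag tests is the indicator of a cut times its power of the base. -/
theorem remainingSum_univ (A : Type*) [CommSemiring A] (hb : BagsCover G c same bag) {v₁ : Fin n}
    (hv₁ : IsFirst K c same v₁) (m : Fin T → (Fin n → Fin 3) → A) :
    remainingSum G K c same tree bag ω A Finset.univ m = (cutSum G K c same ω v₁ : A) := by
  classical
  have hU : Finset.univ.biUnion (repBag c same bag) = reps c same := by
    ext u
    simp only [Finset.mem_biUnion, Finset.mem_univ, true_and, mem_repBag, mem_reps]
    exact ⟨fun ⟨t, _, h⟩ => h, fun h => let ⟨t, ht⟩ := hb.vertex u h; ⟨t, ht, h⟩⟩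
  have hcuts : cuts G (reps c same) (termReps K c same) v₁ = (colorings (reps c same)).filter fun f =>
      ((∀ v ∈ termReps K c same, f v ≠ 0) ∧ f v₁ ≠ 2) ∧ ∀ u v, G.Adj u v → ¬(f u = 1 ∧ f v = 2) := by
    ext f
    rw [mem_cuts, IsCut, Finset.mem_filter, and_assoc]
  rw [remainingSum, totalSum, hU, cutSum, hcuts, Finset.sum_filter, Nat.cast_sum]
  refine Finset.sum_congr rfl fun f hf => ?_
  have h1 : ∀ t, nodeFactor tree (repBag c same bag)
      (fun t g => (localFactor G (repBag c same bag t) g : A)) Finset.univ m t (restr f (repBag c same bag t)) =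
      (localFactor G (repBag c same bag t) (restr f (repBag c same bag t)) : A) := by
    intro t; simp [nodeFactor]
  rw [Finset.prod_congr rfl fun t _ => h1 t, ← Nat.cast_prod, ← Nat.cast_prod, ← Nat.cast_mul,
    prod_vertexFactor hv₁ hf, prod_localFactor hb hf, mul_right_comm, propBit_and]
  congr 1
  split_ifs with h
  · rw [propBit_of_true h, one_mul]
  · rw [propBit_of_false h, zero_mul]

theorem quotientCost_le (u : Fin n) : quotientCost K c same u ≤ ∑ v, c v := by
  rw [quotientCost]
  split_ifs
  · exact Finset.sum_le_sum_of_subset (Finset.subset_univ _)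
  · exact Finset.single_le_sum (f := c) (fun _ _ => Nat.zero_le _) (Finset.mem_univ u)

theorem sum_coinWeight_lt (X : Finset (Fin n)) :
    ∑ v ∈ X, coinWeight n ω v < n * (2 * n * (2 * n)) + 1 := by
  refine Nat.lt_succ_of_le ((Finset.sum_le_card_nsmul X (fun v => coinWeight n ω v) _
    fun v _ => coinWeight_le n ω v).trans ?_)
  rw [smul_eq_mul]
  exact Nat.mul_le_mul_right _ (by simpa using Finset.card_le_univ X)

theorem sum_exponent (X : Finset (Fin n)) : ∑ v ∈ X, exponent K c same ω v =
    (∑ v ∈ X, quotientCost K c same v) * (n * (2 * n * (2 * n)) + 1) + ∑ v ∈ X, coinWeight n ω v := by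
  simp only [exponent, Finset.sum_add_distrib, Finset.sum_mul]

theorem sum_exponent_div (X : Finset (Fin n)) :
    (∑ v ∈ X, exponent K c same ω v) / (n * (2 * n * (2 * n)) + 1) = ∑ v ∈ X, quotientCost K c same v := by
  rw [sum_exponent, mul_comm, Nat.mul_add_div (by omega), Nat.div_eq_of_lt (sum_coinWeight_lt X), add_zero]

theorem sum_exponent_lt (X : Finset (Fin n)) : ∑ v ∈ X, exponent K c same ω v < expRange c := by
  rw [sum_exponent, expRange, add_mul, one_mul]
  refine add_lt_add_of_le_of_lt (Nat.mul_le_mul_right _ ?_) (sum_coinWeight_lt X)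
  refine (Finset.sum_le_card_nsmul _ _ _ fun v _ => quotientCost_le v).trans ?_
  rw [smul_eq_mul]
  exact Nat.mul_le_mul_right _ (by simpa using Finset.card_le_univ X)

/-- The solutions in the quotient graph with cost at most `b`. -/
def IsQuotientSolution (G : SimpleGraph (Fin n)) (K : Finset (Fin n)) (c : Fin n → ℕ)
    (same : Fin n → Fin n → Prop) (b : ℕ) (X : Finset (Fin n)) : Prop :=
  termReps K c same ⊆ X ∧ X ⊆ reps c same ∧ ConnectedOn G (X : Set (Fin n)) ∧
    ∑ v ∈ X, quotientCost K c same v ≤ b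

theorem card_cuts_lt_four_pow (v₁ : Fin n) :
    (cuts G (reps c same) (termReps K c same) v₁).card < 4 ^ n := by
  have := card_cuts_lt (G := G) (R := reps c same) (K := termReps K c same) (v₁ := v₁)
    (Fintype.card_pos_iff.2 ⟨v₁⟩)
  rwa [Fintype.card_fin] at this

theorem cutSum_lt {v₁ : Fin n} : cutSum G K c same ω v₁ < (4 ^ n) ^ expRange c :=
  sum_pow_lt _ _ (card_cuts_lt_four_pow v₁) fun _ _ => sum_exponent_lt _

theorem cutSum_digit {v₁ : Fin n} (i : ℕ) : cutSum G K c same ω v₁ / (4 ^ n) ^ i % 2 =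
    cutNumber G (reps c same) (termReps K c same) v₁ (exponent K c same ω) i % 2 :=
  sum_pow_digit _ _ (card_cuts_lt_four_pow v₁) (dvd_pow (by norm_num) (by have := v₁.2; omega)) i

theorem exists_quotientSolution {v₁ : Fin n} {i b : ℕ}
    (hi : i / (n * (2 * n * (2 * n)) + 1) ≤ b) (h : cutSum G K c same ω v₁ / (4 ^ n) ^ i % 2 = 1) :
    ∃ X, IsQuotientSolution G K c same b X := by
  rw [cutSum_digit] at h
  obtain ⟨X, h1, h2, h3, rfl⟩ := exists_of_odd_cutNumber (Nat.odd_iff.2 h)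
  exact ⟨X, h1, h2, h3, by rwa [sum_exponent_div] at hi⟩

/-- The digit to look at is the exponent of `X`. The random weight of a set is below the unit, so a
solution with the same exponent has the same cost and the same weight; uniqueness makes it equal to
`X`, and the number of cuts is odd. -/
theorem exists_digit_eq_one {v₁ : Fin n} (hv₁ : IsFirst K c same v₁) {b : ℕ} {X : Finset (Fin n)}
    (hX : IsQuotientSolution G K c same b X)
    (huniq : ∀ Y, IsQuotientSolution G K c same b Y →
      ∑ v ∈ Y, coinWeight n ω v ≤ ∑ v ∈ X, coinWeight n ω v → Y = X) :
    ∃ i : Fin (expRange c), (i : ℕ) / (n * (2 * n * (2 * n)) + 1) ≤ b ∧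
      cutSum G K c same ω v₁ / (4 ^ n) ^ (i : ℕ) % 2 = 1 := by
  refine ⟨⟨∑ v ∈ X, exponent K c same ω v, sum_exponent_lt X⟩, ?_, ?_⟩
  · rw [sum_exponent_div]; exact hX.2.2.2
  · rw [cutSum_digit, ← Nat.odd_iff]
    refine odd_cutNumber hv₁.mem hX.1 hX.2.1 hX.2.2.1 fun Y h1 h2 h3 h4 => ?_
    have h5 : ∑ v ∈ Y, quotientCost K c same v = ∑ v ∈ X, quotientCost K c same v := by
      rw [← sum_exponent_div (ω := ω), h4, sum_exponent_div]
    refine huniq Y ⟨h1, h2, h3, h5 ▸ hX.2.2.2⟩ ?_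
    rw [sum_exponent, sum_exponent, h5] at h4
    omega

end

end RAM

/-! ### The decomposition of a prime node as data for the dynamic program -/

namespace ModularDecomposition

/-- A module of `G[M]` is a module of `G` because `M` is one, and `N` does not overlap it. -/
theorem IsStrongModule.preimage {V : Type*} {G : SimpleGraph V} {M N : Set V} (hM : IsStrongModule G M)
    (hN : IsStrongModule G N) : IsStrongModule (G.induce M) (Subtype.val ⁻¹' N) := by
  refine ⟨isModule_iff.2 fun v hv w hw x hx hvx => isModule_iff.1 hN.1 v hv w hw x hx hvx, fun L hL => ?_⟩
  have hL' : IsModule G (Subtype.val '' L) := by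
    rw [isModule_iff] at hL ⊢
    rintro _ ⟨v, hv, rfl⟩ _ ⟨w, hw, rfl⟩ x hx hvx
    by_cases hxM : x ∈ M
    · exact hL v hv w hw ⟨x, hxM⟩ (fun h => hx ⟨_, h, rfl⟩) hvx
    · exact isModule_iff.1 hM.1 v v.2 w w.2 x hxM hvx
  rcases hN.2 _ hL' with h | h | h
  · left
    ext x
    simp only [Set.mem_inter_iff, Set.mem_preimage, Set.mem_empty_iff_false, iff_false, not_and]
    intro h1 h2
    have : (x : V) ∈ N ∩ Subtype.val '' L := ⟨h1, x, h2, rfl⟩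
    rw [h] at this
    exact this
  · right; left
    intro x hx
    obtain ⟨y, hy, hxy⟩ := h hx
    rwa [← Subtype.ext hxy]
  · right; right
    exact fun x hx => h ⟨x, hx, rfl⟩

theorem exists_part_superset {V : Type*} [Finite V] {G : SimpleGraph V} {M N : Set V}
    (hM : IsStrongModule G M) (hN : IsStrongModule G N) (h0 : N.Nonempty) (h1 : N ⊂ M) :
    ∃ P ∈ canonicalPartition (G.induce M), N ⊆ Subtype.val '' P := by
  obtain ⟨P, hP, h⟩ := exists_mem_canonicalPartition_superset (hM.preimage hN)
    (let ⟨x, hx⟩ := h0; ⟨⟨x, h1.1 hx⟩, hx⟩)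
    (fun h => h1.2 fun x hx => (h ▸ Set.mem_univ (⟨x, hx⟩ : M) : (⟨x, hx⟩ : M) ∈ Subtype.val ⁻¹' N))
  exact ⟨P, hP, fun x hx => ⟨⟨x, h1.1 hx⟩, h hx, rfl⟩⟩

end ModularDecomposition

namespace PrimeNodeDecomposition
open ModularDecomposition

variable {n : ℕ} {G : SimpleGraph (Fin n)} (D : PrimeNodeDecomposition G)

def Same (u v : Fin n) : Prop :=
  ∃ N ∈ canonicalPartition (G.induce D.node), u ∈ Subtype.val '' N ∧ v ∈ Subtype.val '' N

def InBag (t : Fin D.decomposition.size) (v : Fin n) : Prop :=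
  ∃ N ∈ D.decomposition.bag t, v ∈ Subtype.val '' (N : Set D.node)

/-- The terminals lie in the node, but not in one part. -/
def IsRelevant (K : Finset (Fin n)) : Prop :=
  (∀ u ∈ K, D.Same u u) ∧ ∃ u ∈ K, ∃ w ∈ K, ¬ D.Same u w

variable {D}

theorem part_eq {M : Set (Fin n)} {N N' : Set M} (hN : N ∈ canonicalPartition (G.induce M))
    (hN' : N' ∈ canonicalPartition (G.induce M)) {u : Fin n} (h : u ∈ Subtype.val '' N)
    (h' : u ∈ Subtype.val '' N') : N = N' := by
  obtain ⟨x, hx, rfl⟩ := h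
  obtain ⟨y, hy, hxy⟩ := h'
  rw [Subtype.ext hxy] at hy
  exact eq_of_mem_canonicalPartition hN hN' hx hy

theorem Same.symm {u v : Fin n} (h : D.Same u v) : D.Same v u := let ⟨N, h1, h2, h3⟩ := h; ⟨N, h1, h3, h2⟩

theorem Same.trans {u v w : Fin n} (h : D.Same u v) (h' : D.Same v w) : D.Same u w := by
  obtain ⟨N, h1, h2, h3⟩ := h
  obtain ⟨N', h1', h2', h3'⟩ := h'
  obtain rfl := part_eq h1 h1' h3 h2'
  exact ⟨N, h1, h2, h3'⟩

theorem Same.mem {u v : Fin n} (h : D.Same u v) : u ∈ D.node := by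
  obtain ⟨N, h1, ⟨x, hx, rfl⟩, h3⟩ := h
  exact x.2

theorem exists_part {u : Fin n} (hu : u ∈ D.node) :
    ∃ N ∈ canonicalPartition (G.induce D.node), u ∈ Subtype.val '' N := by
  have : Nontrivial D.node := Set.nontrivial_coe_sort.2 D.isPrimeNode.2.1
  obtain ⟨N, h1, h2⟩ := exists_mem_canonicalPartition (G := G.induce D.node) ⟨u, hu⟩
  exact ⟨N, h1, _, h2, rfl⟩

theorem same_self {u : Fin n} : D.Same u u ↔ u ∈ D.node :=
  ⟨Same.mem, fun h => let ⟨N, h1, h2⟩ := exists_part h; ⟨N, h1, h2, h2⟩⟩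

theorem isRepMap_adj {u u' v v' : Fin n} (hu : D.Same u u') (hv : D.Same v v') (huv : ¬D.Same u v)
    (h : G.Adj u v) : G.Adj u' v' := by
  obtain ⟨P, hP, ⟨x, hx, rfl⟩, ⟨x', hx', rfl⟩⟩ := hu
  obtain ⟨Q, hQ, ⟨y, hy, rfl⟩, ⟨y', hy', rfl⟩⟩ := hv
  refine adj_of_parts (G := G.induce D.node) hP.1.1.1 hQ.1.1.1 (fun z hz hz' => huv ?_) hx hx' hy hy' h
  rw [eq_of_mem_canonicalPartition hQ hP hz' hz] at hy
  exact ⟨P, hP, ⟨x, hx, rfl⟩, y, hy, rfl⟩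

/-- Every part has a representative. -/
theorem exists_rep (c : Fin n → ℕ) {u : Fin n} (hu : u ∈ D.node) :
    ∃ v, RAM.IsRep c D.Same v ∧ D.Same u v := by
  classical
  obtain ⟨v, hv, hmin⟩ := (Finset.univ.filter fun v => D.Same u v).exists_min_image
    (fun v => c v * n + v) ⟨u, by simpa using same_self.2 hu⟩
  simp only [Finset.mem_filter, Finset.mem_univ, true_and] at hv hmin
  refine ⟨v, ⟨hv.symm.trans hv, ?_⟩, hv⟩
  rintro ⟨w, hw, hlt⟩
  exact absurd (hmin w (hv.trans hw.symm)) (not_le.2 hlt)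

theorem rep_unique {c : Fin n → ℕ} {u v : Fin n} (hu : RAM.IsRep c D.Same u) (hv : RAM.IsRep c D.Same v)
    (h : D.Same u v) : u = v := by
  have h1 : c v * n + v ≤ c u * n + u := not_lt.1 fun hlt => hv.2 ⟨u, h, hlt⟩
  have h2 : c u * n + u ≤ c v * n + v := not_lt.1 fun hlt => hu.2 ⟨v, h.symm, hlt⟩
  have h3 := congrArg (· % n) (h1.antisymm h2)
  simp only [Nat.mul_add_mod_self_right, Nat.mod_eq_of_lt u.2, Nat.mod_eq_of_lt v.2] at h3
  exact Fin.ext h3.symm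

open Classical in
/-- The representative of the part of `u`. -/
noncomputable def rep (D : PrimeNodeDecomposition G) (c : Fin n → ℕ) (u : Fin n) : Fin n :=
  if h : u ∈ D.node then (exists_rep c h).choose else u

theorem isRep_rep (c : Fin n → ℕ) {u : Fin n} (h : u ∈ D.node) : RAM.IsRep c D.Same (D.rep c u) := by
  rw [rep, dif_pos h]; exact (exists_rep c h).choose_spec.1

theorem same_rep (c : Fin n → ℕ) {u : Fin n} (h : u ∈ D.node) : D.Same u (D.rep c u) := by
  rw [rep, dif_pos h]; exact (exists_rep c h).choose_spec.2

theorem rep_eq {c : Fin n → ℕ} {u v : Fin n} (h : D.Same u v) (hv : RAM.IsRep c D.Same v) : D.rep c u = v :=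
  rep_unique (isRep_rep c h.mem) hv ((same_rep c h.mem).symm.trans h)

theorem rep_eq_iff {c : Fin n → ℕ} {u v : Fin n} (hu : u ∈ D.node) (hv : v ∈ D.node) :
    D.rep c u = D.rep c v ↔ D.Same u v :=
  ⟨fun h => (same_rep c hu).trans (h ▸ (same_rep c hv).symm),
    fun h => rep_eq (h.trans (same_rep c hv)) (isRep_rep c hv)⟩

theorem isRep_iff {c : Fin n → ℕ} {u : Fin n} : RAM.IsRep c D.Same u ↔ u ∈ D.node ∧ D.rep c u = u :=
  ⟨fun h => ⟨h.1.mem, rep_eq h.1 h⟩, fun h => h.2 ▸ isRep_rep c h.1⟩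

theorem cost_rep_le (c : Fin n → ℕ) {u : Fin n} (h : u ∈ D.node) : c (D.rep c u) ≤ c u := by
  by_contra! hlt
  refine (isRep_rep c h).2 ⟨u, same_rep c h, ?_⟩
  have := Nat.mul_le_mul_right n hlt
  rw [Nat.succ_mul] at this
  have := u.2
  omega

theorem isRepMap_rep (c : Fin n → ℕ) : IsRepMap G D.node (D.rep c) where
  mem v hv := (same_rep c hv).symm.mem
  idem v hv := rep_eq (isRep_rep c hv).1 (isRep_rep c hv)
  adj u hu u' hu' v hv v' hv' h1 h2 h3 h :=
    isRepMap_adj ((rep_eq_iff hu hu').1 h1) ((rep_eq_iff hv hv').1 h2) (fun hs => h3 ((rep_eq_iff hu hv).2 hs)) h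

theorem hasTerm_iff {c : Fin n → ℕ} {K : Finset (Fin n)} {u : Fin n}
    (hu : RAM.IsRep c D.Same u) (hK : ∀ u ∈ K, u ∈ D.node) : RAM.HasTerm K D.Same u ↔ u ∈ K.image (D.rep c) := by
  rw [Finset.mem_image]
  exact ⟨fun ⟨w, hw, hs⟩ => ⟨w, hw, rep_eq hs hu⟩, fun ⟨w, hw, hs⟩ => ⟨w, hw, hs ▸ same_rep c (hK w hw)⟩⟩

theorem termReps_eq {c : Fin n → ℕ} {K : Finset (Fin n)} (hK : ∀ u ∈ K, u ∈ D.node) :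
    RAM.termReps K c D.Same = K.image (D.rep c) := by
  ext u
  rw [RAM.mem_termReps]
  constructor
  · rintro ⟨h1, h2⟩; exact (hasTerm_iff h1 hK).1 h2
  · intro h
    obtain ⟨w, hw, rfl⟩ := Finset.mem_image.1 h
    exact ⟨isRep_rep c (hK w hw), (hasTerm_iff (isRep_rep c (hK w hw)) hK).2 h⟩

theorem quotientCost_eq {c : Fin n → ℕ} {K : Finset (Fin n)} (hK : ∀ u ∈ K, u ∈ D.node) {u : Fin n}
    (hu : RAM.IsRep c D.Same u) : RAM.quotientCost K c D.Same u = partCost (D.rep c) K c u := by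
  rw [RAM.quotientCost, partCost]
  simp only [hasTerm_iff hu hK]
  refine if_congr Iff.rfl (Finset.sum_congr ?_ fun _ _ => rfl) rfl
  ext w
  simp only [Finset.mem_filter, Finset.mem_univ, true_and, and_congr_right_iff]
  exact fun hw => ⟨fun hs => rep_eq hs hu, fun hs => hs ▸ same_rep c (hK w hw)⟩

theorem exists_solution_of_quotient {c : Fin n → ℕ} {K : Finset (Fin n)} {b : ℕ} (hD : D.IsRelevant K)
    {X : Finset (Fin n)} (hX : RAM.IsQuotientSolution G K c D.Same b X) :
    ∃ Y : Finset (Fin n), K ⊆ Y ∧ ConnectedOn G (Y : Set (Fin n)) ∧ ∑ v ∈ Y, c v ≤ b := by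
  have hK : ∀ u ∈ K, u ∈ D.node := fun u hu => same_self.1 (hD.1 u hu)
  obtain ⟨k₁, hk₁, k₂, hk₂, hne⟩ := hD.2
  have hrep : ∀ v ∈ X, RAM.IsRep c D.Same v := fun v hv => RAM.mem_reps.1 (hX.2.1 hv)
  obtain ⟨Y, h1, h2, h3⟩ := lift_solution (c := c) (isRepMap_rep (D := D) c) (X := X) (K := K) hK hk₁ hk₂
    (fun h => hne ((rep_eq_iff (hK _ hk₁) (hK _ hk₂)).1 h))
    (fun v hv => isRep_iff.1 (hrep v hv)) (termReps_eq hK ▸ hX.1) hX.2.2.1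
  refine ⟨Y, h1, h2, ?_⟩
  rw [h3, ← Finset.sum_congr rfl fun v hv => quotientCost_eq hK (hrep v hv)]
  exact hX.2.2.2

theorem exists_quotient_of_solution {c : Fin n → ℕ} {K : Finset (Fin n)} {b : ℕ} {Y : Finset (Fin n)}
    (hYM : ↑Y ⊆ D.node) (hKY : K ⊆ Y) (hY : ConnectedOn G (Y : Set (Fin n))) (hb : ∑ v ∈ Y, c v ≤ b) :
    ∃ X, RAM.IsQuotientSolution G K c D.Same b X := by
  have hK : ∀ u ∈ K, u ∈ D.node := fun u hu => hYM (hKY hu)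
  obtain ⟨h1, h2, h3, h4⟩ := project_solution (isRepMap_rep (D := D) c) (c := c)
    (fun v hv => cost_rep_le c hv) hYM hKY hY
  have hrep : ∀ v ∈ Y.image (D.rep c), RAM.IsRep c D.Same v := fun v hv => isRep_iff.2 (h1 v hv)
  refine ⟨_, termReps_eq hK ▸ h2, fun v hv => RAM.mem_reps.2 (hrep v hv), by simpa using h3, ?_⟩
  rw [Finset.sum_congr rfl fun v hv => quotientCost_eq hK (hrep v hv)]
  exact h4.trans hb

theorem isRelevant_of_prime {K : Finset (Fin n)} (hK : ↑K ⊆ D.node)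
    (h : ∀ N ∈ canonicalPartition (G.induce D.node), ¬ ↑K ⊆ Subtype.val '' N) : D.IsRelevant K := by
  refine ⟨fun u hu => same_self.2 (hK hu), ?_⟩
  by_contra! hcon
  rcases K.eq_empty_or_nonempty with rfl | ⟨k, hk⟩
  · obtain ⟨x, hx⟩ := D.isPrimeNode.1.2
    obtain ⟨N, h1, -⟩ := exists_part hx
    exact h N h1 (by simp)
  · obtain ⟨N, h1, h2⟩ := exists_part (hK hk)
    refine h N h1 fun w hw => ?_
    obtain ⟨N', h1', h2', h3'⟩ := hcon k hk w hw
    rwa [part_eq h1 h1' h2 h2']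

/-- Strong modules that share a terminal are nested. If one node were strictly smaller, it would lie
inside one part of the other, and so would all terminals. Hence it does not matter which relevant
decomposition the scan selects. -/
theorem node_eq_of_isRelevant {D' : PrimeNodeDecomposition G} {K : Finset (Fin n)} (hD : D.IsRelevant K)
    (hD' : D'.IsRelevant K) : D.node = D'.node := by
  have key : ∀ {D D' : PrimeNodeDecomposition G}, D.IsRelevant K → D'.IsRelevant K → ¬ D.node ⊂ D'.node := by
    intro D D' h h' hss
    obtain ⟨P, hP, hsub⟩ := exists_part_superset D'.isPrimeNode.1.1 D.isPrimeNode.1.1 D.isPrimeNode.1.2 hss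
    obtain ⟨u, hu, w, hw, hne⟩ := h'.2
    exact hne ⟨P, hP, hsub (h.1 u hu).mem, hsub (h.1 w hw).mem⟩
  obtain ⟨u, hu, -⟩ := hD.2
  rcases D.isPrimeNode.1.1.2 _ D'.isPrimeNode.1.1.1 with h | h | h
  · have : u ∈ D.node ∩ D'.node := ⟨(hD.1 u hu).mem, (hD'.1 u hu).mem⟩
    rw [h] at this
    exact this.elim
  · by_contra hne
    exact key hD hD' (h.ssubset_of_ne hne)
  · by_contra hne
    exact key hD' hD (h.ssubset_of_ne (Ne.symm hne))

theorem bagsCover (c : Fin n → ℕ) : RAM.BagsCover G c D.Same D.InBag := by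
  constructor
  · intro u hu
    obtain ⟨N, hN, hu'⟩ := exists_part hu.1.mem
    obtain ⟨t, ht⟩ := D.decomposition.exists_mem_bag ⟨N, hN⟩
    exact ⟨t, ⟨N, hN⟩, ht, hu'⟩
  · intro u v hu hv huv
    obtain ⟨N, hN, hu'⟩ := exists_part hu.1.mem
    obtain ⟨N', hN', hv'⟩ := exists_part hv.1.mem
    have hne : N ≠ N' := by
      rintro rfl
      exact huv.ne (rep_unique hu hv ⟨N, hN, hu', hv'⟩)
    obtain ⟨x, hx, rfl⟩ := hu'
    obtain ⟨y, hy, rfl⟩ := hv'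
    obtain ⟨t, ht1, ht2⟩ := D.decomposition.exists_edge_bag ⟨N, hN⟩ ⟨N', hN'⟩
      ⟨fun h => hne (congrArg Subtype.val h), x, hx, y, hy, huv⟩
    exact ⟨t, ⟨⟨N, hN⟩, ht1, x, hx, rfl⟩, ⟨N', hN'⟩, ht2, y, hy, rfl⟩

/-- For a representative these are the nodes whose bags contain its part; for any other vertex there
are none. -/
theorem connectedOn_bags (c : Fin n → ℕ) (v : Fin n) :
    ConnectedOn D.decomposition.tree {t | t ∈ Finset.univ ∧ v ∈ RAM.repBag c D.Same D.InBag t} := by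
  by_cases hv : RAM.IsRep c D.Same v
  · obtain ⟨N, hN, hv'⟩ := exists_part hv.1.mem
    have : {t | t ∈ Finset.univ ∧ v ∈ RAM.repBag c D.Same D.InBag t} =
        {t | (⟨N, hN⟩ : canonicalPartition (G.induce D.node)) ∈ D.decomposition.bag t} := by
      ext t
      simp only [Finset.mem_univ, true_and, RAM.mem_repBag, Set.mem_ofPred_eq, hv, and_true]
      constructor
      · rintro ⟨N', h1, h2⟩
        rwa [show (⟨N, hN⟩ : canonicalPartition (G.induce D.node)) = N' from
          Subtype.ext (part_eq hN N'.2 hv' h2)]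
      · exact fun h => ⟨_, h, hv'⟩
    rw [this]
    exact induce_preconnected_iff.1 (D.decomposition.connected ⟨N, hN⟩).preconnected
  · intro C hC ⟨t, ht⟩
    exact absurd (RAM.mem_repBag.1 (hC ht).2).2 hv

theorem connectedOn_tree : ConnectedOn D.decomposition.tree
    ((Finset.univ : Finset (Fin D.decomposition.size)) : Set (Fin D.decomposition.size)) := by
  rw [Finset.coe_univ, ← induce_preconnected_iff]
  exact (SimpleGraph.induceUnivIso D.decomposition.tree).preconnected_iff.2 D.decomposition.isTree.1.preconnected

/-- Different representatives lie in different parts, so they inject into the bag of the quotient.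
-/
theorem card_repBag_le (c : Fin n → ℕ) {k : ℕ} (hk : D.decomposition.width ≤ k)
    (t : Fin D.decomposition.size) : (RAM.repBag c D.Same D.InBag t).card ≤ k + 1 := by
  have h1 : (D.decomposition.bag t).ncard ≤ k + 1 := by
    have := Finset.le_sup (f := fun t => (D.decomposition.bag t).ncard) (Finset.mem_univ t)
    unfold TreeDecomposition.width at hk
    omega
  refine le_trans ?_ h1
  have hfin : (D.decomposition.bag t).Finite := Set.toFinite _
  have hch : ∀ u ∈ RAM.repBag c D.Same D.InBag t, ∃ N ∈ D.decomposition.bag t, u ∈ Subtype.val '' (N : Set D.node) :=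
    fun u hu => (RAM.mem_repBag.1 hu).1
  rcases (RAM.repBag c D.Same D.InBag t).eq_empty_or_nonempty with h0 | ⟨u₀, hu₀⟩
  · simp [h0]
  have : Nonempty (canonicalPartition (G.induce D.node)) := ⟨(hch u₀ hu₀).choose⟩
  choose! f hf1 hf2 using hch
  rw [← Set.ncard_coe_finset]
  refine Set.ncard_le_ncard_of_injOn f (fun u hu => hf1 u hu) (fun u hu v hv huv => ?_) hfin
  exact rep_unique (RAM.mem_repBag.1 hu).2 (RAM.mem_repBag.1 hv).2
    ⟨f u, (f u).2, hf2 u hu, huv ▸ hf2 v hv⟩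

end PrimeNodeDecomposition

/-! ### The layout of the input -/

/-- The list `l` occurs in `x` at position `p`. -/
def OccursAt (x : List ℕ) (p : ℕ) (l : List ℕ) : Prop :=
  ∃ pre post, x = pre ++ (l ++ post) ∧ pre.length = p

namespace OccursAt
variable {x l l₁ l₂ : List ℕ} {p : ℕ}

theorem left (h : OccursAt x p (l₁ ++ l₂)) : OccursAt x p l₁ := by
  obtain ⟨pre, post, rfl, rfl⟩ := h
  exact ⟨pre, l₂ ++ post, by simp, rfl⟩

theorem right (h : OccursAt x p (l₁ ++ l₂)) : OccursAt x (p + l₁.length) l₂ := by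
  obtain ⟨pre, post, rfl, rfl⟩ := h
  exact ⟨pre ++ l₁, post, by simp, by simp⟩

theorem getD (h : OccursAt x p l) {i : ℕ} (hi : i < l.length) : x.getD (p + i) 0 = l.getD i 0 := by
  obtain ⟨pre, post, rfl, rfl⟩ := h
  rw [List.getD_append_right _ _ _ _ (by omega), Nat.add_sub_cancel_left, List.getD_append _ _ _ _ hi]

theorem le_length (h : OccursAt x p l) : p + l.length ≤ x.length := by
  obtain ⟨pre, post, rfl, rfl⟩ := h
  simp

theorem subset (h : OccursAt x p l) {y : ℕ} (hy : y ∈ l) : y ∈ x := by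
  obtain ⟨pre, post, rfl, rfl⟩ := h
  simp [hy]

end OccursAt

theorem length_flatMap_const {α : Type*} (L : List α) (f : α → List ℕ) {b : ℕ}
    (hb : ∀ a, (f a).length = b) : (L.flatMap f).length = L.length * b := by
  induction L with
  | nil => simp
  | cons a L ih => rw [List.flatMap_cons, List.length_append, ih, hb, List.length_cons]; ring

theorem getD_flatMap_const {α : Type*} (L : List α) (f : α → List ℕ) {b : ℕ}
    (hb : ∀ a, (f a).length = b) {i j : ℕ} (hi : i < L.length) (hj : j < b) :
    (L.flatMap f).getD (i * b + j) 0 = (f L[i]).getD j 0 := by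
  induction L generalizing i with
  | nil => simp at hi
  | cons a L ih =>
    rw [List.flatMap_cons]
    cases i with
    | zero => rw [List.getD_append _ _ _ _ (by rw [hb]; omega)]; simp
    | succ i =>
      rw [List.getD_append_right _ _ _ _ (by rw [hb, Nat.succ_mul]; omega), hb,
        show (i + 1) * b + j - b = i * b + j by rw [Nat.succ_mul]; omega, ih (by simpa using hi)]
      simp

theorem length_matrixBits {a b : ℕ} (R : Fin a → Fin b → Prop) : (matrixBits R).length = a * b := by
  rw [matrixBits, length_flatMap_const (b := b)] <;> simp

theorem getD_matrixBits {a b : ℕ} (R : Fin a → Fin b → Prop) (i : Fin a) (j : Fin b) :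
    (matrixBits R).getD (i * b + j) 0 = propBit (R i j) := by
  rw [matrixBits, getD_flatMap_const (b := b) _ _ (by simp) (by simp) j.2]
  simp [List.getD_eq_getElem?_getD]

theorem getD_map_finRange {a : ℕ} (f : Fin a → ℕ) (i : Fin a) :
    ((List.finRange a).map f).getD i 0 = f i := by
  simp [List.getD_eq_getElem?_getD]

theorem mul_add_lt {a b : ℕ} (i : Fin a) (j : Fin b) : (i : ℕ) * b + j < a * b := by
  have h : ((i : ℕ) + 1) * b ≤ a * b := Nat.mul_le_mul_right _ i.2
  rw [Nat.succ_mul] at h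
  have := j.2
  omega

theorem OccursAt.matrix {x : List ℕ} {p a b : ℕ} {R : Fin a → Fin b → Prop} (h : OccursAt x p (matrixBits R))
    (i : Fin a) (j : Fin b) : x.getD (p + i * b + j) 0 = propBit (R i j) := by
  rw [add_assoc, h.getD (by rw [length_matrixBits]; exact mul_add_lt i j), getD_matrixBits]

theorem propBit_le (p : Prop) : propBit p ≤ 1 := by by_cases h : p <;> simp [propBit, h]

theorem le_of_mem_matrixBits {a b : ℕ} {R : Fin a → Fin b → Prop} {y : ℕ} (h : y ∈ matrixBits R) :
    y ≤ 1 := by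
  simp only [matrixBits, List.mem_flatMap, List.mem_map] at h
  obtain ⟨i, -, j, -, rfl⟩ := h
  exact propBit_le _

theorem length_le_inputSize (x : List ℕ) : x.length ≤ RAM.inputSize x := by
  induction x with
  | nil => simp [RAM.inputSize]
  | cons a x ih =>
    simp only [RAM.inputSize, List.map_cons, List.sum_cons, List.length_cons] at ih ⊢
    have : 1 ≤ RAM.len a := by unfold RAM.len; omega
    omega

theorem len_le_inputSize {x : List ℕ} {y : ℕ} (h : y ∈ x) : RAM.len y ≤ RAM.inputSize x :=
  List.single_le_sum (by simp) _ (List.mem_map_of_mem h)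

/-! ### The encoding of one decomposition -/

namespace PrimeNodeDecomposition
variable {n : ℕ} {G : SimpleGraph (Fin n)} (D : PrimeNodeDecomposition G)

theorem encode_eq : D.encode = matrixBits D.Same ++ ([D.decomposition.size] ++
    (matrixBits D.decomposition.tree.Adj ++ matrixBits D.InBag)) := by
  simp only [encode, List.append_assoc]
  rfl

theorem length_encode : D.encode.length =
    n * n + 1 + D.decomposition.size * D.decomposition.size + D.decomposition.size * n := by
  rw [encode_eq]
  simp only [List.length_append, length_matrixBits, List.length_singleton]
  ring

/-- The only entry that is not a bit is the number of tree nodes, and the encoding also contains the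
adjacency matrix, which has its square as length. -/
theorem le_of_mem_encode {y : ℕ} (h : y ∈ D.encode) : y ≤ max 1 D.encode.length := by
  rw [encode_eq] at h
  simp only [List.mem_append, List.mem_singleton] at h
  rcases h with h | rfl | h | h
  · exact (le_of_mem_matrixBits h).trans (le_max_left _ _)
  · refine le_max_of_le_right ?_
    rw [length_encode]
    have := Nat.le_mul_self D.decomposition.size
    omega
  · exact (le_of_mem_matrixBits h).trans (le_max_left _ _)
  · exact (le_of_mem_matrixBits h).trans (le_max_left _ _)

variable {D} {x : List ℕ} {p : ℕ}

theorem getD_same (h : OccursAt x p D.encode) (u v : Fin n) :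
    x.getD (p + u * n + v) 0 = propBit (D.Same u v) := by
  rw [encode_eq] at h; exact h.left.matrix u v

theorem getD_size (h : OccursAt x p D.encode) : x.getD (p + n * n) 0 = D.decomposition.size := by
  rw [encode_eq] at h
  have := h.right.left.getD (i := 0) (by simp)
  simpa [length_matrixBits] using this

theorem getD_tree (h : OccursAt x p D.encode) (s t : Fin D.decomposition.size) :
    x.getD (p + n * n + 1 + s * D.decomposition.size + t) 0 = propBit (D.decomposition.tree.Adj s t) := by
  rw [encode_eq] at h
  have := h.right.right.left.matrix s t
  simpa [length_matrixBits] using this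

theorem getD_bag (h : OccursAt x p D.encode) (t : Fin D.decomposition.size) (v : Fin n) :
    x.getD (p + n * n + 1 + D.decomposition.size * D.decomposition.size + t * n + v) 0 =
      propBit (D.InBag t v) := by
  rw [encode_eq] at h
  have := h.right.right.right.matrix t v
  simpa [length_matrixBits] using this

end PrimeNodeDecomposition

/-! ### The encoding of the whole input -/

namespace SteinerInput
variable (I : SteinerInput)

/-- The part of the input before the budget. -/
noncomputable def prefixList : List ℕ :=
  [I.n] ++ (matrixBits I.graph.Adj ++ ((List.finRange I.n).map (fun v => propBit (v ∈ I.terminals)) ++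
    ((List.finRange I.n).map I.cost ++ [propBit (I.budget < 0)])))

noncomputable def suffixList : List ℕ :=
  [I.decompositions.length] ++ I.decompositions.flatMap PrimeNodeDecomposition.encode

theorem encode_eq : I.encode = I.prefixList ++ ([I.budget.natAbs] ++ I.suffixList) := by
  simp [encode, prefixList, suffixList]

/-- The position of the sign of the budget. -/
def signPos (n : ℕ) : ℕ := 1 + n * n + n + n

theorem length_prefixList : I.prefixList.length = signPos I.n + 1 := by
  simp only [prefixList, List.length_append, length_matrixBits, List.length_map, List.length_finRange,
    List.length_singleton, signPos]
  ring

theorem occursAt_encode : OccursAt I.encode 0 (I.prefixList ++ ([I.budget.natAbs] ++ I.suffixList)) :=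
  ⟨[], [], by simp [encode_eq], rfl⟩

theorem getD_n : I.encode.getD 0 0 = I.n := by
  simpa using I.occursAt_encode.left.left.getD (i := 0) (by simp)

theorem getD_adj (u v : Fin I.n) : I.encode.getD (1 + u * I.n + v) 0 = propBit (I.graph.Adj u v) := by
  simpa using I.occursAt_encode.left.right.left.matrix u v

theorem getD_term (u : Fin I.n) : I.encode.getD (1 + I.n * I.n + u) 0 = propBit (u ∈ I.terminals) := by
  have := I.occursAt_encode.left.right.right.left.getD (i := u) (by simp)
  rw [getD_map_finRange] at this
  simpa [length_matrixBits] using this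

theorem getD_cost (u : Fin I.n) : I.encode.getD (1 + I.n * I.n + I.n + u) 0 = I.cost u := by
  have := I.occursAt_encode.left.right.right.right.left.getD (i := u) (by simp)
  rw [getD_map_finRange] at this
  simpa [length_matrixBits] using this

theorem getD_sign : I.encode.getD (signPos I.n) 0 = propBit (I.budget < 0) := by
  have := I.occursAt_encode.left.right.right.right.right.getD (i := 0) (by simp)
  simpa [length_matrixBits, signPos] using this

theorem getD_budget : I.encode.getD (signPos I.n + 1) 0 = I.budget.natAbs := by
  have := I.occursAt_encode.right.left.getD (i := 0) (by simp)
  simpa [length_prefixList] using this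

theorem occursAt_suffixList : OccursAt I.encode (signPos I.n + 2) I.suffixList := by
  simpa [length_prefixList] using I.occursAt_encode.right.right

theorem getD_count : I.encode.getD (signPos I.n + 2) 0 = I.decompositions.length := by
  simpa using I.occursAt_suffixList.left.getD (i := 0) (by simp)

theorem occursAt_decompositions : OccursAt I.encode (signPos I.n + 3)
    (I.decompositions.flatMap PrimeNodeDecomposition.encode) := by
  simpa using I.occursAt_suffixList.right

/-- The position of the decomposition with number `i`. -/
noncomputable def decompositionPos (i : ℕ) : ℕ :=
  signPos I.n + 3 + ((I.decompositions.take i).flatMap PrimeNodeDecomposition.encode).length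

theorem occursAt_decomposition {i : ℕ} (hi : i < I.decompositions.length) :
    OccursAt I.encode (I.decompositionPos i) I.decompositions[i].encode := by
  have h := I.occursAt_decompositions
  rw [← List.take_append_drop i I.decompositions, List.flatMap_append,
    List.drop_eq_getElem_cons hi, List.flatMap_cons] at h
  exact h.right.left

theorem decompositionPos_zero : I.decompositionPos 0 = signPos I.n + 3 := by simp [decompositionPos]

theorem decompositionPos_succ {i : ℕ} (hi : i < I.decompositions.length) :
    I.decompositionPos (i + 1) = I.decompositionPos i + I.decompositions[i].encode.length := by
  rw [decompositionPos, decompositionPos, List.take_succ_eq_append_getElem hi, List.flatMap_append]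
  simp [add_assoc]

theorem decompositionPos_le (i : ℕ) : I.decompositionPos i ≤ I.encode.length := by
  have h := I.occursAt_decompositions
  rw [← List.take_append_drop i I.decompositions, List.flatMap_append] at h
  exact h.left.le_length

theorem le_decompositionPos (i : ℕ) : signPos I.n + 3 ≤ I.decompositionPos i := by
  unfold decompositionPos; omega

theorem n_le_length : I.n ≤ I.encode.length := by
  have := I.occursAt_encode.left.le_length
  rw [length_prefixList, signPos] at this
  omega

theorem length_decompositions_le : I.decompositions.length ≤ I.encode.length := by
  have key : ∀ L : List (PrimeNodeDecomposition I.graph),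
      L.length ≤ (L.flatMap PrimeNodeDecomposition.encode).length := by
    intro L
    induction L with
    | nil => simp
    | cons D L ih =>
      rw [List.flatMap_cons, List.length_append, List.length_cons, D.length_encode]
      omega
  exact (key _).trans (by have := I.occursAt_decompositions.le_length; omega)

/-- The excluded position is that of the budget. All other entries are bits, lengths or costs. -/
theorem getD_le {S : ℕ} (hS : I.encode.length ≤ S) (hc : ∀ v, I.cost v ≤ S) {i : ℕ}
    (hi : i ≠ signPos I.n + 1) : I.encode.getD i 0 ≤ S := by
  have h1S : 1 ≤ S := by
    refine le_trans ?_ hS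
    have := I.occursAt_encode.left.le_length
    rw [length_prefixList] at this
    omega
  have getD_le_of : ∀ (l : List ℕ), (∀ y ∈ l, y ≤ S) → ∀ j, l.getD j 0 ≤ S := by
    intro l hl j
    rw [List.getD_eq_getElem?_getD]
    rcases h : l[j]? with _ | y
    · simp
    · exact hl y (List.mem_of_getElem? h)
  rw [encode_eq]
  rcases Nat.lt_or_gt_of_ne hi with h | h
  · rw [List.getD_append _ _ _ _ (by rw [length_prefixList]; omega)]
    refine getD_le_of _ (fun y hy => ?_) _
    simp only [prefixList, List.mem_append, List.mem_singleton, List.mem_map] at hy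
    rcases hy with rfl | hy | ⟨v, -, rfl⟩ | ⟨v, -, rfl⟩ | rfl
    · exact I.n_le_length.trans hS
    · exact (le_of_mem_matrixBits hy).trans h1S
    · exact (propBit_le _).trans h1S
    · exact hc v
    · exact (propBit_le _).trans h1S
  · rw [List.getD_append_right _ _ _ _ (by rw [length_prefixList]; omega),
      List.getD_append_right _ _ _ _ (by rw [length_prefixList, List.length_singleton]; omega)]
    refine getD_le_of _ (fun y hy => ?_) _
    simp only [suffixList, List.mem_append, List.mem_singleton, List.mem_flatMap] at hy
    rcases hy with rfl | ⟨D, hD, hy⟩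
    · exact I.length_decompositions_le.trans hS
    · refine (D.le_of_mem_encode hy).trans (max_le h1S ?_)
      obtain ⟨j, hj, rfl⟩ := List.getElem_of_mem hD
      exact le_trans (by have := (I.occursAt_decomposition hj).le_length; omega) hS

theorem budget_lt : I.budget.natAbs < 2 ^ RAM.inputSize I.encode := by
  have h : RAM.len I.budget.natAbs ≤ RAM.inputSize I.encode :=
    len_le_inputSize (I.occursAt_encode.right.left.subset (by simp))
  refine (Nat.lt_size_self _).trans_le (Nat.pow_le_pow_right (by norm_num) ?_)
  unfold RAM.len at h
  omega

end SteinerInput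

/-! ### The run of the program -/

namespace RAM
open Ex

/-- The registers that are assigned. -/
def Cmd.regs : Cmd → List ℕ
  | .skip => []
  | .set r _ => [r]
  | .write _ _ _ => []
  | .flip r => [r]
  | .seq c₁ c₂ => c₁.regs ++ c₂.regs
  | .ite _ c₁ c₂ => c₁.regs ++ c₂.regs
  | .loop r _ c => r :: c.regs

/-- The arrays that are written to. -/
def Cmd.arrays : Cmd → List ℕ
  | .skip => []
  | .set _ _ => []
  | .write a _ _ => [a]
  | .flip _ => []
  | .seq c₁ c₂ => c₁.arrays ++ c₂.arrays
  | .ite _ c₁ c₂ => c₁.arrays ++ c₂.arrays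
  | .loop _ _ c => c.arrays

theorem iter_induction {f : ℕ → State → State} {P : ℕ → State → Prop} {s : State} {n : ℕ} (h0 : P 0 s)
    (hs : ∀ i < n, ∀ s, P i s → P (i + 1) (f i s)) : P n (iter f n s) := by
  have : ∀ i ≤ n, P i (iter f i s) := by
    intro i
    induction i with
    | zero => exact fun _ => h0
    | succ i ih => exact fun hi => hs i hi _ (ih (by omega))
  exact this n le_rfl

theorem Cmd.den_reg (c : Cmd) (σ : State) {r : ℕ} (hr : r ∉ c.regs) : (c.den σ).reg r = σ.reg r := by
  induction c generalizing σ with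
  | skip => rfl
  | set r' e => exact Function.update_of_ne (by simpa [Cmd.regs] using hr) _ _
  | write => rfl
  | flip r' => exact Function.update_of_ne (by simpa [Cmd.regs] using hr) _ _
  | seq c₁ c₂ ih₁ ih₂ =>
    simp only [Cmd.regs, List.mem_append, not_or] at hr
    rw [Cmd.den, ih₂ _ hr.2, ih₁ _ hr.1]
  | ite e c₁ c₂ ih₁ ih₂ =>
    simp only [Cmd.regs, List.mem_append, not_or] at hr
    rw [Cmd.den]
    split_ifs
    · exact ih₁ _ hr.1
    · exact ih₂ _ hr.2
  | loop r' N c ih =>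
    simp only [Cmd.regs, List.mem_cons, not_or] at hr
    refine iter_induction (P := fun _ s => s.reg r = σ.reg r) rfl fun i _ s hs => ?_
    rw [ih _ hr.2, ← hs]
    exact Function.update_of_ne hr.1 _ _

theorem Cmd.den_mem (c : Cmd) (σ : State) {a : ℕ} (ha : a ∉ c.arrays) : (c.den σ).mem a = σ.mem a := by
  induction c generalizing σ with
  | skip => rfl
  | set r' e => rfl
  | write a' i e => exact Function.update_of_ne (by simpa [Cmd.arrays] using ha) _ _
  | flip r' => rfl
  | seq c₁ c₂ ih₁ ih₂ =>
    simp only [Cmd.arrays, List.mem_append, not_or] at ha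
    rw [Cmd.den, ih₂ _ ha.2, ih₁ _ ha.1]
  | ite e c₁ c₂ ih₁ ih₂ =>
    simp only [Cmd.arrays, List.mem_append, not_or] at ha
    rw [Cmd.den]
    split_ifs
    · exact ih₁ _ ha.1
    · exact ih₂ _ ha.2
  | loop r' N c ih =>
    refine iter_induction (P := fun _ s => s.mem a = σ.mem a) rfl fun i _ s hs => ?_
    rw [ih _ ha, ← hs]
    rfl

variable (I : SteinerInput) (ω : ℕ → Bool)

open SteinerInput (signPos)

/-- Variables 1, 2, 3 and array 0 hold the input. -/
structure ReadsInput (σ : State) : Prop where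
  numVertices : σ.reg 1 = I.n
  sign : σ.reg 2 = propBit (I.budget < 0)
  budget : σ.reg 3 = I.budget.natAbs
  mem : ∀ i, σ.mem 0 i = if i = signPos I.n + 1 then 0 else I.encode.getD i 0

variable {I ω}

theorem ReadsInput.mem_of_ne {σ : State} (h : ReadsInput I σ) {i : ℕ} (hi : i < signPos I.n + 1) :
    σ.mem 0 i = I.encode.getD i 0 := by
  rw [h.mem, if_neg (by omega)]

theorem ReadsInput.mem_of_gt {σ : State} (h : ReadsInput I σ) {i : ℕ} (hi : signPos I.n + 1 < i) :
    σ.mem 0 i = I.encode.getD i 0 := by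
  rw [h.mem, if_neg (by omega)]

theorem ReadsInput.graph {σ : State} (h : ReadsInput I σ) :
    ReadsGraph I.graph I.terminals I.cost σ.mem σ.reg := by
  refine ⟨h.numVertices, fun u v => ?_, fun u => ?_, fun u => ?_⟩
  · have := mul_add_lt u v
    rw [h.mem_of_ne (by unfold SteinerInput.signPos; omega), I.getD_adj]
  · have := u.2
    rw [h.mem_of_ne (by unfold SteinerInput.signPos; omega), I.getD_term]
  · have := u.2
    rw [h.mem_of_ne (by unfold SteinerInput.signPos; omega), I.getD_cost]

theorem ReadsInput.congr {σ σ' : State} (h : ReadsInput I σ) (hr : ∀ r, 1 ≤ r → r ≤ 3 → σ'.reg r = σ.reg r)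
    (hm : σ'.mem 0 = σ.mem 0) : ReadsInput I σ' := by
  obtain ⟨h1, h2, h3, h4⟩ := h
  exact ⟨(hr 1 (by omega) (by omega)).trans h1, (hr 2 (by omega) (by omega)).trans h2,
    (hr 3 (by omega) (by omega)).trans h3, fun i => hm ▸ h4 i⟩

theorem ReadsInput.den {σ : State} (h : ReadsInput I σ) {c : Cmd} (hr : ∀ r ∈ c.regs, r = 0 ∨ 3 < r)
    (hm : 0 ∉ c.arrays) : ReadsInput I (c.den σ) :=
  h.congr (fun r h1 h2 => c.den_reg σ fun h => by have := hr r h; omega) (c.den_mem σ hm)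

theorem eval_signPosE {σ : State} (h : σ.reg 1 = I.n) : signPosE.eval σ.mem σ.reg = signPos I.n := by
  simp [signPosE, nE, h, SteinerInput.signPos]

theorem setupCmd_den : ReadsInput I (setupCmd.den (init I.encode ω)) ∧
    (∀ r, 3 < r ∨ r = 0 → (setupCmd.den (init I.encode ω)).reg r = 0) ∧
    (∀ a ≠ 0, ∀ i, (setupCmd.den (init I.encode ω)).mem a i = 0) ∧
    (setupCmd.den (init I.encode ω)).coins = ω := by
  set σ₀ := init I.encode ω with hσ₀
  have h0 : ∀ i, σ₀.mem 0 i = I.encode.getD i 0 := fun i => rfl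
  set σ₁ := (Cmd.set 1 (.read 0 0)).den σ₀ with hσ₁
  have e1 : σ₁ = σ₀.setReg 1 I.n := by
    show σ₀.setReg 1 (σ₀.mem 0 0) = _
    rw [h0, I.getD_n]
  set σ₂ := (Cmd.set 2 (.read 0 signPosE)).den σ₁ with hσ₂
  have e2 : σ₂ = σ₁.setReg 2 (propBit (I.budget < 0)) := by
    show σ₁.setReg 2 (σ₁.mem 0 (signPosE.eval σ₁.mem σ₁.reg)) = _
    rw [eval_signPosE (I := I) (by rw [e1, setReg_reg, if_pos rfl]), show σ₁.mem 0 = σ₀.mem 0 from rfl, h0,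
      I.getD_sign]
  set σ₃ := (Cmd.set 3 (.read 0 (signPosE + 1))).den σ₂ with hσ₃
  have e3 : σ₃ = σ₂.setReg 3 I.budget.natAbs := by
    show σ₂.setReg 3 (σ₂.mem 0 (signPosE.eval σ₂.mem σ₂.reg + 1)) = _
    rw [eval_signPosE (I := I) (by rw [e2, setReg_reg, e1, setReg_reg]; rfl), show σ₂.mem 0 = σ₀.mem 0 from rfl, h0,
      I.getD_budget]
  have hreg : ∀ r, σ₃.reg r = if r = 3 then I.budget.natAbs else if r = 2 then propBit (I.budget < 0) else
      if r = 1 then I.n else 0 := by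
    intro r
    rw [e3, setReg_reg, e2, setReg_reg, e1, setReg_reg]
    rfl
  have e4 : setupCmd.den σ₀ = σ₃.setMem 0 (signPos I.n + 1) 0 := by
    show σ₃.setMem 0 (signPosE.eval σ₃.mem σ₃.reg + 1) 0 = _
    rw [eval_signPosE (I := I) (by rw [hreg]; rfl)]
  rw [e4]
  refine ⟨⟨?_, ?_, ?_, fun i => ?_⟩, fun r hr => ?_, fun a ha i => ?_, rfl⟩
  · show σ₃.reg 1 = _
    rw [hreg]; rfl
  · show σ₃.reg 2 = _
    rw [hreg]; rfl
  · show σ₃.reg 3 = _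
    rw [hreg]; rfl
  · have : (σ₃.setMem 0 (signPos I.n + 1) 0).mem 0 i = if i = signPos I.n + 1 then 0 else σ₃.mem 0 i := by
      simp [State.setMem, Function.update_apply]
    exact this
  · show σ₃.reg r = _
    rw [hreg, if_neg (by omega), if_neg (by omega), if_neg (by omega)]
  · show Function.update σ₃.mem 0 _ a i = _
    rw [Function.update_of_ne ha]
    show (if a = 0 then _ else 0) = 0
    rw [if_neg ha]

theorem coinCmd_den {σ : State} (h : σ.reg 1 = I.n) : ReadsCoins I.n σ.coins (coinCmd.den σ).mem := by
  have hN : (2 * nE * nE : Ex).eval σ.mem σ.reg = 2 * I.n * I.n := by simp [nE, h]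
  have key : (∀ j < 2 * I.n * I.n, (coinCmd.den σ).mem 1 j = (σ.coins j).toNat) ∧
      ∀ j, (coinCmd.den σ).coins j = σ.coins (2 * I.n * I.n + j) := by
    rw [coinCmd, Cmd.den, hN]
    refine iter_induction (P := fun i s => (∀ j < i, s.mem 1 j = (σ.coins j).toNat) ∧
      ∀ j, s.coins j = σ.coins (i + j)) (by simp) fun i _ s hs => ?_
    have e12 : ((s.setReg 12 i).setReg 11 (s.coins 0).toNat).reg 12 = i := by
      rw [setReg_reg, if_neg (by omega), setReg_reg, if_pos rfl]
    have e11 : ((s.setReg 12 i).setReg 11 (s.coins 0).toNat).reg 11 = (s.coins 0).toNat := by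
      rw [setReg_reg, if_pos rfl]
    refine ⟨fun j hj => ?_, fun j => ?_⟩
    · show Function.update s.mem 1 (Function.update (s.mem 1)
        (((s.setReg 12 i).setReg 11 (s.coins 0).toNat).reg 12)
        (((s.setReg 12 i).setReg 11 (s.coins 0).toNat).reg 11)) 1 j = _
      rw [Function.update_self, e12, e11, Function.update_apply]
      split_ifs with hji
      · rw [hji, hs.2 0, add_zero]
      · exact hs.1 j (by omega)
    · show s.coins (j + 1) = _
      rw [hs.2, show i + (j + 1) = i + 1 + j by ring]
  exact key.1

/-- The state of the scan after the first `i` decompositions. -/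
structure ScanInvariant (I : SteinerInput) (i : ℕ) (σ : State) : Prop where
  input : ReadsInput I σ
  pos : σ.reg 6 = I.decompositionPos i
  found : (σ.reg 5 = 0 ∧ ∀ j, ∀ hj : j < I.decompositions.length, j < i →
      ¬ I.decompositions[j].IsRelevant I.terminals) ∨
    (σ.reg 5 = 1 ∧ ∃ D ∈ I.decompositions, D.IsRelevant I.terminals ∧
      OccursAt I.encode (σ.reg 4) D.encode ∧ signPos I.n + 3 ≤ σ.reg 4)

theorem ScanInvariant.setReg {i : ℕ} {σ : State} (h : ScanInvariant I i σ) (x : ℕ) :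
    ScanInvariant I i (σ.setReg 10 x) := by
  have hreg : ∀ r < 10, (σ.setReg 10 x).reg r = σ.reg r := fun r hr => Function.update_of_ne (by omega) _ _
  refine ⟨h.input.congr (fun r _ _ => hreg r (by omega)) rfl, by rw [hreg 6 (by omega), h.pos], ?_⟩
  rw [hreg 5 (by omega), hreg 4 (by omega)]
  exact h.found

theorem ScanInvariant.step {i : ℕ} {σ : State} (h : ScanInvariant I i σ) (hi : i < I.decompositions.length) :
    ScanInvariant I (i + 1) ((Cmd.seq scanBody advanceCmd).den σ) := by
  have hocc := I.occursAt_decomposition hi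
  have hle := I.le_decompositionPos i
  have hrel : (relevantE 6).eval σ.mem σ.reg = propBit (I.decompositions[i].IsRelevant I.terminals) := by
    refine eval_relevantE h.input.graph (by omega) (same := I.decompositions[i].Same) fun u v => ?_
    rw [h.pos, h.input.mem_of_gt (by omega), PrimeNodeDecomposition.getD_same hocc]
  set τ := scanBody.den σ with hτ
  have hτin : ReadsInput I τ := h.input.den (by decide) (by decide)
  have hτ6 : τ.reg 6 = I.decompositionPos i := by
    rw [hτ, scanBody.den_reg σ (by decide), h.pos]
  have hadv : (Cmd.seq scanBody advanceCmd).den σ = τ.setReg 6 (I.decompositionPos (i + 1)) := by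
    rw [Cmd.den, ← hτ, advanceCmd, Cmd.den]
    congr 1
    have hsize : (sizeE 6).eval τ.mem τ.reg = I.decompositions[i].decomposition.size := by
      rw [sizeE, eval_read, eval_add, eval_mul, eval_nE hτin.graph, eval_var, hτ6, hτin.mem_of_gt (by omega),
        PrimeNodeDecomposition.getD_size hocc]
    simp only [eval_add, eval_mul, hsize, eval_nE hτin.graph, eval_var, hτ6, eval_one]
    rw [I.decompositionPos_succ hi, PrimeNodeDecomposition.length_encode]
    ring
  have hfound : (τ.reg 5 = 0 ∧ ∀ j, ∀ hj : j < I.decompositions.length, j < i + 1 →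
      ¬ I.decompositions[j].IsRelevant I.terminals) ∨
    (τ.reg 5 = 1 ∧ ∃ D ∈ I.decompositions, D.IsRelevant I.terminals ∧
      OccursAt I.encode (τ.reg 4) D.encode ∧ signPos I.n + 3 ≤ τ.reg 4) := by
    by_cases hr : I.decompositions[i].IsRelevant I.terminals
    · right
      have e : τ = (σ.setReg 4 (σ.reg 6)).setReg 5 1 := by
        rw [hτ, scanBody, Cmd.den, hrel, if_pos (propBit_ne_zero.2 hr)]
        rfl
      have e5 : τ.reg 5 = 1 := by rw [e, setReg_reg, if_pos rfl]
      have e4 : τ.reg 4 = I.decompositionPos i := by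
        rw [e, setReg_reg, if_neg (by omega), setReg_reg, if_pos rfl, h.pos]
      rw [e4]
      exact ⟨e5, _, List.getElem_mem hi, hr, hocc, hle⟩
    · have e : τ = σ := by
        rw [hτ, scanBody, Cmd.den, hrel, if_neg fun h => hr (propBit_ne_zero.1 h)]
        rfl
      rw [e]
      refine h.found.imp_left fun ⟨h1, h2⟩ => ⟨h1, fun j hj hji => ?_⟩
      rcases Nat.lt_succ_iff_lt_or_eq.1 hji with h | rfl
      · exact h2 j hj h
      · exact hr
  rw [hadv]
  have hreg : ∀ r < 6, (τ.setReg 6 (I.decompositionPos (i + 1))).reg r = τ.reg r :=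
    fun r hr => Function.update_of_ne (by omega) _ _
  refine ⟨hτin.congr (fun r _ _ => hreg r (by omega)) rfl, by rw [setReg_reg, if_pos rfl], ?_⟩
  rw [hreg 5 (by omega), hreg 4 (by omega)]
  exact hfound

/-- The state at the start of the loop of the scan. -/
theorem ScanInvariant.start {σ : State} (h : ReadsInput I σ) (h5 : σ.reg 5 = 0) :
    ScanInvariant I 0 ((Cmd.set 6 (signPosE + 3)).den σ) := by
  have e : (Cmd.set 6 (signPosE + 3)).den σ = σ.setReg 6 (signPos I.n + 3) := by
    rw [Cmd.den, eval_add, eval_signPosE h.numVertices, eval_three]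
  rw [e]
  have hreg : ∀ r < 6, (σ.setReg 6 (signPos I.n + 3)).reg r = σ.reg r :=
    fun r hr => Function.update_of_ne (by omega) _ _
  refine ⟨h.congr (fun r _ _ => hreg r (by omega)) rfl, ?_, .inl ⟨?_, by simp⟩⟩
  · rw [setReg_reg, if_pos rfl, I.decompositionPos_zero]
  · rw [hreg 5 (by omega), h5]

theorem ScanInvariant.iter {σ : State} (h : ScanInvariant I 0 σ) {i : ℕ} (hi : i ≤ I.decompositions.length) :
    ScanInvariant I i (iter (fun i s => (Cmd.seq scanBody advanceCmd).den (s.setReg 10 i)) i σ) :=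
  iter_induction (P := fun i s => ScanInvariant I i s) h fun j hj _ hs => (hs.setReg j).step (by omega)

theorem ScanInvariant.eval_count {i : ℕ} {σ : State} (h : ScanInvariant I i σ) :
    (Ex.read 0 (signPosE + 2)).eval σ.mem σ.reg = I.decompositions.length := by
  rw [eval_read, eval_add, eval_signPosE h.input.numVertices, eval_two, h.input.mem_of_gt (by omega), I.getD_count]

theorem scanCmd_den {σ : State} (h : ReadsInput I σ) (h5 : σ.reg 5 = 0) :
    ScanInvariant I I.decompositions.length (scanCmd.den σ) := by
  have h0 := ScanInvariant.start h h5
  show ScanInvariant I _ ((Cmd.loop 10 _ _).den ((Cmd.set 6 (signPosE + 3)).den σ))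
  generalize (Cmd.set 6 (signPosE + 3)).den σ = τ at h0 ⊢
  rw [Cmd.den, h0.eval_count]
  exact h0.iter le_rfl

/-! #### The selected decomposition -/

theorem ReadsInput.decomposition {σ : State} (h : ReadsInput I σ) {D : PrimeNodeDecomposition I.graph}
    (hocc : OccursAt I.encode (σ.reg 4) D.encode) (h4 : signPos I.n + 3 ≤ σ.reg 4)
    (h7 : σ.reg 7 = D.decomposition.size) :
    ReadsDecomposition D.Same D.decomposition.tree D.InBag σ.mem σ.reg := by
  refine ⟨h7, fun u v => ?_, fun s t => ?_, fun t u => ?_⟩ <;> rw [h.mem_of_gt (by omega)]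
  · exact PrimeNodeDecomposition.getD_same hocc u v
  · exact PrimeNodeDecomposition.getD_tree hocc s t
  · exact PrimeNodeDecomposition.getD_bag hocc t u

theorem prepareCmd_den {σ : State} (h : ReadsInput I σ) (h5 : σ.reg 5 = 1)
    {D : PrimeNodeDecomposition I.graph} (hocc : OccursAt I.encode (σ.reg 4) D.encode)
    (h4 : signPos I.n + 3 ≤ σ.reg 4) :
    ReadsDecomposition D.Same D.decomposition.tree D.InBag (prepareCmd.den σ).mem (prepareCmd.den σ).reg ∧
    (prepareCmd.den σ).reg 8 =
      3 ^ Finset.univ.sup fun t => (repBag I.cost D.Same D.InBag t).card := by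
  have hin := h.den (c := prepareCmd) (by decide) (by decide)
  set τ := (Cmd.set 7 (sizeE 4)).den σ with hτ
  have hτin : ReadsInput I τ := h.den (by decide) (by decide)
  have e7 : τ = σ.setReg 7 D.decomposition.size := by
    rw [hτ, Cmd.den, sizeE, eval_read, eval_add, eval_mul, eval_nE h.graph, eval_var, h.mem_of_gt (by omega),
      PrimeNodeDecomposition.getD_size hocc]
  have hτ4 : τ.reg 4 = σ.reg 4 := by rw [e7, setReg_reg, if_neg (by omega)]
  have hd := hτin.decomposition (hτ4 ▸ hocc) (hτ4 ▸ h4) (by rw [e7, setReg_reg, if_pos rfl])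
  have e : prepareCmd.den σ = τ.setReg 8 (3 ^ Finset.univ.sup fun t => (repBag I.cost D.Same D.InBag t).card) := by
    rw [prepareCmd, Cmd.den, if_pos (by rw [eval_var, h5]; omega), Cmd.den, ← hτ, Cmd.den,
      eval_pow (x := 3) (fun _ => rfl) (eval_maxBagE hτin.graph hd)]
  refine ⟨?_, by rw [e, setReg_reg, if_pos rfl]⟩
  have hr4 : (prepareCmd.den σ).reg 4 = σ.reg 4 := prepareCmd.den_reg σ (by decide)
  refine hin.decomposition (hr4 ▸ hocc) (hr4 ▸ h4) ?_
  rw [e, setReg_reg, if_neg (by omega), e7, setReg_reg, if_pos rfl]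

/-- The sweep is followed in the ring of residues; since the sum over the cuts is smaller than the
modulus, its residue determines it. -/
theorem sweepCmd_den {σ : State} (h : ReadsInput I σ) (hω : ReadsCoins I.n ω σ.mem)
    (h2 : ∀ i, σ.mem 2 i = 0) (h3 : ∀ i, σ.mem 3 i = 0) {D : PrimeNodeDecomposition I.graph}
    (hD : D.IsRelevant I.terminals)
    (hd : ReadsDecomposition D.Same D.decomposition.tree D.InBag σ.mem σ.reg)
    (h8 : σ.reg 8 = 3 ^ Finset.univ.sup fun t => (repBag I.cost D.Same D.InBag t).card) :
    ∃ v₁, IsFirst I.terminals I.cost D.Same v₁ ∧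
      (sweepCmd.den σ).reg 9 % ((4 ^ I.n) ^ expRange I.cost + 1) =
        cutSum I.graph I.terminals I.cost D.Same ω v₁ := by
  have hK : ∀ u ∈ I.terminals, u ∈ D.node := fun u hu => (hD.1 u hu).mem
  obtain ⟨v₁, hv₁⟩ := exists_isFirst (K := I.terminals) (c := I.cost) (same := D.Same) (by
    obtain ⟨u, hu, -⟩ := hD.2
    rw [PrimeNodeDecomposition.termReps_eq hK]
    exact ⟨_, Finset.mem_image_of_mem _ hu⟩)
  refine ⟨v₁, hv₁, ?_⟩
  have hA : (((4 ^ I.n) ^ expRange I.cost + 1 : ℕ) : ZMod ((4 ^ I.n) ^ expRange I.cost + 1)) = 0 :=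
    ZMod.natCast_self _
  have hinv : SweepInvariant I.graph I.terminals I.cost D.Same D.decomposition.tree D.InBag ω
      (ZMod ((4 ^ I.n) ^ expRange I.cost + 1)) (cutSum I.graph I.terminals I.cost D.Same ω v₁)
      Finset.univ σ := by
    refine ⟨⟨h.graph, hd, hω, fun t => ?_⟩, fun t => ?_, fun _ _ _ => h3 _,
      PrimeNodeDecomposition.connectedOn_tree, PrimeNodeDecomposition.connectedOn_bags I.cost,
      fun _ => remainingSum_univ _ (PrimeNodeDecomposition.bagsCover I.cost) hv₁ _, fun hempty => ?_⟩
    · rw [h2, propBit_of_false (by simp)]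
    · rw [h8]
      exact Nat.pow_le_pow_right (by norm_num)
        (Finset.le_sup (f := fun t => (repBag I.cost D.Same D.InBag t).card) (Finset.mem_univ t))
    · obtain ⟨t⟩ := D.decomposition.isTree.1.nonempty
      exact absurd hempty (Finset.nonempty_iff_ne_empty.1 ⟨t, Finset.mem_univ t⟩)
  have := (ZMod.natCast_eq_natCast_iff _ _ _).1 (hinv.sweep D.decomposition.isTree hA)
  rw [Nat.ModEq, Nat.mod_eq_of_lt (cutSum_lt.trans (Nat.lt_succ_self _))] at this
  exact this

end RAM

/-! ### Correctness -/

namespace RAM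
open Ex

open SteinerInput (signPos)

variable {I : SteinerInput} {ω : ℕ → Bool}

/-- Any two terminals are equal, adjacent, or have a common neighbour among the terminals. -/
def TerminalsClose (I : SteinerInput) : Prop :=
  ∀ u ∈ I.terminals, ∀ w ∈ I.terminals,
    u = w ∨ I.graph.Adj u w ∨ ∃ x ∈ I.terminals, I.graph.Adj u x ∧ I.graph.Adj w x

/-- The number `z` is the residue left in variable 9. Without a relevant decomposition it means
nothing, and the third alternative of the answer is then switched off by the flag in variable 5. -/
theorem steinerCmd_answer (I : SteinerInput) (ω : ℕ → Bool) : ∃ z,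
    (steinerCmd.den (init I.encode ω)).reg 0 = propBit (¬I.budget < 0 ∧
      ((TerminalsClose I ∧ ∑ u ∈ I.terminals, I.cost u ≤ I.budget.natAbs) ∨
      (∃ v, (∀ u ∈ I.terminals, I.graph.Adj u v) ∧
        ∑ u ∈ I.terminals, I.cost u + I.cost v ≤ I.budget.natAbs) ∨
      ((∃ D ∈ I.decompositions, D.IsRelevant I.terminals) ∧
        ∃ i : Fin (expRange I.cost), (i : ℕ) / (I.n * (2 * I.n * (2 * I.n)) + 1) ≤ I.budget.natAbs ∧
          z / (4 ^ I.n) ^ (i : ℕ) % 2 = 1))) ∧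
    ((∃ D ∈ I.decompositions, D.IsRelevant I.terminals) →
      ∃ D ∈ I.decompositions, D.IsRelevant I.terminals ∧ ∃ v₁, IsFirst I.terminals I.cost D.Same v₁ ∧
        z = cutSum I.graph I.terminals I.cost D.Same ω v₁) := by
  obtain ⟨a1, a2, a3, a4⟩ := setupCmd_den (I := I) (ω := ω)
  set σ₁ := setupCmd.den (init I.encode ω)
  have b1 : ReadsInput I (coinCmd.den σ₁) := a1.den (by decide) (by decide)
  have b2 := coinCmd_den (I := I) a1.numVertices
  rw [a4] at b2
  have b3 := scanCmd_den b1 (by rw [coinCmd.den_reg σ₁ (by decide), a2 5 (by omega)])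
  have b4 : ∀ a, a = 2 ∨ a = 3 → ∀ i, (prepareCmd.den (scanCmd.den (coinCmd.den σ₁))).mem a i = 0 := by
    intro a ha i
    rw [prepareCmd.den_mem _ (by rcases ha with rfl | rfl <;> decide),
      scanCmd.den_mem _ (by rcases ha with rfl | rfl <;> decide),
      coinCmd.den_mem _ (by rcases ha with rfl | rfl <;> decide), a3 a (by omega)]
  have b5 : ReadsCoins I.n ω (prepareCmd.den (scanCmd.den (coinCmd.den σ₁))).mem := by
    unfold ReadsCoins
    rw [prepareCmd.den_mem _ (by decide), scanCmd.den_mem _ (by decide)]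
    exact b2
  set σ₃ := scanCmd.den (coinCmd.den σ₁)
  have c1 : ReadsInput I (prepareCmd.den σ₃) := b3.input.den (by decide) (by decide)
  have d1 : ReadsInput I (sweepCmd.den (prepareCmd.den σ₃)) := c1.den (by decide) (by decide)
  have d5 : (sweepCmd.den (prepareCmd.den σ₃)).reg 5 =
      propBit (∃ D ∈ I.decompositions, D.IsRelevant I.terminals) := by
    rw [sweepCmd.den_reg _ (by decide), prepareCmd.den_reg _ (by decide)]
    rcases b3.found with ⟨h1, h2⟩ | ⟨h1, D, hD, hD', -⟩
    · rw [h1, propBit_of_false]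
      rintro ⟨D, hD, hD'⟩
      obtain ⟨j, hj, rfl⟩ := List.getElem_of_mem hD
      exact h2 j hj hj hD'
    · rw [h1, propBit_of_true ⟨D, hD, hD'⟩]
  refine ⟨(sweepCmd.den (prepareCmd.den σ₃)).reg 9 % ((4 ^ I.n) ^ expRange I.cost + 1), ?_, ?_⟩
  · have e : (steinerCmd.den (init I.encode ω)).reg 0 =
        answerE.eval (sweepCmd.den (prepareCmd.den σ₃)).mem (sweepCmd.den (prepareCmd.den σ₃)).reg := by
      show ((Cmd.set 0 answerE).den (sweepCmd.den (prepareCmd.den σ₃))).reg 0 = _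
      rw [Cmd.den, setReg_reg, if_pos rfl]
    rw [e, eval_answerE d1.graph d1.sign d5, d1.budget]
    rfl
  · rintro ⟨D, hD, hD'⟩
    rcases b3.found with ⟨h1, h2⟩ | ⟨h1, D, hD, hD', hocc, h4⟩
    · obtain ⟨j, hj, rfl⟩ := List.getElem_of_mem hD
      exact absurd hD' (h2 j hj hj)
    · obtain ⟨e1, e2⟩ := prepareCmd_den b3.input h1 hocc h4
      obtain ⟨v₁, f1, f2⟩ := sweepCmd_den c1 b5 (b4 2 (.inl rfl)) (b4 3 (.inr rfl)) hD' e1 e2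
      exact ⟨D, hD, hD', v₁, f1, f2⟩

theorem hasSolution_iff : I.HasSolution ↔ ¬I.budget < 0 ∧ ∃ X : Finset (Fin I.n), I.terminals ⊆ X ∧
    ConnectedOn I.graph (X : Set (Fin I.n)) ∧ ∑ v ∈ X, I.cost v ≤ I.budget.natAbs := by
  simp only [SteinerInstance.HasSolution, induce_preconnected_iff]
  constructor
  · rintro ⟨X, h1, h2, h3⟩
    exact ⟨by omega, X, h1, h2, by omega⟩
  · rintro ⟨h, X, h1, h2, h3⟩
    exact ⟨X, h1, h2, by omega⟩

theorem connectedOn_of_terminalsClose (h : TerminalsClose I) :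
    ConnectedOn I.graph (I.terminals : Set (Fin I.n)) := by
  intro C hC ⟨u, hu⟩ hcl w hw
  rcases h u (hC hu) w hw with rfl | h | ⟨x, hx, h1, h2⟩
  · exact hu
  · exact hcl u hu w hw h
  · exact hcl x (hcl u hu x hx h1) w hw h2.symm

theorem connectedOn_insert {V : Type*} {G : SimpleGraph V} {K : Set V} {v : V} (h : ∀ u ∈ K, G.Adj u v) :
    ConnectedOn G (insert v K) := by
  intro C hC ⟨u, hu⟩ hcl w hw
  have hv : v ∈ C := by
    rcases hC hu with rfl | h'
    · exact hu
    · exact hcl u hu v (Set.mem_insert _ _) (h u h')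
  rcases hw with rfl | hw
  · exact hv
  · exact hcl v hv w (Set.mem_insert_of_mem _ hw) (h w hw).symm

/-- Whatever the coins are, each of the three tests yields an actual solution: the terminals, the
terminals with one more vertex, or the lift of a quotient solution certified by an odd number of
cuts. -/
theorem hasSolution_of_answer (h : (steinerCmd.den (init I.encode ω)).reg 0 = 1) : I.HasSolution := by
  obtain ⟨z, h1, h2⟩ := steinerCmd_answer I ω
  rw [h1, propBit_eq_one] at h
  rw [hasSolution_iff]
  refine ⟨h.1, ?_⟩
  rcases h.2 with ⟨h3, h4⟩ | ⟨v, h3, h4⟩ | ⟨hD, i, h3, h4⟩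
  · exact ⟨_, subset_rfl, connectedOn_of_terminalsClose h3, h4⟩
  · refine ⟨insert v I.terminals, Finset.subset_insert _ _, ?_, ?_⟩
    · rw [Finset.coe_insert]; exact connectedOn_insert h3
    · refine le_trans ?_ h4
      by_cases hv : v ∈ I.terminals
      · exact absurd (h3 v hv) (I.graph.loopless.irrefl v)
      · rw [Finset.sum_insert hv, add_comm]
  · obtain ⟨D, -, hD, v₁, -, rfl⟩ := h2 hD
    obtain ⟨X, hX⟩ := exists_quotientSolution h3 h4
    exact PrimeNodeDecomposition.exists_solution_of_quotient hD hX

/-- The parts are sets in a type depending on the node, so the equality is substituted with the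
nodes as free variables. -/
theorem same_eq {G : SimpleGraph (Fin I.n)} {D D' : PrimeNodeDecomposition G} (h : D.node = D'.node) :
    D.Same = D'.Same := by
  have key : ∀ M M' : Set (Fin I.n), M = M' → (fun u v : Fin I.n =>
      ∃ N ∈ ModularDecomposition.canonicalPartition (G.induce M), u ∈ Subtype.val '' N ∧ v ∈ Subtype.val '' N) =
      fun u v : Fin I.n =>
      ∃ N ∈ ModularDecomposition.canonicalPartition (G.induce M'), u ∈ Subtype.val '' N ∧ v ∈ Subtype.val '' N := by
    rintro M _ rfl; rfl
  exact key _ _ h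

/-- In the first two cases of `terminals_trichotomy` the answer is always yes. In the third it is
yes whenever the weights isolate a quotient solution within the budget. This event depends only on
the node, so it is the same for every relevant decomposition in the input. -/
theorem prob_reject_le (h : I.HasSolution) :
    fairCoins {ω | ¬(steinerCmd.den (init I.encode ω)).reg 0 = 1} ≤ 1 / 2 := by
  obtain ⟨hneg, X, hKX, hX, hb⟩ := hasSolution_iff.1 h
  have hempty : (∀ ω, (steinerCmd.den (init I.encode ω)).reg 0 = 1) →
      fairCoins {ω | ¬(steinerCmd.den (init I.encode ω)).reg 0 = 1} ≤ 1 / 2 := by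
    intro hP
    rw [show {ω | ¬(steinerCmd.den (init I.encode ω)).reg 0 = 1} = ∅ by ext; simp [hP]]
    simp
  rcases ModularDecomposition.terminals_trichotomy (G := I.graph) (K := (I.terminals : Set (Fin I.n)))
    (X := (X : Set (Fin I.n))) (by exact_mod_cast hKX) hX with h1 | ⟨v, hv, hvK, h1⟩ | ⟨M, hM, hXM, hpart⟩
  · refine hempty fun ω => ?_
    obtain ⟨z, e, -⟩ := steinerCmd_answer I ω
    rw [e, propBit_eq_one]
    exact ⟨hneg, .inl ⟨h1, (Finset.sum_le_sum_of_subset hKX).trans hb⟩⟩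
  · refine hempty fun ω => ?_
    obtain ⟨z, e, -⟩ := steinerCmd_answer I ω
    rw [e, propBit_eq_one]
    refine ⟨hneg, .inr (.inl ⟨v, h1, le_trans ?_ hb⟩)⟩
    rw [add_comm, ← Finset.sum_insert (by simpa using hvK)]
    exact Finset.sum_le_sum_of_subset (Finset.insert_subset (by simpa using hv) hKX)
  · obtain ⟨D, hD, rfl⟩ := I.complete M hM
    have hrel : D.IsRelevant I.terminals :=
      PrimeNodeDecomposition.isRelevant_of_prime (fun u hu => hXM (hKX hu)) hpart
    have hn : 0 < I.n := by
      obtain ⟨x, -⟩ := hM.1.2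
      have := x.2
      omega
    refine (MeasureTheory.measure_mono ?_).trans (isolation hn
      (F := {Y | IsQuotientSolution I.graph I.terminals I.cost D.Same I.budget.natAbs Y})
      (PrimeNodeDecomposition.exists_quotient_of_solution hXM hKX hX hb))
    intro ω hω
    rw [Set.mem_ofPred_eq] at hω ⊢
    refine mt (fun ⟨Y, hY, huniq⟩ => ?_) hω
    obtain ⟨z, e, hz⟩ := steinerCmd_answer I ω
    obtain ⟨D', hD', hrel', v₁, hv₁, rfl⟩ := hz ⟨D, hD, hrel⟩
    have hsame : D'.Same = D.Same := same_eq (PrimeNodeDecomposition.node_eq_of_isRelevant hrel' hrel)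
    rw [e, propBit_eq_one]
    refine ⟨hneg, .inr (.inr ⟨⟨D, hD, hrel⟩, exists_digit_eq_one hv₁ (X := Y) ?_ ?_⟩)⟩
    · rw [hsame]; exact hY
    · rw [hsame]; exact huniq

/-! ### Running time -/

/-- The hypothesis is decided by evaluation on a concrete command, and the resulting exponent never
has to be named. -/
theorem exists_check {Δ Γ : ℕ → Kd} {q : ℕ} {c : Cmd} (h : (check Δ Γ q c).isSome = true) :
    ∃ A, ∀ {S M : ℕ}, 2 ≤ S → 1 ≤ M → ∀ {σ : State}, InCtx S Δ Γ σ → σ.reg q ≤ M →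
      InCtx S Δ Γ (c.den σ) ∧ Runs c σ (S ^ A * M) := by
  obtain ⟨⟨A, f⟩, hA⟩ := Option.isSome_iff_exists.1 h
  refine ⟨A, fun hS hM σ hσ hq => ?_⟩
  obtain ⟨h1, -, h2⟩ := check_sound hS hM c hA hσ hq
  exact ⟨h1, h2.mono (Nat.mul_le_mul_left _ (by split_ifs <;> omega))⟩

/-- During the setup the budget is still in array 0, so the whole array counts as large. -/
def setupArrayKd (a : ℕ) : Kd := if a = 0 then .bg 1 else .sm 0
def setupVarKd (r : ℕ) : Kd := if r = 1 ∨ r = 2 ∨ r = 3 then .bg 1 else .sm 0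

theorem exists_runs_set {Δ Γ : ℕ → Kd} (r : ℕ) {e : Ex} (h : (infer Δ e Γ).isSome = true) :
    ∃ A, ∀ {S : ℕ}, 2 ≤ S → ∀ {σ : State}, InCtx S Δ Γ σ → Runs (.set r e) σ (S ^ A) := by
  obtain ⟨⟨k, B⟩, hB⟩ := Option.isSome_iff_exists.1 h
  exact ⟨_, fun hS _ hσ => Runs.set hS hσ hB⟩

theorem InCtx.setReg_six {S : ℕ} (hS : 2 ≤ S) {σ : State} {e : Ex} (h : InCtx S arrayKd varKd σ)
    (h6 : ((Cmd.set 6 e).den σ).reg 6 ≤ S) : InCtx S arrayKd varKd ((Cmd.set 6 e).den σ) := by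
  rw [Cmd.den, setReg_reg, if_pos rfl] at h6
  exact h.setReg hS (k := .sm 1) (by show _ ≤ S ^ 1; rwa [pow_one]) (by decide)

theorem inCtx_init {S : ℕ} (hS : inputSize I.encode ≤ S) :
    InCtx S setupArrayKd setupVarKd (init I.encode ω) := by
  refine ⟨fun a i => ?_, fun r => Nat.zero_le _⟩
  show (if a = 0 then I.encode.getD i 0 else 0) ≤ _
  by_cases ha : a = 0
  · subst ha
    rw [if_pos rfl]
    show _ ≤ 2 ^ S ^ 1
    rw [pow_one, List.getD_eq_getElem?_getD]
    rcases h : I.encode[i]? with _ | y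
    · simp
    · have h1 := len_le_inputSize (List.mem_of_getElem? h)
      refine (Nat.lt_size_self y).le.trans (Nat.pow_le_pow_right (by norm_num) ?_)
      unfold len at h1
      omega
  · rw [if_neg ha]; exact Nat.zero_le _

theorem inCtx_setup {S : ℕ} (hS : inputSize I.encode ≤ S) (hc : ∀ v, I.cost v ≤ S) :
    InCtx S arrayKd varKd (setupCmd.den (init I.encode ω)) := by
  obtain ⟨a1, a2, a3, -⟩ := setupCmd_den (I := I) (ω := ω)
  have hlen := (length_le_inputSize I.encode).trans hS
  refine ⟨fun a i => ?_, fun r => ?_⟩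
  · by_cases ha : a = 0
    · subst ha
      rw [a1.mem]
      show _ ≤ S ^ 1
      rw [pow_one]
      split_ifs with hi
      · exact Nat.zero_le _
      · exact I.getD_le hlen hc hi
    · rw [a3 a ha]; exact Nat.zero_le _
  · by_cases h1 : r = 1
    · subst h1
      rw [a1.numVertices]
      show _ ≤ S ^ 1
      rw [pow_one]
      exact I.n_le_length.trans hlen
    by_cases h2 : r = 2
    · subst h2
      rw [a1.sign]
      exact propBit_le _
    by_cases h3 : r = 3
    · subst h3
      rw [a1.budget]
      show _ ≤ 2 ^ S ^ 1
      rw [pow_one]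
      exact I.budget_lt.le.trans (Nat.pow_le_pow_right (by norm_num) hS)
    · rw [a2 r (by omega)]; exact Nat.zero_le _

/-- `check` cannot accept the assignment that advances variable 6, whose value would seem to grow in
every round. The bound comes instead from `ScanInvariant`: the position never exceeds the length of
the input. -/
theorem exists_scan_runs : ∃ A, ∀ {S : ℕ}, 2 ≤ S → ∀ {I : SteinerInput}, inputSize I.encode ≤ S →
    ∀ {σ : State}, InCtx S arrayKd varKd σ → ReadsInput I σ → σ.reg 5 = 0 → σ.reg 100 ≤ 1 →
      InCtx S arrayKd varKd (scanCmd.den σ) ∧ Runs scanCmd σ (S ^ A) := by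
  obtain ⟨A₁, h₁⟩ := exists_runs_set (Δ := arrayKd) (Γ := varKd) 6 (e := signPosE + 3) (by decide +kernel)
  obtain ⟨A₂, h₂⟩ := exists_check (Δ := arrayKd) (Γ := varKd) (q := 100) (c := scanBody) (by decide +kernel)
  obtain ⟨A₃, h₃⟩ := exists_runs_set (Δ := arrayKd) (Γ := varKd) 6
    (e := .var 6 + nE * nE + 1 + sizeE 6 * sizeE 6 + sizeE 6 * nE) (by decide +kernel)
  obtain ⟨⟨k, A₄⟩, h₄⟩ := Option.isSome_iff_exists.1
    (show (infer arrayKd (.read 0 (signPosE + 2)) varKd).isSome = true by decide +kernel)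
  refine ⟨A₁ + A₂ + A₃ + A₄ + 2 + 1 + 6, fun {S} hS {I} hI {σ} hσ hin h5 h100 => ?_⟩
  have hpos : ∀ i, I.decompositionPos i ≤ S := fun i =>
    (I.decompositionPos_le i).trans ((length_le_inputSize _).trans hI)
  have hcount : I.decompositions.length ≤ S :=
    I.length_decompositions_le.trans ((length_le_inputSize _).trans hI)
  have s0 := ScanInvariant.start hin h5
  have c1 := hσ.setReg_six hS (s0.pos ▸ hpos 0)
  have r0 := h₁ hS hσ
  have q0 : ((Cmd.set 6 (signPosE + 3)).den σ).reg 100 ≤ 1 := by rwa [Cmd.den_reg _ _ (by decide)]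
  have hden : scanCmd.den σ = (Cmd.loop 10 (.read 0 (signPosE + 2)) (.seq scanBody advanceCmd)).den
    ((Cmd.set 6 (signPosE + 3)).den σ) := rfl
  rw [hden]
  have hruns : ∀ T, Runs (.loop 10 (.read 0 (signPosE + 2)) (.seq scanBody advanceCmd))
      ((Cmd.set 6 (signPosE + 3)).den σ) T → S ^ A₁ + T ≤ S ^ (A₁ + A₂ + A₃ + A₄ + 2 + 1 + 6) →
      Runs scanCmd σ (S ^ (A₁ + A₂ + A₃ + A₄ + 2 + 1 + 6)) := fun T hT hle => (r0.seq hT).mono hle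
  generalize (Cmd.set 6 (signPosE + 3)).den σ = τ at s0 c1 q0 hruns ⊢
  -- one round
  have round : ∀ i < I.decompositions.length, ∀ s, (InCtx S arrayKd varKd s ∧ ScanInvariant I i s ∧ s.reg 100 ≤ 1) →
      Runs (.seq scanBody advanceCmd) (s.setReg 10 i) (S ^ A₂ * 1 + S ^ A₃) ∧
      (InCtx S arrayKd varKd ((Cmd.seq scanBody advanceCmd).den (s.setReg 10 i)) ∧
        ScanInvariant I (i + 1) ((Cmd.seq scanBody advanceCmd).den (s.setReg 10 i)) ∧
        ((Cmd.seq scanBody advanceCmd).den (s.setReg 10 i)).reg 100 ≤ 1) := by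
    intro i hi s ⟨e1, e2, e3⟩
    have f1 : InCtx S arrayKd varKd (s.setReg 10 i) :=
      e1.setReg hS (k := .sm 1) (by show i ≤ S ^ 1; rw [pow_one]; omega) (by decide)
    have f3 : (s.setReg 10 i).reg 100 ≤ 1 := by rwa [setReg_reg, if_neg (by omega)]
    have f2 := (e2.setReg i).step hi
    obtain ⟨g1, g2⟩ := h₂ hS le_rfl f1 f3
    refine ⟨g2.seq (h₃ hS g1), g1.setReg_six hS ?_, f2, ?_⟩
    · exact f2.pos.le.trans (hpos _)
    · rwa [Cmd.den_reg _ _ (by decide)]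
  have hall : ∀ i ≤ I.decompositions.length, InCtx S arrayKd varKd
      (iter (fun i s => (Cmd.seq scanBody advanceCmd).den (s.setReg 10 i)) i τ) ∧ ScanInvariant I i
      (iter (fun i s => (Cmd.seq scanBody advanceCmd).den (s.setReg 10 i)) i τ) ∧
      (iter (fun i s => (Cmd.seq scanBody advanceCmd).den (s.setReg 10 i)) i τ).reg 100 ≤ 1 :=
    fun i hi => iter_induction (P := fun i s => InCtx S arrayKd varKd s ∧ ScanInvariant I i s ∧ s.reg 100 ≤ 1)
      ⟨c1, s0, q0⟩ fun j hj s hs => (round j (by omega) s hs).2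
  refine ⟨?_, ?_⟩
  · rw [Cmd.den, s0.eval_count]
    exact (hall _ le_rfl).1
  · have hloop : Runs (.loop 10 (.read 0 (signPosE + 2)) (.seq scanBody advanceCmd)) τ _ :=
      Runs.loop s0.eval_count (tN := S ^ A₄) (L := S ^ 2) (fun d s hs => by
        have := infer_computes hS (.read 0 (signPosE + 2)) (d := d) hs.reg (by rw [hs.mem]; exact c1.mem) c1.reg h₄
        rwa [hs.mem, s0.eval_count] at this)
        (fun i hi => (round i hi _ (hall i hi.le)).1) (by
          have h1 : len I.decompositions.length ≤ I.decompositions.length + 1 := by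
            unfold len
            exact Nat.add_le_add_right (Nat.size_le.2 Nat.lt_two_pow_self) 1
          nlinarith) (by
          have : len 1 = 2 := by decide
          rw [this]
          nlinarith)
    refine hruns _ hloop (le_pow_add (A := A₁ + A₂ + A₃ + A₄ + 2 + 1) hS 6 ?_)
    set B := A₁ + A₂ + A₃ + A₄ + 2 with hB
    have p1 : S ^ A₁ ≤ S ^ B := Kd.pow_mono_exp hS (by omega)
    have p2 : S ^ A₂ ≤ S ^ B := Kd.pow_mono_exp hS (by omega)
    have p3 : S ^ A₃ ≤ S ^ B := Kd.pow_mono_exp hS (by omega)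
    have p4 : S ^ A₄ ≤ S ^ B := Kd.pow_mono_exp hS (by omega)
    have p5 : S ^ 2 ≤ S ^ B := Kd.pow_mono_exp hS (by omega)
    have p6 : I.decompositions.length * (S ^ A₂ * 1 + S ^ A₃ + 16 * S ^ 2) ≤ S * (18 * S ^ B) :=
      Nat.mul_le_mul hcount (by omega)
    have p7 : S ^ B ≤ S ^ (B + 1) := Kd.pow_mono_exp hS (by omega)
    have p8 : S ^ (B + 1) = S * S ^ B := pow_succ' _ _
    have p9 : S * (18 * S ^ B) = 18 * S ^ (B + 1) := by rw [p8]; ring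
    omega

/-- Apart from the sweep no phase contains a long loop; these phases are analysed with the unused
variable 100, which stays 0, in the role of `q` and with `M = 1`. For the sweep, `q` is variable 8
and `M = 3 ^ (k + 1)`, since bags have at most `k + 1` elements. -/
theorem exists_steinerCmd_runs : ∃ A, ∀ {S : ℕ}, 2 ≤ S → ∀ {I : SteinerInput}, inputSize I.encode ≤ S →
    (∀ v, I.cost v ≤ S) → ∀ {k : ℕ}, (∀ D ∈ I.decompositions, D.decomposition.width ≤ k) → ∀ ω,
      Runs steinerCmd (init I.encode ω) (S ^ A * 3 ^ k) := by
  obtain ⟨A₁, h₁⟩ := exists_check (Δ := setupArrayKd) (Γ := setupVarKd) (q := 100) (c := setupCmd)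
    (by decide +kernel)
  obtain ⟨A₂, h₂⟩ := exists_check (Δ := arrayKd) (Γ := varKd) (q := 100) (c := coinCmd) (by decide +kernel)
  obtain ⟨A₃, h₃⟩ := exists_scan_runs
  obtain ⟨A₄, h₄⟩ := exists_check (Δ := arrayKd) (Γ := varKd) (q := 100) (c := prepareCmd) (by decide +kernel)
  obtain ⟨A₅, h₅⟩ := exists_check (Δ := arrayKd) (Γ := varKd) (q := 8) (c := sweepCmd) (by decide +kernel)
  obtain ⟨A₆, h₆⟩ := exists_check (Δ := arrayKd) (Γ := varKd) (q := 100) (c := .set 0 answerE) (by decide +kernel)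
  refine ⟨A₁ + A₂ + A₃ + A₄ + A₅ + A₆ + 3, fun {S} hS {I} hI hc {k} hk ω => ?_⟩
  obtain ⟨-, r1⟩ := h₁ hS le_rfl (inCtx_init (I := I) (ω := ω) hI) (Nat.zero_le _)
  obtain ⟨i1, a2, -, -⟩ := setupCmd_den (I := I) (ω := ω)
  have c1 := inCtx_setup (I := I) (ω := ω) hI hc
  set σ₁ := setupCmd.den (init I.encode ω) with hσ₁
  have q1 : σ₁.reg 100 ≤ 1 := by rw [a2 100 (by omega)]; omega
  obtain ⟨c2, r2⟩ := h₂ hS le_rfl c1 q1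
  set σ₂ := coinCmd.den σ₁ with hσ₂
  have i2 : ReadsInput I σ₂ := i1.den (by decide) (by decide)
  have q2 : σ₂.reg 100 ≤ 1 := by rwa [hσ₂, Cmd.den_reg _ _ (by decide)]
  have z2 : σ₂.reg 5 = 0 := by rw [hσ₂, Cmd.den_reg _ _ (by decide), a2 5 (by omega)]
  obtain ⟨c3, r3⟩ := h₃ hS hI c2 i2 z2 q2
  have s3 := scanCmd_den i2 z2
  set σ₃ := scanCmd.den σ₂ with hσ₃
  have q3 : σ₃.reg 100 ≤ 1 := by rwa [hσ₃, Cmd.den_reg _ _ (by decide)]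
  obtain ⟨c4, r4⟩ := h₄ hS le_rfl c3 q3
  have q4 : (prepareCmd.den σ₃).reg 8 ≤ 3 ^ (k + 1) := by
    rcases s3.found with ⟨h5, -⟩ | ⟨h5, D, hD, -, hocc, h4⟩
    · have e : prepareCmd.den σ₃ = σ₃ := by
        rw [prepareCmd, Cmd.den, if_neg (by rw [eval_var, h5]; omega), Cmd.den]
      rw [e, hσ₃, Cmd.den_reg _ _ (by decide), hσ₂, Cmd.den_reg _ _ (by decide), a2 8 (by omega)]
      exact Nat.zero_le _
    · rw [(prepareCmd_den s3.input h5 hocc h4).2]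
      exact Nat.pow_le_pow_right (by norm_num)
        (Finset.sup_le fun t _ => PrimeNodeDecomposition.card_repBag_le I.cost (hk D hD) t)
  set σ₄ := prepareCmd.den σ₃ with hσ₄
  obtain ⟨c5, r5⟩ := h₅ hS (Nat.one_le_pow _ _ (by norm_num)) c4 q4
  have q5 : (sweepCmd.den σ₄).reg 100 ≤ 1 := by
    rwa [Cmd.den_reg _ _ (by decide), hσ₄, Cmd.den_reg _ _ (by decide)]
  obtain ⟨-, r6⟩ := h₆ hS le_rfl c5 q5
  refine (r1.seq (r2.seq (r3.seq (r4.seq (r5.seq r6))))).mono ?_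
  set B := A₁ + A₂ + A₃ + A₄ + A₅ + A₆ with hB
  have p1 : S ^ A₁ ≤ S ^ B := Kd.pow_mono_exp hS (by omega)
  have p2 : S ^ A₂ ≤ S ^ B := Kd.pow_mono_exp hS (by omega)
  have p3 : S ^ A₃ ≤ S ^ B := Kd.pow_mono_exp hS (by omega)
  have p4 : S ^ A₄ ≤ S ^ B := Kd.pow_mono_exp hS (by omega)
  have p5 : S ^ A₅ ≤ S ^ B := Kd.pow_mono_exp hS (by omega)
  have p6 : S ^ A₆ ≤ S ^ B := Kd.pow_mono_exp hS (by omega)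
  have p7 : S ^ B * 1 ≤ S ^ B * 3 ^ k := Nat.mul_le_mul_left _ (Nat.one_le_pow _ _ (by norm_num))
  have p8 : S ^ A₅ * 3 ^ (k + 1) ≤ 3 * (S ^ B * 3 ^ k) := by
    rw [pow_succ]
    have := Nat.mul_le_mul_right (3 ^ k) p5
    nlinarith
  have p9 : 8 * S ^ B ≤ S ^ (B + 3) := le_pow_add hS 3 le_rfl
  have p10 := Nat.mul_le_mul_right (3 ^ k) p9
  rw [mul_assoc] at p10
  omega

theorem rep_init (x : List ℕ) (ω : ℕ → Bool) : Rep (init x ω) (init x ω) := ⟨fun _ => rfl, rfl, rfl⟩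

theorem accepts_iff (h : ∃ T, Runs steinerCmd (init I.encode ω) T) :
    Accepts (steinerCmd.comp 0) I.encode ω ↔ (steinerCmd.den (init I.encode ω)).reg 0 = 1 := by
  obtain ⟨T, hT⟩ := h
  obtain ⟨s', t, h1, -, h2, -⟩ := hT 0 _ (rep_init _ _)
  have h0 : s'.reg 0 = (steinerCmd.den (init I.encode ω)).reg 0 := h2.reg 0
  rw [← h0]
  exact ⟨fun ⟨s, t', h3, h4⟩ => (h1.det h3) ▸ h4, fun h => ⟨s', t, h1, h⟩⟩

end RAM

/-! ### The main theorem -/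

theorem mainTheorem5 :
    ∃ P : RAM.Program, ∀ q : Polynomial ℕ, ∃ p : Polynomial ℕ, ∀ (I : SteinerInput) (k : ℕ),
      (∀ v, I.cost v ≤ q.eval I.n) →
      (∀ D ∈ I.decompositions, D.decomposition.width ≤ k) →
        (∀ ω, RAM.HaltsWithin P I.encode ω (p.eval (RAM.inputSize I.encode) * 3 ^ k)) ∧
        (¬ I.HasSolution → ∀ ω, ¬ RAM.Accepts P I.encode ω) ∧
        (I.HasSolution → RAM.fairCoins {ω | ¬ RAM.Accepts P I.encode ω} ≤ 1 / 2) := by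
  obtain ⟨A, hA⟩ := RAM.exists_steinerCmd_runs
  -- The parameter `S` is the input size plus `q` of the input size plus 2: it is at least 2 and
  -- bounds both the input size and, as `q` is monotone, the costs.
  refine ⟨RAM.steinerCmd.comp 0, fun q => ⟨(Polynomial.X + q + 2) ^ A, fun I k hq hk => ?_⟩⟩
  have hmono : q.eval I.n ≤ q.eval (RAM.inputSize I.encode) := by
    rw [Polynomial.eval_eq_sum_range, Polynomial.eval_eq_sum_range]
    exact Finset.sum_le_sum fun i _ => Nat.mul_le_mul_left _
      (Nat.pow_le_pow_left (I.n_le_length.trans (length_le_inputSize _)) i)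
  have hp : ((Polynomial.X + q + 2) ^ A).eval (RAM.inputSize I.encode) =
      (RAM.inputSize I.encode + q.eval (RAM.inputSize I.encode) + 2) ^ A := by
    simp
  have hruns : ∀ ω, RAM.Runs RAM.steinerCmd (RAM.init I.encode ω)
      (((Polynomial.X + q + 2) ^ A).eval (RAM.inputSize I.encode) * 3 ^ k) := by
    rw [hp]
    exact hA (by omega) (by omega) (fun v => (hq v).trans (by omega)) hk
  simp only [RAM.accepts_iff ⟨_, hruns _⟩]
  refine ⟨fun ω => ?_, fun h ω h1 => h (RAM.hasSolution_of_answer h1), RAM.prob_reject_le⟩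
  obtain ⟨s', t, h1, h2, -⟩ := hruns ω 0 _ (RAM.rep_init _ _)
  exact ⟨s', t, h1, h2⟩
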